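/- Write $x^\perp=(-x_2,x_1)$ for $x\in\mathbb R^2$ and let $$G(\xi)=\frac1{4\pi}e^{-|\xi|^2/4},\qquad v^G(\xi)=\frac1{2\pi}\frac{\xi^\perp}{|\xi|^2}\bigl(1-e^{-|\xi|^2/4}\bigr)\qquad(\xi\in\mathbb R^2,\ v^G(0)=0).$$ Let $Y$ be the space of real functions $w\in L^2(\mathbb R^2)$ with $\|w\|_Y^2=\int_{\mathbb R^2}|w(\xi)|^2e^{|\xi|^2/4}\,d\xi<\infty$, and let $Z$ be the space of functions $w:\mathbb R^2\to\mathbb R$ such that $e^{|\xi|^2/8}w$ belongs to the Schwartz space $\mathcal S(\mathbb R^2)$. For $n\in\mathbb N$ let $Y_n=P_nY$, where $P_n$ is the orthogonal projection in $Y$ given in polar coordinates by $$(P_nw)(r\cos\theta,r\sin\theta)=\frac{2-\delta_{n,0}}{2\pi}\int_0^{2\pi}w(r\cos\theta',r\sin\theta')\cos(n(\theta-\theta'))\,d\theta'.$$ For $w\in Z$ put $$\mathcal Lw=\Delta w+\tfrac12\,\xi\cdot\nabla w+w,\qquad \Lambda w=v^G\cdot\nabla w+v\cdot\nabla G,\qquad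 v(\xi)=\frac1{2\pi}\int_{\mathbb R^2}\frac{(\xi-\eta)^\perp}{|\xi-\eta|^2}\,w(\eta)\,d\eta .$$ **Lemma 3.4.** Let $n\ge2$ and $z\in Y_n\cap Z$. Then there is a unique $w\in Y_n\cap Z$ with $\Lambda w=z$. For every real $\varepsilon\ne0$ the equation $$\varepsilon(1-\mathcal L)w^\varepsilon+\Lambda w^\varepsilon=z$$ has a unique solution $w^\varepsilon\in Y_n\cap Z$. Moreover, there exists a constant $C>0$, depending on $z$ but not on $\varepsilon$, such that $$\|w^\varepsilon-w\|_Y\le\frac{C|\varepsilon|}{1+|\varepsilon|}\qquad\text{for all }\varepsilon\ne0 .$$ -/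

import Mathlib

open scoped SchwartzMap

namespace OseenVortex

noncomputable section

/-- The plane `ℝ²` with its Euclidean norm. -/
abbrev Plane : Type := EuclideanSpace ℝ (Fin 2)

/-- `x^⊥ = (-x₂, x₁)`. -/
def perp (x : Plane) : Plane := !₂[-x 1, x 0]

/-- The point with polar coordinates `(r, θ)`. -/
def polarPt (r θ : ℝ) : Plane := !₂[r * Real.cos θ, r * Real.sin θ]

/-- A polar angle of `ξ`; its choice is irrelevant where it is used below. -/
def angle (ξ : Plane) : ℝ := Complex.arg ⟨ξ 0, ξ 1⟩

/-- The Gaussian vorticity profile `G(ξ) = (4π)⁻¹ e^{-|ξ|²/4}`. -/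
def G (ξ : Plane) : ℝ := 1 / (4 * Real.pi) * Real.exp (-‖ξ‖ ^ 2 / 4)

/-- Its velocity field `v^G(ξ) = (2π)⁻¹ |ξ|⁻² (1 - e^{-|ξ|²/4}) ξ^⊥`, with value `0` at the
origin, where it extends continuously. -/
def vG (ξ : Plane) : Plane :=
  (1 / (2 * Real.pi) * ((1 - Real.exp (-‖ξ‖ ^ 2 / 4)) / ‖ξ‖ ^ 2)) • perp ξ

/-- The two-dimensional Biot-Savart law
`v(ξ) = (2π)⁻¹ ∫ (ξ - η)^⊥ |ξ - η|⁻² w(η) dη`. -/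
def biotSavart (w : Plane → ℝ) (ξ : Plane) : Plane :=
  (1 / (2 * Real.pi)) • ∫ η : Plane, (w η / ‖ξ - η‖ ^ 2) • perp (ξ - η)

/-- `Λ w = v^G · ∇w + v · ∇G`, where `v` is the velocity field of `w`; here `u · ∇f` is the
derivative of `f` in the direction `u`. -/
def Lam (w : Plane → ℝ) (ξ : Plane) : ℝ :=
  fderiv ℝ w ξ (vG ξ) + fderiv ℝ G ξ (biotSavart w ξ)

/-- `𝓛 w = Δw + ½ ξ · ∇w + w`. -/
def calL (w : Plane → ℝ) (ξ : Plane) : ℝ :=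
  Laplacian.laplacian w ξ + 1 / 2 * fderiv ℝ w ξ ξ + w ξ

/-- (Representatives of) the elements of the weighted space
`Y = {w ∈ L²(ℝ²) | ∫ |w|² e^{|ξ|²/4} dξ < ∞}`. -/
def Y : Set (Plane → ℝ) :=
  {w | MeasureTheory.MemLp w 2 MeasureTheory.volume ∧
    MeasureTheory.Integrable (fun ξ => w ξ ^ 2 * Real.exp (‖ξ‖ ^ 2 / 4)) MeasureTheory.volume}

/-- The norm of `Y`. -/
def normY (w : Plane → ℝ) : ℝ :=
  Real.sqrt (∫ ξ : Plane, w ξ ^ 2 * Real.exp (‖ξ‖ ^ 2 / 4))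

/-- The orthogonal projection `P_n` of `Y` onto the functions of angular frequency `n`:
`(P_n w)(r cos θ, r sin θ)
  = (2 - δ_{n,0}) / (2π) ∫₀^{2π} w(r cos θ', r sin θ') cos(n(θ - θ')) dθ'`. -/
def P (n : ℕ) (w : Plane → ℝ) (ξ : Plane) : ℝ :=
  (2 - if n = 0 then 1 else 0) / (2 * Real.pi) *
    ∫ θ' in (0 : ℝ)..(2 * Real.pi),
      w (polarPt ‖ξ‖ θ') * Real.cos (n * (angle ξ - θ'))

/-- `Y_n = P_n Y`: as `P_n` is a projection of `Y`, its range is its set of fixed points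
(equality in `Y` is equality almost everywhere). -/
def Yn (n : ℕ) : Set (Plane → ℝ) :=
  {w | w ∈ Y ∧ P n w =ᵐ[MeasureTheory.volume] w}

/-- `Z`: the functions `w` for which `e^{|ξ|²/8} w` is a Schwartz function. -/
def Z : Set (Plane → ℝ) :=
  {w | ∃ f : 𝓢(Plane, ℝ), ∀ ξ, Real.exp (‖ξ‖ ^ 2 / 8) * w ξ = f ξ}

end

end OseenVortex

open OseenVortex

namespace OseenVortex

open scoped LineDeriv Topology FourierTransform
open MeasureTheory Filter

noncomputable section

/-! ### Method of continuity -/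

section Continuity

variable {E F : Type*} [AddCommGroup E] [Module ℝ E] [AddCommGroup F] [Module ℝ F]

/-! Write γ = e^{-|x|²/8}. Multiplication by γ maps the Schwartz space bijectively onto `Z` and
turns the norm of `Y` into the plain L² norm (`mem_Z_iff`, `normY_wgt`). Under this conjugation 1 -
𝓛 becomes the harmonic oscillator H = -Δ + |x|²/16 + 1/2 (`wgt_sub_calL`), and Λ becomes an operator
A that is skew for the L² pairing (`Lam_wgt`, `ip_vorA`). Functions of angular frequency n are
described by the relation f∘R_α + f∘R_{-α} = 2 cos(nα) f (`modeS`, `wgt_mem_Yn_iff`), which every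
operator commuting with rotations preserves.

Regularised equation. By skewness, pairing (εH + sA)u with u leaves ε⟨Hu, u⟩, so the energy estimate
does not see A. Elliptic regularity for H promotes it to estimates in all the weighted Sobolev
seminorms `sob k`, uniform for s in [0, 1] (`sob_succ_le_of_skew`). These seminorms control the
Schwartz seminorms (`seminorm_le_sob`), and H has dense range because it is triangular on
polynomials times γ (`oscH_dense_range`). The method of continuity then solves the equation in the
Schwartz space (`exists_oscH_add_vorA_eq`), and uniqueness puts the solution in the right angular
mode.

Limit equation. On mode n the unknown U = ∂_θ u determines u, and Au = f reads U + `nlQ n` U = F,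
where F is f divided by the angular velocity profile and `nlQ n` is nonlocal. For a vorticity ω of
mode n, expanding the Biot-Savart kernel in polar coordinates gives |x · (K ∗ ω)| ≤ (2π/n) sup
|x|²|ω| (`abs_bsDot_le`). Together with |x|²γ²/`prof` ≤ 31/10, where 31/10 < 4 ≤ n², this is a
strict contraction estimate on the normalised velocity (`abs_normalised_apriori`); this is where n ≥
2 enters. The Biot-Savart operator gains a derivative up to an arbitrarily small error, so the bound
passes to every `sob k`, and the method of continuity again gives solvability (`exists_add_nlQ_eq`,
`exists_vorA_eq`).

Convergence. Let Au₀ = f, and choose u₁ with Au₁ = Hu₀. The energy estimate for u^ε - u₀ gives a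
bound independent of ε; for u^ε - u₀ + εu₁ the right-hand side is ε²Hu₁, which gives a bound of
order |ε|. The two combine to |ε|/(1 + |ε|) (`exists_sob_zero_sub_le`). -/

lemma exists_approx_of_half {T : E →ₗ[ℝ] F} {q : Seminorm ℝ F}
    (h : ∀ f, ∀ η > 0, ∃ u, q (f - T u) ≤ q f / 2 + η) (f : F) {η : ℝ} (hη : 0 < η) :
    ∃ u, q (f - T u) < η := by
  -- Each application to the current residual halves it. Spending η/4 each time keeps the
  -- accumulated error at η/2, the fixed point of t ↦ t/2 + η/4.
  have key : ∀ m : ℕ, ∃ u, q (f - T u) ≤ q f / 2 ^ m + η / 2 := by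
    intro m
    induction m with
    | zero => exact ⟨0, by simp; positivity⟩
    | succ m ih =>
      obtain ⟨u, hu⟩ := ih
      obtain ⟨v, hv⟩ := h (f - T u) (η / 4) (by positivity)
      refine ⟨u + v, ?_⟩
      rw [map_add, ← sub_sub]
      refine hv.trans ?_
      rw [pow_succ]
      have : q f / (2 ^ m * 2) = q f / 2 ^ m / 2 := by rw [div_div]
      rw [this]; linarith
  have ht : Tendsto (fun m : ℕ => q f * (1 / 2 : ℝ) ^ m) atTop (𝓝 0) := by
    simpa using (tendsto_pow_atTop_nhds_zero_of_lt_one (r := (1 / 2 : ℝ)) (by norm_num)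
      (by norm_num)).const_mul (q f)
  obtain ⟨m, hm⟩ := (ht.eventually (gt_mem_nhds (half_pos hη))).exists
  obtain ⟨u, hu⟩ := key m
  refine ⟨u, hu.trans_lt ?_⟩
  have : q f / 2 ^ m = q f * (1 / 2 : ℝ) ^ m := by rw [one_div, inv_pow, div_eq_mul_inv]
  rw [this]; linarith

/-- Density of the range propagates along the segment `T + s Q`, by the method of continuity. -/
lemma dense_range_of_continuity (T Q : E →ₗ[ℝ] F) (p : Seminorm ℝ E) (q : Seminorm ℝ F)
    (hdense : ∀ f, ∀ δ > 0, ∃ u, q (f - T u) < δ)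
    (hapr : ∃ C, ∀ s ∈ Set.Icc (0 : ℝ) 1, ∀ u, p u ≤ C * q (T u + s • Q u))
    (hQ : ∃ C, ∀ u, q (Q u) ≤ C * p u) (f : F) {δ : ℝ} (hδ : 0 < δ) :
    ∃ u, q (f - (T u + Q u)) < δ := by
  obtain ⟨C₁, hC₁⟩ := hapr
  obtain ⟨C₂, hC₂⟩ := hQ
  set K : ℝ := |C₂| * |C₁| with hK
  have hbound : ∀ s ∈ Set.Icc (0 : ℝ) 1, ∀ u, q (Q u) ≤ K * q (T u + s • Q u) := by
    intro s hs u
    calc q (Q u) ≤ C₂ * p u := hC₂ u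
      _ ≤ |C₂| * p u := by gcongr; exact le_abs_self _
      _ ≤ |C₂| * (|C₁| * q (T u + s • Q u)) := by
          gcongr
          exact (hC₁ s hs u).trans (by gcongr; exact le_abs_self _)
      _ = K * q (T u + s • Q u) := by rw [hK]; ring
  have hK0 : 0 ≤ K := by positivity
  -- The constant K bounds Q relative to T + sQ uniformly in s. With N > 2K, moving s by 1/N changes
  -- the operator by at most half of its own size, so near-solvability at i/N yields a halved
  -- residual at (i+1)/N.
  obtain ⟨N, hN⟩ := exists_nat_gt (2 * K)
  have hN0 : (0 : ℝ) < N := by linarith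
  have hstep : (1 / N : ℝ) * K ≤ 1 / 2 := by
    rw [div_mul_eq_mul_div, div_le_iff₀ hN0]; linarith
  have main : ∀ i : ℕ, i ≤ N → ∀ f, ∀ δ > 0, ∃ u, q (f - (T u + (i / N : ℝ) • Q u)) < δ := by
    intro i
    induction i with
    | zero => intro _ f δ hδ; simpa using hdense f δ hδ
    | succ i ih =>
      intro hi f δ hδ
      have hs : (i / N : ℝ) ∈ Set.Icc (0 : ℝ) 1 := by
        refine ⟨by positivity, ?_⟩
        rw [div_le_one hN0]; exact_mod_cast (Nat.le_of_succ_le hi)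
      refine exists_approx_of_half (T := T + ((i + 1 : ℕ) / N : ℝ) • Q) (q := q) ?_ f hδ
      intro g η hη
      obtain ⟨v, hv⟩ := ih (Nat.le_of_succ_le hi) g (η / 2) (by positivity)
      refine ⟨v, ?_⟩
      set Tv := T v + (i / N : ℝ) • Q v with hTv
      have e1 : g - (T + ((i + 1 : ℕ) / N : ℝ) • Q) v = (g - Tv) - (1 / N : ℝ) • Q v := by
        simp only [LinearMap.add_apply, LinearMap.smul_apply, hTv]
        push_cast
        rw [add_div, add_smul]; abel
      have e2 : q Tv ≤ q g + η / 2 := by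
        have : q Tv ≤ q g + q (g - Tv) := by
          have := map_sub_le_add q g (g - Tv)
          simpa using this
        linarith
      have e3 : q ((1 / N : ℝ) • Q v) ≤ 1 / 2 * (q g + η / 2) := by
        rw [map_smul_eq_mul, Real.norm_of_nonneg (by positivity)]
        calc (1 / N : ℝ) * q (Q v) ≤ 1 / N * (K * q Tv) := by gcongr; exact hbound _ hs v
          _ = (1 / N * K) * q Tv := by ring
          _ ≤ 1 / 2 * (q g + η / 2) := by gcongr
      rw [e1]
      have := map_sub_le_add q (g - Tv) ((1 / N : ℝ) • Q v)
      linarith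
  have := main N le_rfl f δ hδ
  simpa only [div_self hN0.ne', one_smul] using this

/-- The method of continuity for a space that is complete for a sequence of seminorms. -/
theorem surjective_of_continuity (T Q : E →ₗ[ℝ] F) (p : ℕ → Seminorm ℝ E) (q : ℕ → Seminorm ℝ F)
    (hdense : ∀ k f, ∀ δ > 0, ∃ u, q k (f - T u) < δ)
    (hapr : ∀ k, ∃ C, ∀ s ∈ Set.Icc (0 : ℝ) 1, ∀ u, p k u ≤ C * q k (T u + s • Q u))
    (hT : ∀ k, ∃ C, ∀ u, q k (T u) ≤ C * p k u)
    (hQ : ∀ k, ∃ C, ∀ u, q k (Q u) ≤ C * p k u)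
    (hq : Monotone q)
    (hcompl : ∀ u : ℕ → E, (∀ k, ∀ η > 0, ∃ N, ∀ m ≥ N, ∀ l ≥ N, p k (u m - u l) < η) →
      ∃ v, ∀ k, Tendsto (fun m => p k (u m - v)) atTop (𝓝 0))
    (hsep : ∀ f, q 0 f = 0 → f = 0) (f : F) : ∃ u, T u + Q u = f := by
  have hd : ∀ k : ℕ, ∃ u, q k (f - (T u + Q u)) < 1 / ((k : ℝ) + 1) := fun k =>
    dense_range_of_continuity T Q (p k) (q k) (hdense k) (hapr k) (hQ k) f (by positivity)
  choose u hu using hd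
  have hu' : ∀ k m, k ≤ m → q k (f - (T (u m) + Q (u m))) < 1 / ((m : ℝ) + 1) := fun k m h =>
    (hq h _).trans_lt (hu m)
  -- The estimate at s = 1 turns closeness of the images in q k into closeness of the approximate
  -- solutions in p k. Monotonicity of q lets u m, which was chosen for the seminorm q m, serve all
  -- k ≤ m at once.
  obtain ⟨v, hv⟩ := hcompl u (by
    intro k η hη
    obtain ⟨C, hC⟩ := hapr k
    obtain ⟨M, hM⟩ := exists_nat_gt ((2 * (|C| + 1)) / η)
    have hM0 : (0 : ℝ) < M + 1 := by positivity
    refine ⟨max k M, fun m hm l hl => ?_⟩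
    have h1 : ∀ m ≥ max k M, q k (f - (T (u m) + Q (u m))) < 1 / ((M : ℝ) + 1) := by
      intro m hm
      refine (hu' k m ((le_max_left _ _).trans hm)).trans_le ?_
      gcongr
      exact (le_max_right _ _).trans hm
    have h2 := hC 1 ⟨zero_le_one, le_rfl⟩ (u m - u l)
    have e : T (u m - u l) + (1 : ℝ) • Q (u m - u l)
        = (f - (T (u l) + Q (u l))) - (f - (T (u m) + Q (u m))) := by
      simp only [map_sub, one_smul]; abel
    rw [e] at h2
    have h3 := map_sub_le_add (q k) (f - (T (u l) + Q (u l))) (f - (T (u m) + Q (u m)))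
    have h4 := h1 m hm
    have h5 := h1 l hl
    calc p k (u m - u l) ≤ _ := h2
      _ ≤ (|C| + 1) * q k ((f - (T (u l) + Q (u l))) - (f - (T (u m) + Q (u m)))) := by
          gcongr; linarith [le_abs_self C]
      _ ≤ (|C| + 1) * (2 / (M + 1)) := by
          gcongr; refine h3.trans ?_
          have : (2 : ℝ) / (M + 1) = 1 / (M + 1) + 1 / (M + 1) := by ring
          linarith
      _ < η := by
          rw [← mul_div_assoc, div_lt_iff₀ hM0]
          rw [div_lt_iff₀ hη] at hM
          nlinarith [abs_nonneg C])
  refine ⟨v, ?_⟩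
  obtain ⟨C₁, hC₁⟩ := hT 0
  obtain ⟨C₂, hC₂⟩ := hQ 0
  have hlim : Tendsto (fun m : ℕ => 1 / ((m : ℝ) + 1) + (C₁ + C₂) * p 0 (u m - v)) atTop (𝓝 0) := by
    simpa using tendsto_one_div_add_atTop_nhds_zero_nat.add ((hv 0).const_mul (C₁ + C₂))
  have hle : ∀ m : ℕ, q 0 (f - (T v + Q v)) ≤ 1 / ((m : ℝ) + 1) + (C₁ + C₂) * p 0 (u m - v) := by
    intro m
    have e : f - (T v + Q v) = (f - (T (u m) + Q (u m))) + (T (u m - v) + Q (u m - v)) := by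
      simp only [map_sub]; abel
    rw [e]
    have h1 := map_add_le_add (q 0) (f - (T (u m) + Q (u m))) (T (u m - v) + Q (u m - v))
    have h2 := map_add_le_add (q 0) (T (u m - v)) (Q (u m - v))
    have := hC₁ (u m - v); have := hC₂ (u m - v); have := hu' 0 m (Nat.zero_le _)
    linarith
  have h0 : q 0 (f - (T v + Q v)) = 0 :=
    le_antisymm (ge_of_tendsto' hlim hle) (apply_nonneg _ _)
  exact (sub_eq_zero.1 (hsep _ h0)).symm

end Continuity

/-! ### Completeness of the Schwartz space -/

section Complete

universe u

lemma uniformCauchySeqOn_of_seminorm {E F : Type*} [NormedAddCommGroup E] [NormedSpace ℝ E]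
    [NormedAddCommGroup F] [NormedSpace ℝ F] (u : ℕ → 𝓢(E, F))
    (hu : ∀ η > 0, ∃ N, ∀ m ≥ N, ∀ l ≥ N, SchwartzMap.seminorm ℝ 0 0 (u m - u l) < η) :
    UniformCauchySeqOn (fun m x => u m x) atTop Set.univ := by
  rw [Metric.uniformCauchySeqOn_iff]
  intro η hη
  obtain ⟨N, hN⟩ := hu η hη
  refine ⟨N, fun m hm l hl x _ => ?_⟩
  rw [dist_eq_norm]
  exact ((u m - u l).norm_le_seminorm ℝ x).trans_lt (hN m hm l hl)

lemma seminorm_fderivCLM {E F : Type*} [NormedAddCommGroup E] [NormedSpace ℝ E]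
    [NormedAddCommGroup F] [NormedSpace ℝ F] (k n : ℕ) (u : 𝓢(E, F)) :
    SchwartzMap.seminorm ℝ k n (SchwartzMap.fderivCLM ℝ E F u) =
      SchwartzMap.seminorm ℝ k (n + 1) u := by
  have h : ∀ x, ‖iteratedFDeriv ℝ n (SchwartzMap.fderivCLM ℝ E F u) x‖
      = ‖iteratedFDeriv ℝ (n + 1) u x‖ := fun x => by
    rw [← norm_iteratedFDeriv_fderiv]; rfl
  apply le_antisymm
  · refine SchwartzMap.seminorm_le_bound ℝ _ _ _ (apply_nonneg _ _) fun x => ?_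
    rw [h]; exact u.le_seminorm ℝ _ _ _
  · refine SchwartzMap.seminorm_le_bound ℝ _ _ _ (apply_nonneg _ _) fun x => ?_
    rw [← h]; exact (SchwartzMap.fderivCLM ℝ E F u).le_seminorm ℝ _ _ _

/-- The pointwise limit of a sequence that is Cauchy for the Schwartz seminorms. -/
lemma exists_limit_iteratedFDeriv {E : Type u} [NormedAddCommGroup E] [NormedSpace ℝ E] (n : ℕ) :
    ∀ {F : Type u} [NormedAddCommGroup F] [NormedSpace ℝ F] [CompleteSpace F] (u : ℕ → 𝓢(E, F))
      (_ : ∀ j ≤ n, ∀ η > 0, ∃ N, ∀ m ≥ N, ∀ l ≥ N, SchwartzMap.seminorm ℝ 0 j (u m - u l) < η)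
      (g : E → F) (_ : ∀ x, Tendsto (fun m => u m x) atTop (𝓝 (g x))),
      ContDiff ℝ n g ∧
        ∀ j ≤ n, ∀ x, Tendsto (fun m => iteratedFDeriv ℝ j (u m) x) atTop
          (𝓝 (iteratedFDeriv ℝ j g x)) := by
  induction n with
  | zero =>
    intro F _ _ _ u hu g hg
    have hc := uniformCauchySeqOn_of_seminorm u (hu 0 le_rfl)
    have hU : TendstoUniformlyOn (fun m x => u m x) g atTop Set.univ :=
      hc.tendstoUniformlyOn_of_tendsto fun x _ => hg x
    refine ⟨?_, ?_⟩
    · simp only [Nat.cast_zero, contDiff_zero]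
      exact (tendstoUniformlyOn_univ.1 hU).continuous
        (Frequently.of_forall fun m => (u m).continuous)
    · intro j hj x
      obtain rfl : j = 0 := by omega
      simp only [iteratedFDeriv_zero_eq_comp, Function.comp_apply]
      exact ((continuousMultilinearCurryFin0 ℝ E F).symm.continuous.tendsto _).comp (hg x)
  | succ n ih =>
    intro F _ _ _ u hu g hg
    -- The induction hypothesis is applied to the derivatives, which take values in `E →L[ℝ] F`.
    -- This is why F varies inside the induction and shares the universe of E.
    let u' : ℕ → 𝓢(E, E →L[ℝ] F) := fun m => SchwartzMap.fderivCLM ℝ E F (u m)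
    have hcau : ∀ j ≤ n, ∀ η > 0, ∃ N, ∀ m ≥ N, ∀ l ≥ N,
        SchwartzMap.seminorm ℝ 0 j (u' m - u' l) < η := by
      intro j hj η hη
      obtain ⟨N, hN⟩ := hu (j + 1) (by omega) η hη
      refine ⟨N, fun m hm l hl => ?_⟩
      simp only [u']
      rw [← map_sub, seminorm_fderivCLM]
      exact hN m hm l hl
    have hc := uniformCauchySeqOn_of_seminorm u' (hcau 0 (Nat.zero_le _))
    have hex : ∀ x, ∃ y, Tendsto (fun m => u' m x) atTop (𝓝 y) := fun x =>
      cauchySeq_tendsto_of_complete (hc.cauchySeq (Set.mem_univ x))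
    choose g' hg' using hex
    have hU : TendstoUniformlyOn (fun m x => u' m x) g' atTop Set.univ :=
      hc.tendstoUniformlyOn_of_tendsto fun x _ => hg' x
    have hfd : ∀ x, HasFDerivAt g (g' x) x :=
      hasFDerivAt_of_tendstoUniformly (tendstoUniformlyOn_univ.1 hU)
        (fun m x => (u m).hasFDerivAt x) hg
    obtain ⟨h1, h2⟩ := ih u' hcau g' hg'
    have hfe : fderiv ℝ g = g' := funext fun x => (hfd x).fderiv
    refine ⟨?_, ?_⟩
    · push_cast
      rw [contDiff_succ_iff_fderiv]
      exact ⟨fun x => (hfd x).differentiableAt, by simp, by rw [hfe]; exact h1⟩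
    · intro j hj x
      rcases j with _ | j
      · simp only [iteratedFDeriv_zero_eq_comp, Function.comp_apply]
        exact ((continuousMultilinearCurryFin0 ℝ E F).symm.continuous.tendsto _).comp (hg x)
      · simp only [iteratedFDeriv_succ_eq_comp_right, Function.comp_apply, hfe]
        exact ((continuousMultilinearCurryRightEquiv' ℝ j E F).symm.continuous.tendsto _).comp
          (h2 j (by omega) x)

theorem exists_schwartz_limit {E F : Type u} [NormedAddCommGroup E] [NormedSpace ℝ E]
    [NormedAddCommGroup F] [NormedSpace ℝ F] [CompleteSpace F] (u : ℕ → 𝓢(E, F))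
    (hu : ∀ k n, ∀ η > 0, ∃ N, ∀ m ≥ N, ∀ l ≥ N, SchwartzMap.seminorm ℝ k n (u m - u l) < η) :
    ∃ v : 𝓢(E, F), ∀ k n, Tendsto (fun m => SchwartzMap.seminorm ℝ k n (u m - v)) atTop (𝓝 0) := by
  have hc := uniformCauchySeqOn_of_seminorm u (hu 0 0)
  have hex : ∀ x, ∃ y, Tendsto (fun m => u m x) atTop (𝓝 y) := fun x =>
    cauchySeq_tendsto_of_complete (hc.cauchySeq (Set.mem_univ x))
  choose g hg using hex
  have hlim := fun n => exists_limit_iteratedFDeriv n u (fun j _ => hu 0 j) g hg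
  have hsm : ContDiff ℝ (⊤ : ℕ∞) g := contDiff_infty.2 fun n => (hlim n).1
  have hsub : ∀ (f h : 𝓢(E, F)) (n : ℕ) (x : E), iteratedFDeriv ℝ n (f - h) x =
      iteratedFDeriv ℝ n f x - iteratedFDeriv ℝ n h x := fun f h n x => by
    rw [FunLike.coe_sub, iteratedFDeriv_sub_apply (f.smooth n).contDiffAt (h.smooth n).contDiffAt]
  have hbd : ∀ k n, ∀ η > 0, ∃ N, ∀ m ≥ N, ∀ x,
      ‖x‖ ^ k * ‖iteratedFDeriv ℝ n (u m) x - iteratedFDeriv ℝ n g x‖ ≤ η := by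
    intro k n η hη
    obtain ⟨N, hN⟩ := hu k n η hη
    refine ⟨N, fun m hm x => ?_⟩
    -- Letting l tend to infinity at a fixed point turns the Cauchy estimate into an estimate
    -- against the limit, uniform in the point.
    have ht : Tendsto (fun l => ‖x‖ ^ k * ‖iteratedFDeriv ℝ n (u m) x - iteratedFDeriv ℝ n (u l) x‖)
        atTop (𝓝 (‖x‖ ^ k * ‖iteratedFDeriv ℝ n (u m) x - iteratedFDeriv ℝ n g x‖)) :=
      (((hlim n).2 n le_rfl x).const_sub _).norm.const_mul _
    refine le_of_tendsto ht ?_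
    filter_upwards [eventually_ge_atTop N] with l hl
    have := (u m - u l).le_seminorm ℝ k n x
    rw [hsub] at this
    exact this.trans (hN m hm l hl).le
  let v : 𝓢(E, F) :=
    { toFun := g
      smooth' := hsm
      decay' := fun k n => by
        obtain ⟨N, hN⟩ := hbd k n 1 one_pos
        refine ⟨SchwartzMap.seminorm ℝ k n (u N) + 1, fun x => ?_⟩
        have h1 := hN N le_rfl x
        have h2 := (u N).le_seminorm ℝ k n x
        have h3 : ‖iteratedFDeriv ℝ n g x‖ ≤ ‖iteratedFDeriv ℝ n (u N) x‖ +
            ‖iteratedFDeriv ℝ n (u N) x - iteratedFDeriv ℝ n g x‖ := by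
          have := norm_sub_le (iteratedFDeriv ℝ n (u N) x)
            (iteratedFDeriv ℝ n (u N) x - iteratedFDeriv ℝ n g x)
          simpa using this
        calc ‖x‖ ^ k * ‖iteratedFDeriv ℝ n g x‖ ≤ ‖x‖ ^ k * (‖iteratedFDeriv ℝ n (u N) x‖ +
            ‖iteratedFDeriv ℝ n (u N) x - iteratedFDeriv ℝ n g x‖) := by gcongr
          _ ≤ _ := by rw [mul_add]; linarith }
  refine ⟨v, fun k n => ?_⟩
  rw [Metric.tendsto_atTop]
  intro η hη
  obtain ⟨N, hN⟩ := hbd k n (η / 2) (by positivity)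
  refine ⟨N, fun m hm => ?_⟩
  rw [Real.dist_eq, sub_zero, abs_of_nonneg (apply_nonneg _ _)]
  refine lt_of_le_of_lt ?_ (half_lt_self hη)
  refine SchwartzMap.seminorm_le_bound ℝ _ _ _ (by positivity) fun x => ?_
  rw [hsub]
  exact hN m hm x

end Complete

/-! ### Derivatives, multiplications and the L² pairing on Schwartz functions -/

/-- Real Schwartz functions on the plane. -/
abbrev Sch : Type := 𝓢(Plane, ℝ)

/-- The standard basis of the plane. -/
def unitVec (i : Fin 2) : Plane := EuclideanSpace.single i 1

/-- Partial derivatives on Schwartz functions. -/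
def pd (i : Fin 2) : Sch →L[ℝ] Sch := LineDeriv.lineDerivOpCLM ℝ Sch (unitVec i)

/-- Multiplication of Schwartz functions by a function of temperate growth. -/
def mulS (g : Plane → ℝ) : Sch →L[ℝ] Sch := SchwartzMap.smulLeftCLM ℝ g

/-- Multiplication of Schwartz functions by a coordinate. -/
def xm (i : Fin 2) : Sch →L[ℝ] Sch := mulS (fun x => x i)

lemma coord_temperate (i : Fin 2) : (fun x : Plane => x i).HasTemperateGrowth :=
  (EuclideanSpace.proj (𝕜 := ℝ) i : Plane →L[ℝ] ℝ).hasTemperateGrowth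

lemma pd_apply (i : Fin 2) (f : Sch) (x : Plane) : pd i f x = fderiv ℝ f x (unitVec i) := by
  simp [pd, SchwartzMap.lineDerivOp_apply_eq_fderiv]

lemma mulS_apply {g : Plane → ℝ} (hg : g.HasTemperateGrowth) (f : Sch) (x : Plane) :
    mulS g f x = g x * f x := by
  simp [mulS, SchwartzMap.smulLeftCLM_apply_apply hg]

lemma xm_apply (i : Fin 2) (f : Sch) (x : Plane) : xm i f x = x i * f x :=
  mulS_apply (coord_temperate i) f x

lemma hasTemperateGrowth_fderiv_apply {g : Plane → ℝ} (hg : g.HasTemperateGrowth) (v : Plane) :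
    (fun x => fderiv ℝ g x v).HasTemperateGrowth := by
  have h : (fderiv ℝ g).HasTemperateGrowth := by
    refine ⟨(contDiff_infty_iff_fderiv.1 hg.1).2, fun n => ?_⟩
    obtain ⟨k, C, h⟩ := hg.2 (n + 1)
    refine ⟨k, C, fun x => ?_⟩
    rw [norm_iteratedFDeriv_fderiv]; exact h x
  exact ((ContinuousLinearMap.apply ℝ ℝ v).hasTemperateGrowth).comp h

lemma pd_mulS {g : Plane → ℝ} (hg : g.HasTemperateGrowth) (i : Fin 2) (f : Sch) :
    pd i (mulS g f) = mulS (fun x => fderiv ℝ g x (unitVec i)) f + mulS g (pd i f) := by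
  ext x
  have h : (⇑(mulS g f) : Plane → ℝ) = fun x => g x * f x := funext (mulS_apply hg f)
  rw [pd_apply, h, fderiv_fun_mul ((hg.1.differentiable (by simp)) x)
    (f.differentiable x)]
  change _ = mulS _ f x + mulS g (pd i f) x
  rw [mulS_apply hg, mulS_apply (hasTemperateGrowth_fderiv_apply hg _),
    pd_apply]
  simp only [add_apply, smul_apply, smul_eq_mul]
  ring

lemma fderiv_coord (j : Fin 2) (x v : Plane) : fderiv ℝ (fun x : Plane => x j) x v = v j := by
  have : (fun x : Plane => x j) = (EuclideanSpace.proj (𝕜 := ℝ) j : Plane →L[ℝ] ℝ) := rfl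
  rw [this, ContinuousLinearMap.fderiv]; rfl

lemma pd_xm (i j : Fin 2) (f : Sch) :
    pd i (xm j f) = (if i = j then f else 0) + xm j (pd i f) := by
  rw [xm, pd_mulS (coord_temperate j)]
  congr 1
  ext x
  rw [mulS_apply (hasTemperateGrowth_fderiv_apply (coord_temperate j) _), fderiv_coord]
  by_cases h : i = j
  · simp [unitVec, h]
  · simp [unitVec, h, Ne.symm h]

lemma xm_comm (i j : Fin 2) (f : Sch) : xm i (xm j f) = xm j (xm i f) := by
  ext x; simp only [xm_apply]; ring

lemma pd_comm (i j : Fin 2) (f : Sch) : pd i (pd j f) = pd j (pd i f) := by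
  ext x
  have h : ∀ a b : Fin 2, pd a (pd b f) x = fderiv ℝ (fderiv ℝ f) x (unitVec a) (unitVec b) := by
    intro a b
    have e : (⇑(pd b f) : Plane → ℝ) = fun x => fderiv ℝ f x (unitVec b) := funext (pd_apply b f)
    have hd : DifferentiableAt ℝ (fderiv ℝ f) x :=
      ((contDiff_infty_iff_fderiv.1 (f.smooth ⊤)).2.differentiable (by simp)) x
    rw [pd_apply, e, fderiv_clm_apply hd (differentiableAt_const _)]
    simp
  rw [h, h]
  exact (((f.smooth 2).contDiffAt).isSymmSndFDerivAt (by simp)) _ _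

/-- The `L²` inner product of Schwartz functions. -/
def ip (f g : Sch) : ℝ := ∫ x, f x * g x

lemma ip_eq_inner (f g : Sch) : ip f g = inner ℝ (f.toLp 2) (g.toLp 2) := by
  rw [ip, L2.inner_def]
  apply integral_congr_ae
  filter_upwards [f.coeFn_toLp 2, g.coeFn_toLp 2] with x hf hg
  rw [hf, hg]; simp [mul_comm]

lemma toLp_eq (f : Sch) : f.toLp 2 = SchwartzMap.toLpCLM ℝ ℝ 2 volume f := rfl

lemma ip_comm (f g : Sch) : ip f g = ip g f := by
  simp only [ip, mul_comm]

lemma ip_add_left (f g h : Sch) : ip (f + g) h = ip f h + ip g h := by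
  simp only [ip_eq_inner, toLp_eq, map_add, inner_add_left]

lemma ip_smul_left (c : ℝ) (f g : Sch) : ip (c • f) g = c * ip f g := by
  simp only [ip_eq_inner, toLp_eq, map_smul, real_inner_smul_left]

lemma ip_neg_left (f g : Sch) : ip (-f) g = -ip f g := by
  simp only [ip_eq_inner, toLp_eq, map_neg, inner_neg_left]

lemma ip_sub_right (f g h : Sch) : ip f (g - h) = ip f g - ip f h := by
  simp only [ip_eq_inner, toLp_eq, map_sub, inner_sub_right]

lemma ip_pd (i : Fin 2) (f g : Sch) : ip f (pd i g) = -ip (pd i f) g :=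
  SchwartzMap.integral_mul_lineDerivOp_right_eq_neg_left f g (unitVec i)

lemma ip_mulS {a : Plane → ℝ} (ha : a.HasTemperateGrowth) (f g : Sch) :
    ip f (mulS a g) = ip (mulS a f) g := by
  simp only [ip, mulS_apply ha]
  congr 1; ext x; ring

lemma ip_xm (i : Fin 2) (f g : Sch) : ip f (xm i g) = ip (xm i f) g :=
  ip_mulS (coord_temperate i) f g

/-! ### Weighted Sobolev seminorms -/

/-- Weighted Sobolev seminorms: all words of length at most `k` in the partial derivatives and the
multiplications by coordinates, measured in `L²`. -/
def sob : ℕ → Seminorm ℝ Sch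
  | 0 => (normSeminorm ℝ (Lp ℝ 2 (volume : Measure Plane))).comp
      (SchwartzMap.toLpCLM ℝ ℝ 2 volume : Sch →L[ℝ] Lp ℝ 2 (volume : Measure Plane)).toLinearMap
  | k + 1 => sob k + ∑ i : Fin 2, ((sob k).comp (pd i).toLinearMap + (sob k).comp (xm i).toLinearMap)

lemma sob_zero (f : Sch) : sob 0 f = ‖f.toLp 2‖ := rfl

lemma sob_succ (k : ℕ) (f : Sch) :
    sob (k + 1) f = sob k f + ∑ i : Fin 2, (sob k (pd i f) + sob k (xm i f)) := by
  rw [sob]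
  simp [Fin.sum_univ_two]

lemma ip_self (f : Sch) : ip f f = sob 0 f ^ 2 := by
  rw [ip_eq_inner, real_inner_self_eq_norm_sq, sob_zero]

lemma ip_le (f g : Sch) : |ip f g| ≤ sob 0 f * sob 0 g := by
  rw [ip_eq_inner, sob_zero, sob_zero]; exact abs_real_inner_le_norm _ _

lemma sob_zero_eq_sqrt (f : Sch) : sob 0 f = √(∫ x, f x ^ 2) := by
  have h := ip_self f
  rw [ip] at h
  simp only [← sq] at h
  rw [h, Real.sqrt_sq (apply_nonneg _ _)]

lemma sob_le_succ (k : ℕ) (f : Sch) : sob k f ≤ sob (k + 1) f := by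
  rw [sob_succ]
  have : 0 ≤ ∑ i : Fin 2, (sob k (pd i f) + sob k (xm i f)) :=
    Finset.sum_nonneg fun i _ => add_nonneg (apply_nonneg _ _) (apply_nonneg _ _)
  linarith

lemma sob_mono : Monotone sob := monotone_nat_of_le_succ fun k f => sob_le_succ k f

lemma sob_pd_le (k : ℕ) (i : Fin 2) (f : Sch) : sob k (pd i f) ≤ sob (k + 1) f := by
  rw [sob_succ]
  have h := Finset.single_le_sum (f := fun i : Fin 2 => sob k (pd i f) + sob k (xm i f))
    (fun i _ => add_nonneg (apply_nonneg _ _) (apply_nonneg _ _)) (Finset.mem_univ i)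
  have := apply_nonneg (sob k) f
  have := apply_nonneg (sob k) (xm i f)
  linarith

lemma sob_xm_le (k : ℕ) (i : Fin 2) (f : Sch) : sob k (xm i f) ≤ sob (k + 1) f := by
  rw [sob_succ]
  have h := Finset.single_le_sum (f := fun i : Fin 2 => sob k (pd i f) + sob k (xm i f))
    (fun i _ => add_nonneg (apply_nonneg _ _) (apply_nonneg _ _)) (Finset.mem_univ i)
  have := apply_nonneg (sob k) f
  have := apply_nonneg (sob k) (pd i f)
  linarith

lemma sob_continuous (k : ℕ) : Continuous (sob k) := by
  induction k with
  | zero => exact continuous_norm.comp (SchwartzMap.toLpCLM ℝ ℝ 2 volume).continuous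
  | succ k ih =>
    have : (sob (k + 1) : Sch → ℝ) =
        fun f => sob k f + ∑ i : Fin 2, (sob k (pd i f) + sob k (xm i f)) := funext (sob_succ k)
    rw [this]
    fun_prop

lemma sob_zero_eq_zero {f : Sch} (h : sob 0 f = 0) : f = 0 := by
  rw [sob_zero, norm_eq_zero] at h
  exact SchwartzMap.injective_toLp 2 volume (by
    simp only [h, toLp_eq, map_zero])

/-! ### Sobolev embedding into the Schwartz seminorms -/

/-- Integration over the plane in Cartesian coordinates. -/
def planeEquiv : ℝ × ℝ ≃ᵐ Plane :=
  (MeasurableEquiv.finTwoArrow (α := ℝ)).symm.trans (MeasurableEquiv.toLp 2 (Fin 2 → ℝ))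

lemma planeEquiv_measurePreserving : MeasurePreserving planeEquiv volume volume :=
  (EuclideanSpace.volume_preserving_symm_measurableEquiv_toLp (Fin 2)).symm.comp
    (volume_preserving_finTwoArrow ℝ).symm

lemma integrable_comp_planeEquiv {g : Plane → ℝ} (hg : Integrable g) :
    Integrable fun p : ℝ × ℝ => g !₂[p.1, p.2] :=
  (planeEquiv_measurePreserving.integrable_comp_emb planeEquiv.measurableEmbedding).2 hg

lemma integral_comp_planeEquiv (g : Plane → ℝ) :
    ∫ p : ℝ × ℝ, g !₂[p.1, p.2] = ∫ x, g x :=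
  planeEquiv_measurePreserving.integral_comp planeEquiv.measurableEmbedding g

lemma line_temperate (a : Plane) (i : Fin 2) :
    (fun s : ℝ => a + s • unitVec i).HasTemperateGrowth :=
  (Function.HasTemperateGrowth.const a).add
    ((ContinuousLinearMap.toSpanSingleton ℝ (unitVec i)).hasTemperateGrowth)

lemma norm_unitVec (i : Fin 2) : ‖unitVec i‖ = 1 := by simp [unitVec]

lemma line_antilipschitz (a : Plane) (i : Fin 2) :
    AntilipschitzWith 1 (fun s : ℝ => a + s • unitVec i) := by
  refine AntilipschitzWith.of_le_mul_dist fun s t => ?_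
  rw [dist_add_left, dist_eq_norm (s • _), ← sub_smul, norm_smul, norm_unitVec, dist_eq_norm]
  simp

/-- The restriction of a Schwartz function to a line parallel to an axis. -/
def slice (a : Plane) (i : Fin 2) (f : Sch) : 𝓢(ℝ, ℝ) :=
  SchwartzMap.compCLMOfAntilipschitz ℝ (line_temperate a i) (line_antilipschitz a i) f

lemma slice_apply (a : Plane) (i : Fin 2) (f : Sch) (s : ℝ) :
    slice a i f s = f (a + s • unitVec i) := rfl

/-- Fundamental theorem of calculus along the line, starting from -∞, where a Schwartz function
vanishes. -/
lemma abs_le_integral_slice (a : Plane) (i : Fin 2) (f : Sch) (t : ℝ) :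
    |f (a + t • unitVec i)| ≤ ∫ s : ℝ, |pd i f (a + s • unitVec i)| := by
  have hd : ∀ s, HasDerivAt (slice a i f) (slice a i (pd i f) s) s := by
    intro s
    rw [slice_apply, pd_apply]
    have h1 : HasDerivAt (fun s : ℝ => a + s • unitVec i) (unitVec i) s := by
      simpa using ((hasDerivAt_id s).smul_const (unitVec i)).const_add a
    exact (f.hasFDerivAt _).comp_hasDerivAt s h1
  have hint : Integrable (slice a i (pd i f)) := (slice a i (pd i f)).integrable
  have h0 : Tendsto (slice a i f) atBot (𝓝 0) :=
    (slice a i f).tendsto_cocompact.mono_left atBot_le_cocompact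
  have h := integral_Iic_of_hasDerivAt_of_tendsto (a := t) (f := slice a i f) (m := 0)
    (slice a i f).continuous.continuousWithinAt
    (fun s _ => hd s) hint.integrableOn h0
  rw [sub_zero] at h
  rw [← slice_apply, ← h]
  calc |∫ s in Set.Iic t, slice a i (pd i f) s| ≤ ∫ s in Set.Iic t, |slice a i (pd i f) s| :=
        abs_integral_le_integral_abs
    _ ≤ ∫ s, |slice a i (pd i f) s| :=
        setIntegral_le_integral hint.abs (Eventually.of_forall fun s => abs_nonneg _)

lemma plane_eq_add (x : Plane) (s : ℝ) : !₂[s, x 1] = (!₂[0, x 1] : Plane) + s • unitVec 0 := by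
  ext i; fin_cases i <;> simp [unitVec]

lemma plane_eq_add' (s t : ℝ) : !₂[s, t] = (!₂[s, 0] : Plane) + t • unitVec 1 := by
  ext i; fin_cases i <;> simp [unitVec]

lemma abs_le_integral_pd_pd (f : Sch) (x : Plane) : |f x| ≤ ∫ y, |pd 1 (pd 0 f) y| := by
  have hx : x = !₂[0, x 1] + x 0 • unitVec 0 := by
    rw [← plane_eq_add]; ext i; fin_cases i <;> rfl
  set g := pd 1 (pd 0 f)
  have hi := integrable_comp_planeEquiv (g.integrable (μ := volume)).abs
  calc |f x| ≤ ∫ s, |pd 0 f (!₂[0, x 1] + s • unitVec 0)| := by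
        conv_lhs => rw [hx]
        exact abs_le_integral_slice _ _ _ _
    _ ≤ ∫ s, ∫ t, |g !₂[s, t]| := by
        refine integral_mono (slice _ 0 (pd 0 f)).integrable.abs hi.integral_prod_left fun s => ?_
        simp only
        rw [← plane_eq_add, plane_eq_add']
        refine (abs_le_integral_slice _ _ _ _).trans_eq (integral_congr_ae
          (Eventually.of_forall fun t => ?_))
        simp only
        rw [← plane_eq_add']
    _ = ∫ p : ℝ × ℝ, |g !₂[p.1, p.2]| := (integral_prod _ hi).symm
    _ = ∫ y, |g y| := integral_comp_planeEquiv fun y => |g y|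

lemma norm_sq_plane (x : Plane) : ‖x‖ ^ 2 = x 0 ^ 2 + x 1 ^ 2 := by
  simp [EuclideanSpace.norm_sq_eq, Fin.sum_univ_two]

lemma integrable_weight {r : ℝ} (hr : 2 < r) :
    Integrable fun x : Plane => (1 + ‖x‖ ^ 2) ^ (-r / 2) := by
  apply integrable_rpow_neg_one_add_norm_sq
  simpa using hr

/-- Cauchy-Schwarz against (1 + |x|²)⁻¹, which is square integrable in dimension two. The price is
two multiplications by coordinates, hence the index 2. -/
lemma integral_abs_le_sob : ∃ C, 0 ≤ C ∧ ∀ f : Sch, ∫ x, |f x| ≤ C * sob 2 f := by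
  have hw : Integrable fun x : Plane => (1 + ‖x‖ ^ 2)⁻¹ ^ 2 := by
    refine (integrable_weight (r := 4) (by norm_num)).congr (Eventually.of_forall fun x => ?_)
    simp only
    rw [show (-4 / 2 : ℝ) = -(2 : ℕ) by norm_num, Real.rpow_neg (by positivity), Real.rpow_natCast,
      inv_pow]
  have hcont : Continuous fun x : Plane => (1 + ‖x‖ ^ 2)⁻¹ := by
    refine Continuous.inv₀ (by fun_prop) fun x => by positivity
  have hmem : MemLp (fun x : Plane => (1 + ‖x‖ ^ 2)⁻¹) 2 :=
    (memLp_two_iff_integrable_sq hcont.aestronglyMeasurable).2 hw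
  refine ⟨√(∫ x : Plane, (1 + ‖x‖ ^ 2)⁻¹ ^ 2) , by positivity, fun f => ?_⟩
  set g : Sch := f + ∑ i : Fin 2, xm i (xm i f) with hg
  have hgx : ∀ x, g x = (1 + ‖x‖ ^ 2) * f x := by
    intro x
    rw [hg, norm_sq_plane, Fin.sum_univ_two]
    change f x + (xm 0 (xm 0 f) x + xm 1 (xm 1 f) x) = _
    simp only [xm_apply]; ring
  have h1 : ∫ x, |f x| = ∫ x, (1 + ‖x‖ ^ 2)⁻¹ * |g x| := by
    congr 1; ext x
    rw [hgx, abs_mul, abs_of_pos (by positivity : (0 : ℝ) < 1 + ‖x‖ ^ 2),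
      inv_mul_cancel_left₀ (by positivity)]
  have hgm : MemLp (fun x => |g x|) 2 := (g.memLp 2).norm
  have h2 : ∫ x, (1 + ‖x‖ ^ 2)⁻¹ * |g x| ≤ √(∫ x : Plane, (1 + ‖x‖ ^ 2)⁻¹ ^ 2) * sob 0 g := by
    have := integral_mul_le_Lp_mul_Lq_of_nonneg (μ := (volume : Measure Plane)) (p := 2) (q := 2)
      (f := fun x : Plane => (1 + ‖x‖ ^ 2)⁻¹) (g := fun x => |g x|)
      (by constructor <;> norm_num) (Eventually.of_forall fun x => by positivity)
      (Eventually.of_forall fun x => abs_nonneg _) (by simpa using hmem) (by simpa using hgm)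
    refine this.trans_eq ?_
    rw [sob_zero_eq_sqrt, Real.sqrt_eq_rpow, Real.sqrt_eq_rpow]
    norm_num
  rw [h1]
  refine h2.trans ?_
  gcongr
  have e0 : ∀ i, sob 0 (xm i (xm i f)) ≤ sob 1 (xm i f) := fun i => sob_xm_le 0 i _
  calc sob 0 g ≤ sob 0 f + sob 0 (∑ i : Fin 2, xm i (xm i f)) := map_add_le_add _ _ _
    _ ≤ sob 0 f + (sob 0 (xm 0 (xm 0 f)) + sob 0 (xm 1 (xm 1 f))) := by
        gcongr; rw [Fin.sum_univ_two]; exact map_add_le_add _ _ _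
    _ ≤ sob 2 f := by
        rw [sob_succ 1, Fin.sum_univ_two]
        have := e0 0; have := e0 1; have := sob_le_succ 0 f
        have := apply_nonneg (sob 1) (pd 0 f)
        have := apply_nonneg (sob 1) (pd 1 f)
        linarith

/-- The index 4 counts the two derivatives that pass from the supremum to L¹ and the two coordinate
factors that pass from L¹ to L². -/
lemma abs_le_sob : ∃ C, 0 ≤ C ∧ ∀ (f : Sch) (x : Plane), |f x| ≤ C * sob 4 f := by
  obtain ⟨C, hC0, hC⟩ := integral_abs_le_sob
  refine ⟨C, hC0, fun f x => (abs_le_integral_pd_pd f x).trans ((hC _).trans ?_)⟩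
  gcongr
  exact (sob_pd_le 2 1 _).trans (sob_pd_le 3 0 _)

lemma norm_le_abs_add (x : Plane) : ‖x‖ ≤ |x 0| + |x 1| := by
  refine abs_le_of_sq_le_sq' ?_ (by positivity) |>.2
  rw [norm_sq_plane]
  nlinarith [abs_nonneg (x 0), abs_nonneg (x 1), sq_abs (x 0), sq_abs (x 1),
    mul_nonneg (abs_nonneg (x 0)) (abs_nonneg (x 1))]

lemma seminorm_postcomp_le {F G : Type*} [NormedAddCommGroup F] [NormedSpace ℝ F]
    [NormedAddCommGroup G] [NormedSpace ℝ G] (L : F →L[ℝ] G) (k n : ℕ) (f : 𝓢(Plane, F)) :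
    SchwartzMap.seminorm ℝ k n (SchwartzMap.postcompCLM L f) ≤
      ‖L‖ * SchwartzMap.seminorm ℝ k n f := by
  refine SchwartzMap.seminorm_le_bound ℝ _ _ _ (by positivity) fun x => ?_
  have h1 : ‖iteratedFDeriv ℝ n (SchwartzMap.postcompCLM L f) x‖ ≤
      ‖L‖ * ‖iteratedFDeriv ℝ n f x‖ :=
    L.norm_iteratedFDeriv_comp_left (f.smooth n).contDiffAt le_rfl
  calc ‖x‖ ^ k * ‖iteratedFDeriv ℝ n (SchwartzMap.postcompCLM L f) x‖
      ≤ ‖x‖ ^ k * (‖L‖ * ‖iteratedFDeriv ℝ n f x‖) := by gcongr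
    _ = ‖L‖ * (‖x‖ ^ k * ‖iteratedFDeriv ℝ n f x‖) := by ring
    _ ≤ _ := by gcongr; exact f.le_seminorm ℝ _ _ _

lemma fderivCLM_eq_sum (f : Sch) : SchwartzMap.fderivCLM ℝ Plane ℝ f =
    ∑ i : Fin 2, SchwartzMap.postcompCLM (ContinuousLinearMap.toSpanSingleton ℝ
      (EuclideanSpace.proj (𝕜 := ℝ) i : Plane →L[ℝ] ℝ)) (pd i f) := by
  ext x v
  rw [Fin.sum_univ_two]
  change fderiv ℝ f x v = pd 0 f x * v 0 + pd 1 f x * v 1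
  rw [pd_apply, pd_apply, mul_comm _ (v 0), mul_comm _ (v 1), ← smul_eq_mul, ← smul_eq_mul,
    ← map_smul, ← map_smul, ← map_add]
  congr 1
  ext i; fin_cases i <;> simp [unitVec]

/-- The Schwartz seminorms are controlled by the weighted Sobolev seminorms. -/
theorem seminorm_le_sob (k n : ℕ) :
    ∃ (m : ℕ) (C : ℝ), 0 ≤ C ∧ ∀ f : Sch, SchwartzMap.seminorm ℝ k n f ≤ C * sob m f := by
  induction n with
  | zero =>
    induction k with
    | zero =>
      obtain ⟨C, hC0, hC⟩ := abs_le_sob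
      refine ⟨4, C, hC0, fun f => SchwartzMap.seminorm_le_bound ℝ _ _ _ (by positivity) fun x => ?_⟩
      simpa using hC f x
    | succ k ih =>
      obtain ⟨m, C, hC0, hC⟩ := ih
      refine ⟨m + 1, C, hC0, fun f =>
        SchwartzMap.seminorm_le_bound ℝ _ _ _ (by positivity) fun x => ?_⟩
      have h : ∀ i, ‖x‖ ^ k * (|x i| * |f x|) ≤ C * sob m (xm i f) := by
        intro i
        have := (xm i f).le_seminorm ℝ k 0 x
        rw [norm_iteratedFDeriv_zero, xm_apply, Real.norm_eq_abs, abs_mul] at this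
        exact this.trans (hC _)
      rw [norm_iteratedFDeriv_zero, Real.norm_eq_abs, pow_succ]
      calc ‖x‖ ^ k * ‖x‖ * |f x| ≤ ‖x‖ ^ k * (|x 0| + |x 1|) * |f x| := by
            gcongr; exact norm_le_abs_add x
        _ = ‖x‖ ^ k * (|x 0| * |f x|) + ‖x‖ ^ k * (|x 1| * |f x|) := by ring
        _ ≤ C * sob m (xm 0 f) + C * sob m (xm 1 f) := add_le_add (h 0) (h 1)
        _ = C * (sob m (xm 0 f) + sob m (xm 1 f)) := by ring
        _ ≤ C * sob (m + 1) f := by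
          gcongr
          rw [sob_succ, Fin.sum_univ_two]
          have := apply_nonneg (sob m) f
          have := apply_nonneg (sob m) (pd 0 f)
          have := apply_nonneg (sob m) (pd 1 f)
          linarith
  | succ n ih =>
    obtain ⟨m, C, hC0, hC⟩ := ih
    set L : Fin 2 → (ℝ →L[ℝ] (Plane →L[ℝ] ℝ)) := fun i => ContinuousLinearMap.toSpanSingleton ℝ
      (EuclideanSpace.proj (𝕜 := ℝ) i : Plane →L[ℝ] ℝ) with hL
    refine ⟨m + 1, (‖L 0‖ + ‖L 1‖) * C, by positivity, fun f => ?_⟩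
    rw [← seminorm_fderivCLM, fderivCLM_eq_sum, Fin.sum_univ_two]
    have h : ∀ i, SchwartzMap.seminorm ℝ k n (SchwartzMap.postcompCLM (L i) (pd i f)) ≤
        ‖L i‖ * C * sob (m + 1) f := fun i => by
      refine (seminorm_postcomp_le _ _ _ _).trans ?_
      rw [mul_assoc]
      gcongr
      refine (hC _).trans ?_
      gcongr
      exact sob_pd_le m i f
    refine (map_add_le_add _ _ _).trans ((add_le_add (h 0) (h 1)).trans_eq ?_)
    ring

/-- The Schwartz space is complete for the weighted Sobolev seminorms. -/
theorem exists_sob_limit (u : ℕ → Sch)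
    (hu : ∀ k, ∀ η > 0, ∃ N, ∀ m ≥ N, ∀ l ≥ N, sob k (u m - u l) < η) :
    ∃ v : Sch, ∀ k, Tendsto (fun m => sob k (u m - v)) atTop (𝓝 0) := by
  obtain ⟨v, hv⟩ := exists_schwartz_limit u (by
    intro k n η hη
    obtain ⟨m, C, hC0, hC⟩ := seminorm_le_sob k n
    obtain ⟨N, hN⟩ := hu m (η / (C + 1)) (by positivity)
    refine ⟨N, fun a ha b hb => (hC _).trans_lt ?_⟩
    calc C * sob m (u a - u b) ≤ (C + 1) * sob m (u a - u b) := by gcongr; linarith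
      _ < (C + 1) * (η / (C + 1)) := by gcongr; exact hN a ha b hb
      _ = η := by field_simp)
  refine ⟨v, fun k => ?_⟩
  have ht : Tendsto u atTop (𝓝 v) := by
    rw [(schwartz_withSeminorms ℝ Plane ℝ).tendsto_nhds u v]
    rintro ⟨k, n⟩ ε hε
    exact (hv k n).eventually (gt_mem_nhds hε)
  have h1 : Tendsto (fun m => u m - v) atTop (𝓝 0) := by
    simpa using ht.sub_const v
  have h2 := ((sob_continuous k).tendsto 0).comp h1
  rw [map_zero] at h2
  exact h2

/-! ### Elliptic regularity for the harmonic oscillator -/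

/-- The harmonic oscillator `-Δ + |x|²/16 + 1/2`, the conjugate of `1 - 𝓛` by `e^{|x|²/8}`. -/
def oscH : Sch →L[ℝ] Sch :=
  -(∑ i : Fin 2, pd i ∘L pd i) + (1 / 16 : ℝ) • (∑ i : Fin 2, xm i ∘L xm i) +
    (1 / 2 : ℝ) • ContinuousLinearMap.id ℝ Sch

lemma oscH_eq (f : Sch) : oscH f = -(pd 0 (pd 0 f) + pd 1 (pd 1 f)) +
    (1 / 16 : ℝ) • (xm 0 (xm 0 f) + xm 1 (xm 1 f)) + (1 / 2 : ℝ) • f := by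
  simp [oscH, Fin.sum_univ_two]

/-- Only the potential fails to commute with a derivative. Here and in `oscH_xm` the commutator is a
single letter, of lower order than H, so the regularity induction closes. -/
lemma oscH_pd (i : Fin 2) (f : Sch) : oscH (pd i f) = pd i (oscH f) - (1 / 8 : ℝ) • xm i f := by
  simp only [oscH_eq, map_add, map_neg, map_smul, pd_xm]
  rw [pd_comm i 0 (pd 0 f), pd_comm i 0 f, pd_comm i 1 (pd 1 f), pd_comm i 1 f]
  fin_cases i <;> simp <;> module

lemma oscH_xm (i : Fin 2) (f : Sch) : oscH (xm i f) = xm i (oscH f) - (2 : ℝ) • pd i f := by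
  simp only [oscH_eq, map_add, map_neg, map_smul, pd_xm]
  rw [xm_comm 0 i f, xm_comm 0 i (xm 0 f), xm_comm 1 i f, xm_comm 1 i (xm 1 f)]
  fin_cases i <;> simp <;> module

lemma ip_oscH (u : Sch) : ip (oscH u) u =
    sob 0 (pd 0 u) ^ 2 + sob 0 (pd 1 u) ^ 2 +
      1 / 16 * (sob 0 (xm 0 u) ^ 2 + sob 0 (xm 1 u) ^ 2) + 1 / 2 * sob 0 u ^ 2 := by
  rw [oscH_eq]
  simp only [ip_add_left, ip_neg_left, ip_smul_left, ← ip_self]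
  have h1 : ∀ i, ip (pd i (pd i u)) u = -ip (pd i u) (pd i u) := fun i => by rw [ip_pd]; ring
  have h2 : ∀ i, ip (xm i (xm i u)) u = ip (xm i u) (xm i u) := fun i => (ip_xm _ _ _).symm
  rw [h1, h1, h2, h2]; ring

lemma sob_one_eq (u : Sch) : sob 1 u = sob 0 u + (sob 0 (pd 0 u) + sob 0 (xm 0 u) +
    (sob 0 (pd 1 u) + sob 0 (xm 1 u))) := by
  rw [sob_succ, Fin.sum_univ_two]

/-- The factor is 80 = 5 · 16: five terms are squared together, and 1/16 is the smallest coefficient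
in the energy. -/
lemma sob_one_sq_le (u : Sch) : sob 1 u ^ 2 ≤ 80 * ip (oscH u) u := by
  rw [ip_oscH, sob_one_eq]
  set a := sob 0 u; set b := sob 0 (pd 0 u); set c := sob 0 (xm 0 u); set d := sob 0 (pd 1 u)
  set e := sob 0 (xm 1 u)
  nlinarith [sq_nonneg (a - b), sq_nonneg (a - c), sq_nonneg (a - d), sq_nonneg (a - e),
    sq_nonneg (b - c), sq_nonneg (b - d), sq_nonneg (b - e), sq_nonneg (c - d), sq_nonneg (c - e),
    sq_nonneg (d - e), sq_nonneg a, sq_nonneg b, sq_nonneg d]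

lemma half_sob_zero_sq_le (u : Sch) : 1 / 2 * sob 0 u ^ 2 ≤ ip (oscH u) u := by
  rw [ip_oscH]; nlinarith [sq_nonneg (sob 0 (pd 0 u)), sq_nonneg (sob 0 (pd 1 u)),
    sq_nonneg (sob 0 (xm 0 u)), sq_nonneg (sob 0 (xm 1 u))]

lemma sob_one_le (u : Sch) : sob 1 u ≤ 80 * sob 0 (oscH u) := by
  have h1 := sob_one_sq_le u
  have h2 := (le_abs_self _).trans (ip_le (oscH u) u)
  have h3 := sob_le_succ 0 u
  have h4 := apply_nonneg (sob 0) (oscH u)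
  have h5 := apply_nonneg (sob 1) u
  rcases h5.eq_or_lt with h | h
  · rw [← h]; positivity
  · refine le_of_mul_le_mul_right ?_ h
    nlinarith [mul_le_mul_of_nonneg_left h3 h4]

lemma le_of_sq_le_mul_add {t h s : ℝ} (hh : 0 ≤ h) (hs : 0 ≤ s)
    (H : t ^ 2 ≤ 16 * (h * t + 2 * s ^ 2)) : t ≤ 16 * h + 6 * s := by
  by_contra! hc
  nlinarith [mul_nonneg hh hs]

/-- Intended for v = ∂_i u or x_i u, with h = ‖Hu‖ and s = `sob 1 u`. The energy of v dominates
t²/16, where t is its total first-order norm, so t satisfies a quadratic inequality that bounds it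
linearly by h and s. -/
lemma sob_one_le_of_ip {v : Sch} {h s τ : ℝ} (hh : 0 ≤ h) (hs : 0 ≤ s)
    (hτ : τ ^ 2 ≤ sob 0 (pd 0 v) ^ 2 + sob 0 (pd 1 v) ^ 2 + sob 0 (xm 0 v) ^ 2 + sob 0 (xm 1 v) ^ 2)
    (hi : ip (oscH v) v ≤ h * τ + 2 * s ^ 2) (hv : sob 0 v ≤ s) :
    sob 1 v ≤ 64 * h + 25 * s := by
  set t := √(sob 0 (pd 0 v) ^ 2 + sob 0 (pd 1 v) ^ 2 + sob 0 (xm 0 v) ^ 2 + sob 0 (xm 1 v) ^ 2)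
    with ht
  have ht2 : t ^ 2 = sob 0 (pd 0 v) ^ 2 + sob 0 (pd 1 v) ^ 2 + sob 0 (xm 0 v) ^ 2
      + sob 0 (xm 1 v) ^ 2 := Real.sq_sqrt (by positivity)
  have ht0 : 0 ≤ t := Real.sqrt_nonneg _
  have hτt : τ ≤ t := Real.le_sqrt_of_sq_le hτ
  have e1 := ip_oscH v
  have key : t ≤ 16 * h + 6 * s := by
    refine le_of_sq_le_mul_add hh hs ?_
    have : h * τ ≤ h * t := by gcongr
    nlinarith [sq_nonneg (sob 0 v), sq_nonneg (sob 0 (pd 0 v)), sq_nonneg (sob 0 (pd 1 v))]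
  have b : ∀ a : ℝ, a ^ 2 ≤ t ^ 2 → a ≤ t := fun a ha => abs_le_of_sq_le_sq' ha ht0 |>.2
  have b1 := b (sob 0 (pd 0 v)) (by rw [ht2]; nlinarith [sq_nonneg (sob 0 (pd 1 v)), sq_nonneg (sob 0 (xm 0 v)), sq_nonneg (sob 0 (xm 1 v))])
  have b2 := b (sob 0 (pd 1 v)) (by rw [ht2]; nlinarith [sq_nonneg (sob 0 (pd 0 v)), sq_nonneg (sob 0 (xm 0 v)), sq_nonneg (sob 0 (xm 1 v))])
  have b3 := b (sob 0 (xm 0 v)) (by rw [ht2]; nlinarith [sq_nonneg (sob 0 (pd 1 v)), sq_nonneg (sob 0 (pd 0 v)), sq_nonneg (sob 0 (xm 1 v))])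
  have b4 := b (sob 0 (xm 1 v)) (by rw [ht2]; nlinarith [sq_nonneg (sob 0 (pd 1 v)), sq_nonneg (sob 0 (xm 0 v)), sq_nonneg (sob 0 (pd 0 v))])
  rw [sob_one_eq]
  linarith

/-- Test H∂_i u against ∂_i u. The derivative on Hu is moved to the other factor, which leaves ‖Hu‖
‖∂_i² u‖; the commutator contributes first-order terms only. -/
lemma sob_one_pd_le (i : Fin 2) (u : Sch) :
    sob 1 (pd i u) ≤ 64 * sob 0 (oscH u) + 25 * sob 1 u := by
  refine sob_one_le_of_ip (τ := sob 0 (pd i (pd i u))) (apply_nonneg _ _) (apply_nonneg _ _) ?_ ?_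
    (sob_pd_le 0 i u)
  · have h := fun (j : Fin 2) => And.intro (sq_nonneg (sob 0 (pd j (pd i u))))
      (sq_nonneg (sob 0 (xm j (pd i u))))
    have h0 := h 0
    have h1 := h 1
    obtain rfl | rfl : i = 0 ∨ i = 1 := by fin_cases i <;> simp
    · linarith
    · linarith
  · rw [oscH_pd, sub_eq_add_neg, ip_add_left, ip_neg_left, ip_smul_left]
    have h1 : ip (pd i (oscH u)) (pd i u) = -ip (oscH u) (pd i (pd i u)) := by
      rw [ip_pd i (oscH u), neg_neg]
    have h2 := (neg_le_abs _).trans (ip_le (oscH u) (pd i (pd i u)))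
    have h3 := (neg_le_abs _).trans (ip_le (xm i u) (pd i u))
    have h4 : sob 0 (xm i u) * sob 0 (pd i u) ≤ sob 1 u * sob 1 u :=
      mul_le_mul (sob_xm_le 0 i u) (sob_pd_le 0 i u) (apply_nonneg _ _) (apply_nonneg _ _)
    rw [h1]
    nlinarith [sq_nonneg (sob 1 u)]

lemma sob_one_xm_le (i : Fin 2) (u : Sch) :
    sob 1 (xm i u) ≤ 64 * sob 0 (oscH u) + 25 * sob 1 u := by
  refine sob_one_le_of_ip (τ := sob 0 (xm i (xm i u))) (apply_nonneg _ _) (apply_nonneg _ _) ?_ ?_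
    (sob_xm_le 0 i u)
  · have h := fun (j : Fin 2) => And.intro (sq_nonneg (sob 0 (pd j (xm i u))))
      (sq_nonneg (sob 0 (xm j (xm i u))))
    have h0 := h 0
    have h1 := h 1
    obtain rfl | rfl : i = 0 ∨ i = 1 := by fin_cases i <;> simp
    · linarith
    · linarith
  · rw [oscH_xm, sub_eq_add_neg, ip_add_left, ip_neg_left, ip_smul_left]
    have h1 : ip (xm i (oscH u)) (xm i u) = ip (oscH u) (xm i (xm i u)) := (ip_xm _ _ _).symm
    have h2 := (le_abs_self _).trans (ip_le (oscH u) (xm i (xm i u)))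
    have h3 := (neg_le_abs _).trans (ip_le (pd i u) (xm i u))
    have h4 : sob 0 (pd i u) * sob 0 (xm i u) ≤ sob 1 u * sob 1 u :=
      mul_le_mul (sob_pd_le 0 i u) (sob_xm_le 0 i u) (apply_nonneg _ _) (apply_nonneg _ _)
    rw [h1]
    nlinarith [sq_nonneg (sob 1 u)]

/-- Elliptic regularity: the oscillator gains two orders. -/
lemma sob_add_two_le_aux (k : ℕ) :
    ∃ C, 0 ≤ C ∧ ∀ u, sob (k + 2) u ≤ C * (sob k (oscH u) + sob (k + 1) u) := by
  induction k with
  | zero =>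
    refine ⟨256, by norm_num, fun u => ?_⟩
    rw [sob_succ, Fin.sum_univ_two]
    have := sob_one_pd_le 0 u; have := sob_one_pd_le 1 u
    have := sob_one_xm_le 0 u; have := sob_one_xm_le 1 u
    have := apply_nonneg (sob 1) u; have := apply_nonneg (sob 0) (oscH u)
    linarith
  | succ k ih =>
    obtain ⟨C, hC0, hC⟩ := ih
    refine ⟨1 + 4 * (C * 3), by positivity, fun u => ?_⟩
    have m1 : sob k u ≤ sob (k + 1) u := sob_le_succ _ _
    have m2 : sob (k + 1) u ≤ sob (k + 2) u := sob_le_succ _ _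
    have p0 := apply_nonneg (sob k) u
    have p1 := apply_nonneg (sob (k + 1)) (oscH u)
    -- The inductive bound is applied to ∂_i u. The commutator with H is of order one and is
    -- absorbed into `sob (k + 2) u`.
    have hp : ∀ i, sob (k + 2) (pd i u) ≤ C * 3 * (sob (k + 1) (oscH u) + sob (k + 2) u) := by
      intro i
      refine (hC _).trans ?_
      rw [mul_assoc]
      gcongr
      rw [oscH_pd]
      have h1 := map_sub_le_add (sob k) (pd i (oscH u)) ((1 / 8 : ℝ) • xm i u)
      have h2 : sob k ((1 / 8 : ℝ) • xm i u) = 1 / 8 * sob k (xm i u) := by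
        rw [map_smul_eq_mul]; norm_num
      have h3 := sob_pd_le k i (oscH u)
      have h4 := sob_xm_le k i u
      have h5 := sob_pd_le (k + 1) i u
      linarith
    have hx : ∀ i, sob (k + 2) (xm i u) ≤ C * 3 * (sob (k + 1) (oscH u) + sob (k + 2) u) := by
      intro i
      refine (hC _).trans ?_
      rw [mul_assoc]
      gcongr
      rw [oscH_xm]
      have h1 := map_sub_le_add (sob k) (xm i (oscH u)) ((2 : ℝ) • pd i u)
      have h2 : sob k ((2 : ℝ) • pd i u) = 2 * sob k (pd i u) := by
        rw [map_smul_eq_mul]; norm_num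
      have h3 := sob_xm_le k i (oscH u)
      have h4 := sob_pd_le k i u
      have h5 := sob_xm_le (k + 1) i u
      linarith
    rw [sob_succ (k + 2), Fin.sum_univ_two]
    have := hp 0; have := hp 1; have := hx 0; have := hx 1
    linarith

/-- The lower-order term of `sob_add_two_le_aux` is removed by coercivity at the bottom level and by
induction above it. -/
lemma sob_add_two_le (k : ℕ) : ∃ C, 0 ≤ C ∧ ∀ u, sob (k + 2) u ≤ C * sob k (oscH u) := by
  induction k with
  | zero =>
    obtain ⟨C, hC0, hC⟩ := sob_add_two_le_aux 0
    refine ⟨C * 81, by positivity, fun u => (hC u).trans ?_⟩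
    rw [mul_assoc]; gcongr
    have := sob_one_le u; linarith
  | succ k ih =>
    obtain ⟨C, hC0, hC⟩ := ih
    obtain ⟨C', hC'0, hC'⟩ := sob_add_two_le_aux (k + 1)
    refine ⟨C' * (1 + C), by positivity, fun u => (hC' u).trans ?_⟩
    rw [mul_assoc]; gcongr
    have h1 := hC u
    have h2 : C * sob k (oscH u) ≤ C * sob (k + 1) (oscH u) := by
      gcongr; exact sob_le_succ _ _
    linarith

/-- Reduces approximation in `sob k` to approximation in L² of the images under Hᵏ. Each factor H
gains two orders, of which only one is used. -/
lemma sob_le_iterate (k : ℕ) : ∃ C, 0 ≤ C ∧ ∀ u, sob k u ≤ C * sob 0 (oscH^[k] u) := by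
  induction k with
  | zero => exact ⟨1, zero_le_one, fun u => by simp⟩
  | succ k ih =>
    obtain ⟨C, hC0, hC⟩ := ih
    obtain ⟨C', hC'0, hC'⟩ := sob_add_two_le k
    refine ⟨C' * C, by positivity, fun u => ?_⟩
    calc sob (k + 1) u ≤ sob (k + 2) u := sob_le_succ _ _
      _ ≤ C' * sob k (oscH u) := hC' u
      _ ≤ C' * (C * sob 0 (oscH^[k] (oscH u))) := by gcongr; exact hC _
      _ = _ := by rw [Function.iterate_succ_apply]; ring

lemma sob_oscH_le (k : ℕ) (u : Sch) : sob k (oscH u) ≤ 4 * sob (k + 2) u := by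
  rw [oscH_eq]
  have h1 := map_add_le_add (sob k) (-(pd 0 (pd 0 u) + pd 1 (pd 1 u)) +
    (1 / 16 : ℝ) • (xm 0 (xm 0 u) + xm 1 (xm 1 u))) ((1 / 2 : ℝ) • u)
  have h2 := map_add_le_add (sob k) (-(pd 0 (pd 0 u) + pd 1 (pd 1 u)))
    ((1 / 16 : ℝ) • (xm 0 (xm 0 u) + xm 1 (xm 1 u)))
  have h3 := map_add_le_add (sob k) (pd 0 (pd 0 u)) (pd 1 (pd 1 u))
  have h4 := map_add_le_add (sob k) (xm 0 (xm 0 u)) (xm 1 (xm 1 u))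
  have h5 : sob k ((1 / 16 : ℝ) • (xm 0 (xm 0 u) + xm 1 (xm 1 u))) =
      1 / 16 * sob k (xm 0 (xm 0 u) + xm 1 (xm 1 u)) := by rw [map_smul_eq_mul]; norm_num
  have h6 : sob k ((1 / 2 : ℝ) • u) = 1 / 2 * sob k u := by rw [map_smul_eq_mul]; norm_num
  have h7 : sob k (-(pd 0 (pd 0 u) + pd 1 (pd 1 u))) = sob k (pd 0 (pd 0 u) + pd 1 (pd 1 u)) :=
    map_neg_eq_map _ _
  have a := fun i => (sob_pd_le k i (pd i u)).trans (sob_pd_le (k + 1) i u)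
  have b := fun i => (sob_xm_le k i (xm i u)).trans (sob_xm_le (k + 1) i u)
  have c : sob k u ≤ sob (k + 2) u := (sob_le_succ _ _).trans (sob_le_succ _ _)
  have e : k + 1 + 1 = k + 2 := rfl
  rw [e] at a b
  have := a 0; have := a 1; have := b 0; have := b 1
  have := apply_nonneg (sob (k + 2)) u
  linarith

/-! ### Gaussians, Hermite functions and the dense range of the oscillator -/

lemma iteratedDeriv_real_exp (n : ℕ) : iteratedDeriv n Real.exp = Real.exp := by
  rw [iteratedDeriv_eq_iterate]
  exact Real.iter_deriv_exp n

lemma one_add_pow_mul_exp_bounded {c : ℝ} (hc : 0 < c) (k : ℕ) :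
    ∃ C, ∀ r : ℝ, 0 ≤ r → (1 + r) ^ k * Real.exp (-c * r ^ 2) ≤ C := by
  refine ⟨k.factorial * Real.exp (1 + 1 / c), fun r hr => ?_⟩
  have h1 : (1 + r) ^ k ≤ k.factorial * Real.exp (1 + r) := by
    have := Real.pow_div_factorial_le_exp (1 + r) (by positivity) k
    rwa [div_le_iff₀ (by positivity), mul_comm] at this
  calc (1 + r) ^ k * Real.exp (-c * r ^ 2)
      ≤ k.factorial * Real.exp (1 + r) * Real.exp (-c * r ^ 2) := by gcongr
    _ = k.factorial * Real.exp (1 + r - c * r ^ 2) := by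
        rw [mul_assoc, ← Real.exp_add]; ring_nf
    _ ≤ k.factorial * Real.exp (1 + 1 / c) := by
        gcongr
        have : r - c * r ^ 2 ≤ 1 / c := by
          rw [le_div_iff₀ hc]
          nlinarith [sq_nonneg (c * r - 1), sq_nonneg (c * r)]
        linarith

/-- The Gaussian `e^{-c|x|²}` as a Schwartz function. -/
def gaussS (c : ℝ) (hc : 0 < c) : Sch where
  toFun x := Real.exp (-c * ‖x‖ ^ 2)
  smooth' := (contDiff_const.mul (contDiff_norm_sq ℝ)).exp
  decay' k n := by
    have ht : (fun x : Plane => -c * ‖x‖ ^ 2).HasTemperateGrowth :=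
      (Function.HasTemperateGrowth.const (-c)).mul
        (Function.hasTemperateGrowth_norm_sq Plane)
    obtain ⟨m, C₀, hC₀, hb⟩ := ht.norm_iteratedFDeriv_le_uniform n
    obtain ⟨M, hM⟩ := one_add_pow_mul_exp_bounded hc (k + m * n)
    refine ⟨n.factorial * (1 + C₀) ^ n * M, fun x => ?_⟩
    have h := norm_iteratedFDeriv_comp_le (n := n) (N := ((⊤ : ℕ∞) : WithTop ℕ∞))
      (Real.contDiff_exp) ht.1 (by exact_mod_cast le_top)
      x (C := Real.exp (-c * ‖x‖ ^ 2)) (D := (1 + C₀) * (1 + ‖x‖) ^ m)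
      (fun i _ => by
        rw [norm_iteratedFDeriv_eq_norm_iteratedDeriv, iteratedDeriv_real_exp,
          Real.norm_of_nonneg (Real.exp_pos _).le])
      (fun i hi hin => by
        have h1 : 1 ≤ (1 + C₀) * (1 + ‖x‖) ^ m :=
          one_le_mul_of_one_le_of_one_le (by linarith) (one_le_pow₀ (by simp))
        refine (hb i hin x).trans ((?_ : _ ≤ (1 + C₀) * (1 + ‖x‖) ^ m).trans
          (le_self_pow₀ h1 (by omega)))
        gcongr; linarith)
    have h2 : ‖x‖ ^ k ≤ (1 + ‖x‖) ^ k := by gcongr; linarith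
    calc ‖x‖ ^ k * ‖iteratedFDeriv ℝ n (Real.exp ∘ fun x : Plane => -c * ‖x‖ ^ 2) x‖
        ≤ (1 + ‖x‖) ^ k * (n.factorial * Real.exp (-c * ‖x‖ ^ 2) *
            ((1 + C₀) * (1 + ‖x‖) ^ m) ^ n) := by gcongr
      _ = n.factorial * (1 + C₀) ^ n * ((1 + ‖x‖) ^ (k + m * n) * Real.exp (-c * ‖x‖ ^ 2)) := by
          rw [mul_pow, pow_add, pow_mul]; ring
      _ ≤ _ := by gcongr; exact hM _ (norm_nonneg x)

lemma gaussS_apply (c : ℝ) (hc : 0 < c) (x : Plane) :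
    gaussS c hc x = Real.exp (-c * ‖x‖ ^ 2) := rfl

/-- The ground state `e^{-|x|²/8}` of the oscillator. -/
def gam : Sch := gaussS (1 / 8) (by norm_num)

lemma gam_apply (x : Plane) : gam x = Real.exp (-‖x‖ ^ 2 / 8) := by
  rw [gam, gaussS_apply]; congr 1; ring

lemma gam_pos (x : Plane) : 0 < gam x := by rw [gam_apply]; positivity

lemma fderiv_gaussS (c : ℝ) (hc : 0 < c) (x v : Plane) :
    fderiv ℝ (gaussS c hc) x v = -(2 * c) * inner ℝ x v * gaussS c hc x := by
  have h : HasFDerivAt (gaussS c hc) (Real.exp (-c * ‖x‖ ^ 2) • ((-c) • (2 • innerSL ℝ x))) x :=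
    ((hasStrictFDerivAt_norm_sq x).hasFDerivAt.const_mul (-c)).exp
  rw [h.fderiv, gaussS_apply]
  simp
  ring

lemma inner_unitVec (x : Plane) (i : Fin 2) : inner ℝ x (unitVec i) = x i := by
  rw [unitVec, EuclideanSpace.inner_single_right]; simp

lemma pd_gam (i : Fin 2) : pd i gam = -(1 / 4 : ℝ) • xm i gam := by
  ext x
  rw [pd_apply, gam, fderiv_gaussS]
  change _ = -(1 / 4 : ℝ) * xm i _ x
  rw [xm_apply, inner_unitVec]
  ring

/-- `⟨ζ, x⟩^m e^{-|x|²/8}`. -/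
def hermiteS (ζ : Plane) (m : ℕ) : Sch := mulS (fun x => inner ℝ ζ x ^ m) gam

lemma inner_pow_temperate (ζ : Plane) (m : ℕ) :
    (fun x : Plane => (inner ℝ ζ x : ℝ) ^ m).HasTemperateGrowth :=
  (Function.hasTemperateGrowth_inner_right ζ).pow m

lemma hermiteS_apply (ζ : Plane) (m : ℕ) (x : Plane) :
    hermiteS ζ m x = (inner ℝ ζ x : ℝ) ^ m * gam x := mulS_apply (inner_pow_temperate ζ m) _ x

lemma pd_hermiteS (ζ : Plane) (m : ℕ) (i : Fin 2) : pd i (hermiteS ζ m) =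
    (m * ζ i) • hermiteS ζ (m - 1) - (1 / 4 : ℝ) • xm i (hermiteS ζ m) := by
  rw [hermiteS, pd_mulS (inner_pow_temperate ζ m), pd_gam]
  ext x
  change mulS _ _ x + mulS _ _ x = (m * ζ i) * hermiteS ζ (m - 1) x - 1 / 4 * xm i _ x
  rw [mulS_apply (hasTemperateGrowth_fderiv_apply (inner_pow_temperate ζ m) _),
    mulS_apply (inner_pow_temperate ζ m), xm_apply, mulS_apply (inner_pow_temperate ζ m),
    hermiteS_apply]
  have h : fderiv ℝ (fun x : Plane => (inner ℝ ζ x : ℝ) ^ m) x (unitVec i) =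
      m * (inner ℝ ζ x : ℝ) ^ (m - 1) * ζ i := by
    have h1 : HasFDerivAt (fun x : Plane => (inner ℝ ζ x : ℝ)) (innerSL ℝ ζ) x :=
      (innerSL ℝ ζ).hasFDerivAt
    rw [(h1.pow m).fderiv]
    simp [inner_unitVec]
  rw [h]
  change _ + _ * (-(1 / 4 : ℝ) * xm i gam x) = _
  rw [xm_apply]; ring

/-- On a polynomial times γ, H acts on the polynomial as -Δ + ½ x·∇ + 1. It is therefore triangular
in the degree, with nonzero diagonal entries m/2 + 1, and hence surjective on `hermiteSpan`. -/
lemma oscH_hermiteS (ζ : Plane) (m : ℕ) : oscH (hermiteS ζ m) =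
    (m / 2 + 1 : ℝ) • hermiteS ζ m -
      (m * (m - 1 : ℕ) * (ζ 0 ^ 2 + ζ 1 ^ 2)) • hermiteS ζ (m - 2) := by
  have h2 : ∀ i, pd i (pd i (hermiteS ζ m)) =
      (m * ζ i * ((m - 1 : ℕ) * ζ i)) • hermiteS ζ (m - 2) -
      (m * ζ i / 2) • xm i (hermiteS ζ (m - 1)) - (1 / 4 : ℝ) • hermiteS ζ m +
      (1 / 16 : ℝ) • xm i (xm i (hermiteS ζ m)) := by
    intro i
    rw [pd_hermiteS, map_sub, map_smul, map_smul, pd_xm, pd_hermiteS, pd_hermiteS,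
      Nat.sub_sub, map_sub, map_smul, map_smul, if_pos rfl]
    module
  have h3 : (m * ζ 0 / 2) • xm 0 (hermiteS ζ (m - 1)) + (m * ζ 1 / 2) • xm 1 (hermiteS ζ (m - 1))
      = (m / 2 : ℝ) • hermiteS ζ m := by
    ext x
    change (m * ζ 0 / 2) * xm 0 _ x + (m * ζ 1 / 2) * xm 1 _ x = (m / 2) * hermiteS ζ m x
    rw [xm_apply, xm_apply, hermiteS_apply, hermiteS_apply]
    rcases m with _ | m
    · simp
    · rw [Nat.add_sub_cancel, pow_succ]
      have : (inner ℝ ζ x : ℝ) = ζ 0 * x 0 + ζ 1 * x 1 := by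
        simp [PiLp.inner_apply, Fin.sum_univ_two, mul_comm]
      rw [this]; ring
  rw [oscH_eq, h2, h2]
  have h4 : (m * ζ 0 / 2) • xm 0 (hermiteS ζ (m - 1)) =
      (m / 2 : ℝ) • hermiteS ζ m - (m * ζ 1 / 2) • xm 1 (hermiteS ζ (m - 1)) := by
    rw [← h3]; abel
  rw [h4]
  module

/-- Polynomials times `e^{-|x|²/8}`. -/
def hermiteSpan : Submodule ℝ Sch := Submodule.span ℝ {f | ∃ ζ m, f = hermiteS ζ m}

lemma hermiteS_mem (ζ : Plane) (m : ℕ) : hermiteS ζ m ∈ hermiteSpan :=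
  Submodule.subset_span ⟨ζ, m, rfl⟩

lemma exists_oscH_eq_of_mem_span {p : Sch} (hp : p ∈ hermiteSpan) :
    ∃ q ∈ hermiteSpan, oscH q = p := by
  have key : ∀ ζ m, ∃ q ∈ hermiteSpan, oscH q = hermiteS ζ m := by
    intro ζ m
    induction m using Nat.strong_induction_on with
    | _ m ih =>
      have hne : (m / 2 + 1 : ℝ) ≠ 0 := by positivity
      by_cases hm : m < 2
      · refine ⟨(m / 2 + 1 : ℝ)⁻¹ • hermiteS ζ m,
          hermiteSpan.smul_mem _ (hermiteS_mem ζ m), ?_⟩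
        have : (m : ℝ) * (m - 1 : ℕ) = 0 := by interval_cases m <;> simp
        rw [map_smul, oscH_hermiteS, this, zero_mul, zero_smul, sub_zero, smul_smul,
          inv_mul_cancel₀ hne, one_smul]
      · obtain ⟨q, hq, hqe⟩ := ih (m - 2) (by omega)
        refine ⟨(m / 2 + 1 : ℝ)⁻¹ • (hermiteS ζ m +
          (m * (m - 1 : ℕ) * (ζ 0 ^ 2 + ζ 1 ^ 2)) • q),
          hermiteSpan.smul_mem _ (hermiteSpan.add_mem (hermiteS_mem ζ m)
            (hermiteSpan.smul_mem _ hq)), ?_⟩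
        rw [map_smul, map_add, map_smul, hqe, oscH_hermiteS, sub_add_cancel, smul_smul,
          inv_mul_cancel₀ hne, one_smul]
  induction hp using Submodule.span_induction with
  | mem x hx => obtain ⟨ζ, m, rfl⟩ := hx; exact key ζ m
  | zero => exact ⟨0, hermiteSpan.zero_mem, map_zero _⟩
  | add x y _ _ hx hy =>
    obtain ⟨a, ha, rfl⟩ := hx
    obtain ⟨b, hb, rfl⟩ := hy
    exact ⟨a + b, hermiteSpan.add_mem ha hb, map_add _ _ _⟩
  | smul c x _ hx =>
    obtain ⟨a, ha, rfl⟩ := hx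
    exact ⟨c • a, hermiteSpan.smul_mem c ha, map_smul _ _ _⟩

lemma exists_iterate_oscH_eq (k : ℕ) {p : Sch} (hp : p ∈ hermiteSpan) :
    ∃ q ∈ hermiteSpan, oscH^[k] q = p := by
  induction k with
  | zero => exact ⟨p, hp, rfl⟩
  | succ k ih =>
    obtain ⟨q, hq, rfl⟩ := ih
    obtain ⟨r, hr, rfl⟩ := exists_oscH_eq_of_mem_span hq
    exact ⟨r, hr, by rw [Function.iterate_succ_apply]⟩

/-- An integrable function whose Fourier transform vanishes is zero almost everywhere. -/
lemma ae_eq_zero_of_fourier_eq_zero {h : Plane → ℂ} (hh : Integrable h) (h0 : ∀ ξ, 𝓕 h ξ = 0) :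
    ∀ᵐ x, h x = 0 := by
  -- Every test function is a Fourier transform 𝓕ψ of a Schwartz function, and the duality ∫ h 𝓕ψ =
  -- ∫ 𝓕h ψ shows that its integral against h vanishes.
  refine ae_eq_zero_of_integral_contDiff_smul_eq_zero hh.locallyIntegrable fun g hg hgs => ?_
  have hgs' : HasCompactSupport fun x => (g x : ℂ) := hgs.comp_left Complex.ofReal_zero
  have hg' : ContDiff ℝ (⊤ : ℕ∞) fun x => (g x : ℂ) := Complex.ofRealCLM.contDiff.comp hg
  set φ : 𝓢(Plane, ℂ) := hgs'.toSchwartzMap hg' with hφ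
  set ψ : 𝓢(Plane, ℂ) := 𝓕⁻ φ with hψ
  have e : φ = 𝓕 ψ := by rw [hψ, FourierTransform.fourier_fourierInv_eq]
  have key : ∫ ξ, 𝓕 h ξ • ψ ξ = ∫ x, h x • 𝓕 (ψ : Plane → ℂ) x := by
    simpa using! (VectorFourier.integral_fourierIntegral_smul_eq_flip (L := innerₗ Plane)
      Real.continuous_fourierChar continuous_inner hh ψ.integrable)
  have : ∀ x, g x • h x = h x • 𝓕 (ψ : Plane → ℂ) x := by
    intro x
    rw [← SchwartzMap.fourier_coe, ← e, smul_eq_mul, mul_comm]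
    simp [hφ]
  simp only [this, ← key, h0, zero_smul, integral_zero]

/-- Completing the square: -|x|²/8 + b|x| ≤ 4b² - |x|²/16. This puts γ times any exponential of
linear growth in L². -/
lemma gam_mul_exp_le (b r : ℝ) (x : Plane) (hr : |r| ≤ b * ‖x‖) :
    gam x * Real.exp |r| ≤ Real.exp (4 * b ^ 2) * gaussS (1 / 16) (by norm_num) x := by
  rw [gam_apply, gaussS_apply, ← Real.exp_add, ← Real.exp_add]
  refine Real.exp_le_exp.2 ?_
  nlinarith [sq_nonneg (‖x‖ / 4 - 2 * b)]

/-- Polynomials times a Gaussian are dense in `L²`. -/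
lemma hermiteSpan_dense (f : Sch) {δ : ℝ} (hδ : 0 < δ) : ∃ p ∈ hermiteSpan, sob 0 (f - p) < δ := by
  set K : Submodule ℝ (Lp ℝ 2 (volume : Measure Plane)) :=
    hermiteSpan.map (SchwartzMap.toLpCLM ℝ ℝ 2 volume : Sch →L[ℝ] _).toLinearMap with hK
  -- If g is orthogonal to all polynomials times γ, every moment of gγ vanishes. Integrating the
  -- exponential series term by term, dominated by |g| γ e^{|c|} (a product of two L² functions),
  -- shows that the Fourier transform of gγ is zero.
  have horth : Kᗮ = ⊥ := by
    rw [Submodule.eq_bot_iff]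
    intro g hg
    rw [Submodule.mem_orthogonal] at hg
    have hgm : MemLp g 2 := Lp.memLp g
    have h1 : ∀ ζ m, ∫ x, g x * gam x * (inner ℝ ζ x : ℝ) ^ m = 0 := by
      intro ζ m
      have := hg ((hermiteS ζ m).toLp 2) ⟨_, hermiteS_mem ζ m, rfl⟩
      rw [L2.inner_def] at this
      rw [← this]
      apply integral_congr_ae
      filter_upwards [(hermiteS ζ m).coeFn_toLp 2] with x hx
      rw [hx, hermiteS_apply]; simp; ring
    set h : Plane → ℂ := fun x => ((g x * gam x : ℝ) : ℂ) with hh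
    have hi : Integrable h := by
      have : Integrable (fun x => g x * gam x) := hgm.integrable_mul (gam.memLp 2)
      exact this.ofReal
    have h0 : ∀ ζ : Plane, 𝓕 h ζ = 0 := by
      intro ζ
      rw [Real.fourier_eq']
      set c : Plane → ℝ := fun x => -2 * Real.pi * inner ℝ x ζ with hc
      set b : ℝ := 2 * Real.pi * ‖ζ‖ with hb
      have hcb : ∀ x, |c x| ≤ b * ‖x‖ := by
        intro x
        rw [hc, hb]
        simp only [abs_mul, abs_neg, abs_two, abs_of_pos Real.pi_pos]
        have := abs_real_inner_le_norm x ζ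
        calc 2 * Real.pi * |inner ℝ x ζ| ≤ 2 * Real.pi * (‖x‖ * ‖ζ‖) := by gcongr
          _ = _ := by ring
      have hcc : Continuous c := by fun_prop
      have hsum := hasSum_integral_of_dominated_convergence (μ := (volume : Measure Plane))
        (F := fun (m : ℕ) x => ((c x : ℂ) * Complex.I) ^ m / (m.factorial : ℂ) * h x)
        (f := fun x => Complex.exp ((c x : ℂ) * Complex.I) * h x)
        (fun (m : ℕ) x => |c x| ^ m / m.factorial * (|g x| * gam x))
        (fun m => (Continuous.aestronglyMeasurable (by fun_prop)).mul hi.aestronglyMeasurable)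
        (fun m => Eventually.of_forall fun x => by
          rw [hh]
          simp [abs_of_pos (gam_pos x)])
        (Eventually.of_forall fun x => (Real.summable_pow_div_factorial |c x|).mul_right _)
        (by
          have e : ∀ x, ∑' m : ℕ, |c x| ^ m / m.factorial * (|g x| * gam x) =
              |g x| * (gam x * Real.exp |c x|) := by
            intro x
            rw [tsum_mul_right, Real.exp_eq_exp_ℝ, NormedSpace.exp_eq_tsum_div]
            ring
          simp only [e]
          have hE : MemLp (fun x => gam x * Real.exp |c x|) 2 := by
            refine MemLp.of_le (((gaussS (1 / 16) (by norm_num)).memLp 2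
              (μ := volume)).const_mul (Real.exp (4 * b ^ 2)))
              (Continuous.aestronglyMeasurable (by fun_prop)) (Eventually.of_forall fun x => ?_)
            rw [Real.norm_of_nonneg (by have := gam_pos x; positivity)]
            exact (gam_mul_exp_le b (c x) x (hcb x)).trans (le_abs_self _)
          exact hgm.norm.integrable_mul hE)
        (Eventually.of_forall fun x => by
          refine HasSum.mul_right _ ?_
          rw [Complex.exp_eq_exp_ℂ]
          exact NormedSpace.expSeries_div_hasSum_exp _)
      have hz : ∀ m : ℕ, ∫ x, ((c x : ℂ) * Complex.I) ^ m / (m.factorial : ℂ) * h x = 0 := by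
        intro m
        have e : ∀ x, ((c x : ℂ) * Complex.I) ^ m / (m.factorial : ℂ) * h x =
            ((-2 * Real.pi) ^ m * Complex.I ^ m / (m.factorial : ℂ)) *
              ((g x * gam x * (inner ℝ ζ x : ℝ) ^ m : ℝ) : ℂ) := by
          intro x
          rw [hh, hc, real_inner_comm]
          push_cast
          ring
        simp only [e]
        rw [integral_const_mul, integral_complex_ofReal, h1]
        simp
      simp only [hz] at hsum
      exact hsum.unique hasSum_zero
    have hae := ae_eq_zero_of_fourier_eq_zero hi h0
    rw [Lp.eq_zero_iff_ae_eq_zero]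
    filter_upwards [hae] with x hx
    have hx' : ((g x * gam x : ℝ) : ℂ) = 0 := hx
    have : g x * gam x = 0 := by exact_mod_cast hx'
    simpa [(gam_pos x).ne'] using this
  have htop := Submodule.topologicalClosure_eq_top_iff.2 horth
  have hmem : f.toLp 2 volume ∈ K.topologicalClosure := by rw [htop]; trivial
  rw [← SetLike.mem_coe, Submodule.topologicalClosure_coe, Metric.mem_closure_iff] at hmem
  obtain ⟨q, ⟨p, hp, rfl⟩, hq⟩ := hmem δ hδ
  refine ⟨p, hp, ?_⟩
  rw [dist_eq_norm] at hq
  exact hq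

/-- The oscillator has dense range for all weighted Sobolev seminorms. -/
theorem oscH_dense_range (k : ℕ) (f : Sch) {δ : ℝ} (hδ : 0 < δ) : ∃ u, sob k (f - oscH u) < δ := by
  obtain ⟨C, hC0, hC⟩ := sob_le_iterate k
  obtain ⟨p, hp, hpf⟩ := hermiteSpan_dense (oscH^[k] f) (δ := δ / (C + 1)) (by positivity)
  -- With p = H^{k+1}u, the difference Hᵏf - p is Hᵏ(f - Hu), which controls f - Hu in `sob k`.
  obtain ⟨u, _, rfl⟩ := exists_iterate_oscH_eq (k + 1) hp
  refine ⟨u, (hC _).trans_lt ?_⟩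
  have e : oscH^[k] (f - oscH u) = oscH^[k] f - oscH^[k + 1] u := by
    rw [Function.iterate_succ_apply]
    exact iterate_map_sub oscH k f (oscH u)
  rw [e]
  calc C * sob 0 (oscH^[k] f - oscH^[k + 1] u)
      ≤ (C + 1) * sob 0 (oscH^[k] f - oscH^[k + 1] u) := by gcongr; linarith
    _ < (C + 1) * (δ / (C + 1)) := by gcongr
    _ = δ := by field_simp

/-! ### Bounded smooth multipliers and the angular velocity profile -/

/-- Smooth functions all of whose derivatives are bounded. -/
def BddSmooth (g : Plane → ℝ) : Prop :=
  ContDiff ℝ (⊤ : ℕ∞) g ∧ ∀ n : ℕ, ∃ C, ∀ x, ‖iteratedFDeriv ℝ n g x‖ ≤ C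

lemma BddSmooth.temperate {g : Plane → ℝ} (hg : BddSmooth g) : g.HasTemperateGrowth :=
  ⟨hg.1, fun n => by obtain ⟨C, hC⟩ := hg.2 n; exact ⟨0, C, fun x => by simpa using hC x⟩⟩

lemma BddSmooth.add {g h : Plane → ℝ} (hg : BddSmooth g) (hh : BddSmooth h) :
    BddSmooth (fun x => g x + h x) := by
  refine ⟨hg.1.add hh.1, fun n => ?_⟩
  obtain ⟨C, hC⟩ := hg.2 n
  obtain ⟨C', hC'⟩ := hh.2 n
  refine ⟨C + C', fun x => ?_⟩
  have e : (fun x => g x + h x) = g + h := rfl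
  rw [e, iteratedFDeriv_add_apply (hg.1.of_le (by exact_mod_cast le_top)).contDiffAt
    (hh.1.of_le (by exact_mod_cast le_top)).contDiffAt]
  exact (norm_add_le _ _).trans (add_le_add (hC x) (hC' x))

lemma norm_iteratedFDeriv_clm_comp_le {F G : Type*} [NormedAddCommGroup F] [NormedSpace ℝ F]
    [NormedAddCommGroup G] [NormedSpace ℝ G] (L : F →L[ℝ] G) {g : Plane → F}
    (hg : ContDiff ℝ (⊤ : ℕ∞) g) (n : ℕ) (x : Plane) :
    ‖iteratedFDeriv ℝ n (fun x => L (g x)) x‖ ≤ ‖L‖ * ‖iteratedFDeriv ℝ n g x‖ :=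
  L.norm_iteratedFDeriv_comp_left (hg.of_le (by exact_mod_cast le_top)).contDiffAt le_rfl

lemma BddSmooth.const_mul {g : Plane → ℝ} (hg : BddSmooth g) (c : ℝ) :
    BddSmooth (fun x => c * g x) := by
  refine ⟨contDiff_const.mul hg.1, fun n => ?_⟩
  obtain ⟨C, hC⟩ := hg.2 n
  refine ⟨‖(c • ContinuousLinearMap.id ℝ ℝ)‖ * C, fun x => ?_⟩
  refine (norm_iteratedFDeriv_clm_comp_le (c • ContinuousLinearMap.id ℝ ℝ) hg.1 n x).trans ?_
  gcongr; exact hC x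

lemma BddSmooth.pd {g : Plane → ℝ} (hg : BddSmooth g) (v : Plane) :
    BddSmooth (fun x => fderiv ℝ g x v) := by
  have h1 : ContDiff ℝ (⊤ : ℕ∞) (fderiv ℝ g) := (contDiff_infty_iff_fderiv.1 hg.1).2
  refine ⟨h1.clm_apply contDiff_const, fun n => ?_⟩
  obtain ⟨C, hC⟩ := hg.2 (n + 1)
  refine ⟨‖ContinuousLinearMap.apply ℝ ℝ v‖ * C, fun x => ?_⟩
  refine (norm_iteratedFDeriv_clm_comp_le (ContinuousLinearMap.apply ℝ ℝ v) h1 n x).trans ?_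
  gcongr
  rw [norm_iteratedFDeriv_fderiv]; exact hC x

lemma BddSmooth.bounded {g : Plane → ℝ} (hg : BddSmooth g) : ∃ C, 0 ≤ C ∧ ∀ x, |g x| ≤ C := by
  obtain ⟨C, hC⟩ := hg.2 0
  refine ⟨C, (norm_nonneg _).trans (hC 0), fun x => by simpa using hC x⟩

/-- The functional representing a coordinate, as a map from scalars to functionals. -/
def coordSpan (i : Fin 2) : ℝ →L[ℝ] (Plane →L[ℝ] ℝ) :=
  ContinuousLinearMap.toSpanSingleton ℝ (EuclideanSpace.proj (𝕜 := ℝ) i : Plane →L[ℝ] ℝ)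

lemma clm_eq_coordSpan (L : Plane →L[ℝ] ℝ) :
    L = coordSpan 0 (L (unitVec 0)) + coordSpan 1 (L (unitVec 1)) := by
  ext v
  change L v = L (unitVec 0) * v 0 + L (unitVec 1) * v 1
  rw [mul_comm _ (v 0), mul_comm _ (v 1), ← smul_eq_mul, ← smul_eq_mul,
    ← map_smul, ← map_smul, ← map_add]
  congr 1
  ext i; fin_cases i <;> simp [unitVec]

/-- A space of bounded smooth functions that is closed under partial derivatives consists of
functions with bounded derivatives. -/
lemma bddSmooth_of_closed (V : Set (Plane → ℝ))
    (h : ∀ f ∈ V, ContDiff ℝ (⊤ : ℕ∞) f ∧ (∃ C, ∀ x, |f x| ≤ C) ∧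
      ∀ i, (fun x => fderiv ℝ f x (unitVec i)) ∈ V) {f : Plane → ℝ} (hf : f ∈ V) :
    BddSmooth f := by
  refine ⟨(h f hf).1, fun n => ?_⟩
  induction n generalizing f with
  | zero =>
    obtain ⟨C, hC⟩ := (h f hf).2.1
    exact ⟨C, fun x => by simpa using hC x⟩
  | succ n ih =>
    obtain ⟨C₀, hC₀⟩ := ih ((h f hf).2.2 0)
    obtain ⟨C₁, hC₁⟩ := ih ((h f hf).2.2 1)
    have s0 := (h _ ((h f hf).2.2 0)).1
    have s1 := (h _ ((h f hf).2.2 1)).1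
    refine ⟨‖coordSpan 0‖ * C₀ + ‖coordSpan 1‖ * C₁, fun x => ?_⟩
    rw [← norm_iteratedFDeriv_fderiv]
    have e : fderiv ℝ f = (fun x => coordSpan 0 (fderiv ℝ f x (unitVec 0))) +
        (fun x => coordSpan 1 (fderiv ℝ f x (unitVec 1))) := by
      funext x; exact clm_eq_coordSpan _
    have t0 : ContDiff ℝ n (fun x => coordSpan 0 (fderiv ℝ f x (unitVec 0))) :=
      ((coordSpan 0).contDiff.comp s0).of_le (by exact_mod_cast le_top)
    have t1 : ContDiff ℝ n (fun x => coordSpan 1 (fderiv ℝ f x (unitVec 1))) :=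
      ((coordSpan 1).contDiff.comp s1).of_le (by exact_mod_cast le_top)
    rw [e, iteratedFDeriv_add_apply t0.contDiffAt t1.contDiffAt]
    refine (norm_add_le _ _).trans (add_le_add ?_ ?_)
    · refine (norm_iteratedFDeriv_clm_comp_le (coordSpan 0) s0 n x).trans ?_
      gcongr; exact hC₀ x
    · refine (norm_iteratedFDeriv_clm_comp_le (coordSpan 1) s1 n x).trans ?_
      gcongr; exact hC₁ x

lemma sob_zero_le_of_abs_le {f g : Sch} {C : ℝ} (hC : 0 ≤ C) (h : ∀ x, |f x| ≤ C * |g x|) :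
    sob 0 f ≤ C * sob 0 g := by
  rw [sob_zero_eq_sqrt, sob_zero_eq_sqrt]
  refine Real.sqrt_le_iff.2 ⟨by positivity, ?_⟩
  rw [mul_pow, Real.sq_sqrt (integral_nonneg fun x => sq_nonneg _), ← integral_const_mul]
  refine integral_mono ((f.memLp 2).integrable_sq) (((g.memLp 2).integrable_sq).const_mul _)
    fun x => ?_
  have := h x
  simp only
  rw [← sq_abs (f x), ← sq_abs (g x), ← mul_pow]
  gcongr

/-- Coordinates commute with multiplication by g, and a derivative falling on g produces another
bounded smooth multiplier, so the induction runs over all g simultaneously. -/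
lemma sob_mulS_le (k : ℕ) {g : Plane → ℝ} (hg : BddSmooth g) :
    ∃ C, 0 ≤ C ∧ ∀ u, sob k (mulS g u) ≤ C * sob k u := by
  induction k generalizing g with
  | zero =>
    obtain ⟨C, hC0, hC⟩ := hg.bounded
    refine ⟨C, hC0, fun u => sob_zero_le_of_abs_le hC0 fun x => ?_⟩
    rw [mulS_apply hg.temperate, abs_mul]
    gcongr; exact hC x
  | succ k ih =>
    obtain ⟨C, hC0, hC⟩ := ih hg
    obtain ⟨A, hA0, hA⟩ := ih (hg.pd (unitVec 0))
    obtain ⟨B, hB0, hB⟩ := ih (hg.pd (unitVec 1))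
    refine ⟨C + A + B, by positivity, fun u => ?_⟩
    have hx : ∀ i, sob k (xm i (mulS g u)) ≤ C * sob k (xm i u) := fun i => by
      have : xm i (mulS g u) = mulS g (xm i u) := by
        ext x
        rw [xm_apply, mulS_apply hg.temperate, mulS_apply hg.temperate, xm_apply]; ring
      rw [this]; exact hC _
    have hp : ∀ i, sob k (pd i (mulS g u)) ≤
        sob k (mulS (fun x => fderiv ℝ g x (unitVec i)) u) + C * sob k (pd i u) := fun i => by
      rw [pd_mulS hg.temperate]
      exact (map_add_le_add _ _ _).trans (by gcongr; exact hC _)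
    have h0 := hp 0; have h1 := hp 1; have h2 := hx 0; have h3 := hx 1
    have h4 := hC u; have h5 := hA u; have h6 := hB u
    have h7 := sob_le_succ k u
    have h8 : A * sob k u ≤ A * sob (k + 1) u := by gcongr
    have h9 : B * sob k u ≤ B * sob (k + 1) u := by gcongr
    have e := sob_succ k u
    rw [Fin.sum_univ_two] at e
    have : C * sob (k + 1) u = C * sob k u + (C * sob k (pd 0 u) + C * sob k (xm 0 u) +
      (C * sob k (pd 1 u) + C * sob k (xm 1 u))) := by rw [e]; ring
    rw [sob_succ, Fin.sum_univ_two]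
    linarith

/-- `∫₀¹ s^j e^{-st} ds`. -/
def expMoment (j : ℕ) (t : ℝ) : ℝ := ∫ s in (0 : ℝ)..1, s ^ j * Real.exp (-s * t)

lemma expMoment_hasDerivAt (j : ℕ) (t : ℝ) :
    HasDerivAt (expMoment j) (-expMoment (j + 1) t) t := by
  have h := intervalIntegral.hasDerivAt_integral_of_dominated_loc_of_deriv_le
    (μ := volume) (a := (0 : ℝ)) (b := 1) (x₀ := t) (s := Metric.ball t 1)
    (F := fun t s => s ^ j * Real.exp (-s * t))
    (F' := fun t s => -(s ^ (j + 1) * Real.exp (-s * t))) (bound := fun _ => Real.exp (|t| + 1))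
    (Metric.ball_mem_nhds t one_pos)
    (Eventually.of_forall fun t => (by fun_prop : Continuous _).aestronglyMeasurable)
    ((by fun_prop : Continuous fun s : ℝ => s ^ j * Real.exp (-s * t)).intervalIntegrable _ _)
    ((by fun_prop : Continuous fun s : ℝ =>
      -(s ^ (j + 1) * Real.exp (-s * t))).aestronglyMeasurable)
    (Eventually.of_forall fun s hs y hy => by
      rw [Set.uIoc_of_le zero_le_one] at hs
      rw [norm_neg, norm_mul, Real.norm_of_nonneg (Real.exp_pos _).le, norm_pow,
        Real.norm_of_nonneg hs.1.le]
      have h1 : s ^ (j + 1) ≤ 1 := pow_le_one₀ hs.1.le hs.2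
      have h2 : -s * y ≤ |t| + 1 := by
        have : |y| ≤ |t| + 1 := by
          rw [Metric.mem_ball, Real.dist_eq] at hy
          have := abs_sub_abs_le_abs_sub y t
          linarith
        calc -s * y ≤ |(-s) * y| := le_abs_self _
          _ = s * |y| := by rw [abs_mul, abs_neg, abs_of_pos hs.1]
          _ ≤ 1 * |y| := by gcongr; exact hs.2
          _ ≤ _ := by linarith
      calc s ^ (j + 1) * Real.exp (-s * y) ≤ 1 * Real.exp (|t| + 1) := by gcongr
        _ = _ := one_mul _)
    (intervalIntegrable_const) (Eventually.of_forall fun s _ y _ => by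
      have : HasDerivAt (fun y : ℝ => s ^ j * Real.exp (-s * y))
          (s ^ j * (Real.exp (-s * y) * (-s * 1))) y :=
        (((hasDerivAt_id y).const_mul (-s)).exp).const_mul _
      exact this.congr_deriv (by rw [pow_succ]; ring))
  rw [expMoment, ← intervalIntegral.integral_neg]
  exact h.2

lemma expMoment_contDiff (j : ℕ) : ContDiff ℝ (⊤ : ℕ∞) (expMoment j) := by
  rw [contDiff_infty]
  intro n
  induction n generalizing j with
  | zero =>
    simp only [Nat.cast_zero, contDiff_zero]
    exact continuous_iff_continuousAt.2 fun t => (expMoment_hasDerivAt j t).continuousAt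
  | succ n ih =>
    push_cast
    rw [contDiff_succ_iff_deriv]
    refine ⟨fun t => (expMoment_hasDerivAt j t).differentiableAt, by simp, ?_⟩
    have : deriv (expMoment j) = fun t => -expMoment (j + 1) t :=
      funext fun t => (expMoment_hasDerivAt j t).deriv
    rw [this]
    exact (ih (j + 1)).neg

lemma mul_expMoment_succ (j : ℕ) (t : ℝ) :
    t * expMoment (j + 1) t = (j + 1) * expMoment j t - Real.exp (-t) := by
  have hd : ∀ s ∈ Set.uIcc (0 : ℝ) 1, HasDerivAt (fun s : ℝ => s ^ (j + 1) * Real.exp (-s * t))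
      ((j + 1) * (s ^ j * Real.exp (-s * t)) - t * (s ^ (j + 1) * Real.exp (-s * t))) s := by
    intro s _
    have h1 : HasDerivAt (fun s : ℝ => Real.exp (-s * t)) (Real.exp (-s * t) * (-1 * t)) s :=
      (((hasDerivAt_id s).neg).mul_const t).exp
    refine ((hasDerivAt_pow (j + 1) s).mul h1).congr_deriv ?_
    rw [Nat.add_sub_cancel]; push_cast; ring
  have hc : ∀ i : ℕ, Continuous fun s : ℝ => s ^ i * Real.exp (-s * t) := fun i => by fun_prop
  have h := intervalIntegral.integral_eq_sub_of_hasDerivAt hd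
    (((hc j).const_mul _).sub ((hc (j + 1)).const_mul _) |>.intervalIntegrable _ _)
  rw [intervalIntegral.integral_sub (((hc j).const_mul _).intervalIntegrable _ _)
    (((hc (j + 1)).const_mul _).intervalIntegrable _ _), intervalIntegral.integral_const_mul,
    intervalIntegral.integral_const_mul] at h
  simp only [expMoment]
  simp at h ⊢
  linarith

lemma mul_expMoment_zero (t : ℝ) : t * expMoment 0 t = 1 - Real.exp (-t) := by
  have hd : ∀ s ∈ Set.uIcc (0 : ℝ) 1, HasDerivAt (fun s : ℝ => Real.exp (-s * t))
      (-(t * (s ^ 0 * Real.exp (-s * t)))) s := by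
    intro s _
    have h1 : HasDerivAt (fun s : ℝ => Real.exp (-s * t)) (Real.exp (-s * t) * (-1 * t)) s :=
      (((hasDerivAt_id s).neg).mul_const t).exp
    exact h1.congr_deriv (by ring)
  have h := intervalIntegral.integral_eq_sub_of_hasDerivAt hd
    ((by fun_prop : Continuous _).intervalIntegrable _ _)
  rw [intervalIntegral.integral_neg, intervalIntegral.integral_const_mul] at h
  rw [expMoment]
  simp at h ⊢
  linarith

lemma expMoment_nonneg (j : ℕ) (t : ℝ) : 0 ≤ expMoment j t :=
  intervalIntegral.integral_nonneg zero_le_one fun s hs => by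
    have := hs.1; positivity

lemma expMoment_le_one (j : ℕ) {t : ℝ} (ht : 0 ≤ t) : expMoment j t ≤ 1 := by
  have hc : Continuous fun s : ℝ => s ^ j * Real.exp (-s * t) := by fun_prop
  have : expMoment j t ≤ ∫ s in (0 : ℝ)..1, (1 : ℝ) := by
    refine intervalIntegral.integral_mono_on zero_le_one (hc.intervalIntegrable _ _)
      intervalIntegrable_const fun s hs => ?_
    have h1 : s ^ j ≤ 1 := pow_le_one₀ hs.1 hs.2
    have h2 : Real.exp (-s * t) ≤ 1 := Real.exp_le_one_iff.2 (by nlinarith [hs.1])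
    have := hs.1
    calc s ^ j * Real.exp (-s * t) ≤ 1 * 1 := by gcongr
      _ = 1 := one_mul 1
  simpa using this

/-- Each integration by parts (`mul_expMoment_succ`) trades one factor t for an integer factor and
discards a nonpositive boundary term. -/
lemma pow_mul_expMoment_le (j : ℕ) {t : ℝ} (ht : 0 ≤ t) :
    t ^ (j + 1) * expMoment j t ≤ j.factorial := by
  induction j with
  | zero => simp [mul_expMoment_zero, (Real.exp_pos _).le]
  | succ j ih =>
    rw [pow_succ, mul_assoc, mul_expMoment_succ, Nat.factorial_succ]
    push_cast
    have : 0 ≤ t ^ (j + 1) * Real.exp (-t) := by positivity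
    nlinarith

lemma exp_neg_le_expMoment_zero {t : ℝ} (ht : 0 ≤ t) : Real.exp (-t) ≤ expMoment 0 t := by
  have hc : Continuous fun s : ℝ => s ^ 0 * Real.exp (-s * t) := by fun_prop
  have : ∫ s in (0 : ℝ)..1, Real.exp (-t) ≤ expMoment 0 t := by
    refine intervalIntegral.integral_mono_on zero_le_one intervalIntegrable_const
      (hc.intervalIntegrable _ _) fun s hs => ?_
    rw [pow_zero, one_mul]
    refine Real.exp_le_exp.2 ?_
    nlinarith [hs.2]
  simpa using this

/-- Monomials times `∫₀¹ s^j e^{-s|x|²/4} ds`. -/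
def momentFun (a b j : ℕ) (x : Plane) : ℝ := x 0 ^ a * x 1 ^ b * expMoment j (‖x‖ ^ 2 / 4)

lemma abs_coord_le (x : Plane) (i : Fin 2) : |x i| ≤ ‖x‖ := by
  have := PiLp.norm_apply_le x i
  simpa using this

lemma momentFun_bounded {a b j : ℕ} (h : a + b ≤ 2 * j + 2) (x : Plane) :
    |momentFun a b j x| ≤ 4 ^ (j + 1) * j.factorial := by
  have ht : 0 ≤ ‖x‖ ^ 2 / 4 := by positivity
  have hE0 := expMoment_nonneg j (‖x‖ ^ 2 / 4)
  have hE1 := expMoment_le_one j ht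
  have h1 : |momentFun a b j x| ≤ ‖x‖ ^ (a + b) * expMoment j (‖x‖ ^ 2 / 4) := by
    rw [momentFun, abs_mul, abs_mul, abs_pow, abs_pow, abs_of_nonneg hE0, pow_add]
    gcongr <;> exact abs_coord_le _ _
  have hf : (1 : ℝ) ≤ j.factorial := by exact_mod_cast j.factorial_pos
  have hp : (1 : ℝ) ≤ 4 ^ (j + 1) := one_le_pow₀ (by norm_num)
  rcases le_total ‖x‖ 1 with hx | hx
  · have h2 : ‖x‖ ^ (a + b) ≤ 1 := pow_le_one₀ (norm_nonneg _) hx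
    calc _ ≤ _ := h1
      _ ≤ 1 * 1 := by gcongr
      _ ≤ _ := by gcongr
  · calc _ ≤ _ := h1
      _ ≤ ‖x‖ ^ (2 * j + 2) * expMoment j (‖x‖ ^ 2 / 4) := by gcongr
      _ = 4 ^ (j + 1) * ((‖x‖ ^ 2 / 4) ^ (j + 1) * expMoment j (‖x‖ ^ 2 / 4)) := by
          rw [div_pow, ← pow_mul, ← mul_assoc, mul_div_cancel₀ _ (by positivity)]; ring_nf
      _ ≤ _ := by gcongr; exact pow_mul_expMoment_le j ht

lemma momentFun_contDiff (a b j : ℕ) : ContDiff ℝ (⊤ : ℕ∞) (momentFun a b j) := by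
  have h : ∀ i : Fin 2, ContDiff ℝ (⊤ : ℕ∞) fun x : Plane => x i := fun i =>
    (EuclideanSpace.proj (𝕜 := ℝ) i : Plane →L[ℝ] ℝ).contDiff
  exact ((h 0).pow a |>.mul ((h 1).pow b)).mul
    ((expMoment_contDiff j).comp ((contDiff_norm_sq ℝ).div_const 4))

lemma fderiv_momentFun (a b j : ℕ) (x v : Plane) : fderiv ℝ (momentFun a b j) x v =
    (a * momentFun (a - 1) b j x - 1 / 2 * momentFun (a + 1) b (j + 1) x) * v 0 +
      (b * momentFun a (b - 1) j x - 1 / 2 * momentFun a (b + 1) (j + 1) x) * v 1 := by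
  have h : ∀ i : Fin 2, HasFDerivAt (fun x : Plane => x i)
      (EuclideanSpace.proj (𝕜 := ℝ) i : Plane →L[ℝ] ℝ) x := fun i =>
    (EuclideanSpace.proj (𝕜 := ℝ) i : Plane →L[ℝ] ℝ).hasFDerivAt
  have hE : HasFDerivAt (fun x : Plane => expMoment j (‖x‖ ^ 2 / 4))
      ((-expMoment (j + 1) (‖x‖ ^ 2 / 4)) • ((4 : ℝ)⁻¹ • (2 • innerSL ℝ x))) x := by
    have h1 : HasFDerivAt (fun x : Plane => ‖x‖ ^ 2 / 4) ((4 : ℝ)⁻¹ • (2 • innerSL ℝ x)) x := by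
      simp only [div_eq_inv_mul]
      exact (hasStrictFDerivAt_norm_sq x).hasFDerivAt.const_mul (4 : ℝ)⁻¹
    exact (expMoment_hasDerivAt j _).comp_hasFDerivAt x h1
  have := (((h 0).pow a).mul ((h 1).pow b)).mul hE
  have e : fderiv ℝ (momentFun a b j) x = _ := this.fderiv
  rw [e]
  simp [momentFun, PiLp.inner_apply, Fin.sum_univ_two]
  ring

lemma bddSmooth_momentFun {a b j : ℕ} (h : a + b ≤ 2 * j + 2) : BddSmooth (momentFun a b j) := by
  -- The degree condition matches the decay t^{-(j+1)} of `expMoment j` at t = |x|²/4, hence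
  -- boundedness. It survives differentiation: a derivative either lowers an exponent or raises one
  -- exponent by 1 while raising j by 1.
  set V : Submodule ℝ (Plane → ℝ) :=
    Submodule.span ℝ {f | ∃ a b j, a + b ≤ 2 * j + 2 ∧ f = momentFun a b j} with hV
  have hm : ∀ {a b j}, a + b ≤ 2 * j + 2 → momentFun a b j ∈ V := fun h =>
    Submodule.subset_span ⟨_, _, _, h, rfl⟩
  refine bddSmooth_of_closed V ?_ (hm h)
  intro f hf
  induction hf using Submodule.span_induction with
  | mem f hf =>
    obtain ⟨a, b, j, h, rfl⟩ := hf
    refine ⟨momentFun_contDiff a b j, ⟨_, momentFun_bounded h⟩, fun i => ?_⟩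
    have e0 : (fun x => fderiv ℝ (momentFun a b j) x (unitVec 0)) =
        (a : ℝ) • momentFun (a - 1) b j - (1 / 2 : ℝ) • momentFun (a + 1) b (j + 1) := by
      funext x; rw [fderiv_momentFun]; simp [unitVec]
    have e1 : (fun x => fderiv ℝ (momentFun a b j) x (unitVec 1)) =
        (b : ℝ) • momentFun a (b - 1) j - (1 / 2 : ℝ) • momentFun a (b + 1) (j + 1) := by
      funext x; rw [fderiv_momentFun]; simp [unitVec]
    obtain rfl | rfl : i = 0 ∨ i = 1 := by fin_cases i <;> simp
    · rw [e0]
      exact V.sub_mem (V.smul_mem _ (hm (by omega))) (V.smul_mem _ (hm (by omega)))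
    · rw [e1]
      exact V.sub_mem (V.smul_mem _ (hm (by omega))) (V.smul_mem _ (hm (by omega)))
  | zero =>
    refine ⟨contDiff_const, ⟨0, by simp⟩, fun i => ?_⟩
    have : (fun x => fderiv ℝ (0 : Plane → ℝ) x (unitVec i)) = 0 := by
      funext x; simp
    rw [this]; exact V.zero_mem
  | add f g _ _ hf hg =>
    obtain ⟨hf1, ⟨C, hC⟩, hf2⟩ := hf
    obtain ⟨hg1, ⟨C', hC'⟩, hg2⟩ := hg
    refine ⟨hf1.add hg1, ⟨C + C', fun x => (abs_add_le _ _).trans (add_le_add (hC x) (hC' x))⟩,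
      fun i => ?_⟩
    have : (fun x => fderiv ℝ (f + g) x (unitVec i)) =
        (fun x => fderiv ℝ f x (unitVec i)) + fun x => fderiv ℝ g x (unitVec i) := by
      funext x
      rw [fderiv_add (hf1.differentiable (by simp) x) (hg1.differentiable (by simp) x)]; rfl
    rw [this]; exact V.add_mem (hf2 i) (hg2 i)
  | smul c f _ hf =>
    obtain ⟨hf1, ⟨C, hC⟩, hf2⟩ := hf
    refine ⟨contDiff_const.smul hf1, ⟨|c| * C, fun x => ?_⟩, fun i => ?_⟩
    · simp only [Pi.smul_apply, smul_eq_mul, abs_mul]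
      gcongr; exact hC x
    · have : (fun x => fderiv ℝ (c • f) x (unitVec i)) =
          c • fun x => fderiv ℝ f x (unitVec i) := by
        funext x
        rw [fderiv_const_smul (hf1.differentiable (by simp) x)]; rfl
      rw [this]; exact V.smul_mem _ (hf2 i)

/-- The angular velocity profile `8π φ(ξ) = (1 - e^{-|ξ|²/4}) / (|ξ|²/4)`. -/
def prof (x : Plane) : ℝ := expMoment 0 (‖x‖ ^ 2 / 4)

lemma prof_eq_momentFun : prof = momentFun 0 0 0 := by funext x; simp [prof, momentFun]

lemma bddSmooth_prof : BddSmooth prof := by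
  rw [prof_eq_momentFun]; exact bddSmooth_momentFun (by norm_num)

lemma bddSmooth_coord_mul_prof (i : Fin 2) : BddSmooth (fun x => x i * prof x) := by
  obtain rfl | rfl : i = 0 ∨ i = 1 := by fin_cases i <;> simp
  · have : (fun x : Plane => x 0 * prof x) = momentFun 1 0 0 := by
      funext x; simp [prof, momentFun]
    rw [this]; exact bddSmooth_momentFun (by norm_num)
  · have : (fun x : Plane => x 1 * prof x) = momentFun 0 1 0 := by
      funext x; simp [prof, momentFun]
    rw [this]; exact bddSmooth_momentFun (by norm_num)

lemma prof_pos (x : Plane) : 0 < prof x :=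
  (Real.exp_pos _).trans_le (exp_neg_le_expMoment_zero (by positivity))

lemma one_le_weight_mul_prof (x : Plane) : 1 ≤ (1 + ‖x‖ ^ 2 / 4) * prof x := by
  have h1 := exp_neg_le_expMoment_zero (t := ‖x‖ ^ 2 / 4) (by positivity)
  have h2 := mul_expMoment_zero (‖x‖ ^ 2 / 4)
  rw [prof, add_mul, one_mul, h2]; linarith

lemma bddSmooth_weight_mul_prof : BddSmooth fun x => (1 + ‖x‖ ^ 2 / 4) * prof x := by
  have e : (fun x => (1 + ‖x‖ ^ 2 / 4) * prof x) =
      fun x => prof x + ((1 / 4) * momentFun 2 0 0 x + (1 / 4) * momentFun 0 2 0 x) := by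
    funext x
    rw [norm_sq_plane]
    simp only [prof, momentFun, norm_sq_plane]; ring
  rw [e]
  exact bddSmooth_prof.add (((bddSmooth_momentFun (by norm_num)).const_mul _).add
    ((bddSmooth_momentFun (by norm_num)).const_mul _))

lemma inv_temperate {g : Plane → ℝ} (hg : g.HasTemperateGrowth) (h1 : ∀ x, 1 ≤ g x) :
    (fun x => (g x)⁻¹).HasTemperateGrowth := by
  -- The half-line t > 1/2 is an open neighbourhood of the range of g on which every derivative of
  -- inversion is bounded.
  refine Function.HasTemperateGrowth.comp' (t := Set.Ioi (1 / 2 : ℝ)) (g := Inv.inv)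
    (by rintro _ ⟨x, rfl⟩; exact (by norm_num : (1 / 2 : ℝ) < 1).trans_le (h1 x))
    isOpen_Ioi.uniqueDiffOn ?_ ?_ hg
  · exact fun t ht => (contDiffAt_inv ℝ
      (ne_of_gt ((by norm_num : (0 : ℝ) < 1 / 2).trans ht))).contDiffWithinAt
  · intro N
    refine ⟨0, N.factorial * 2 ^ (N + 1), by positivity, fun n hn t ht => ?_⟩
    have ht' : (1 / 2 : ℝ) < t := ht
    have ht0 : 0 < t := by linarith
    rw [norm_iteratedFDerivWithin_eq_norm_iteratedDerivWithin,
      iteratedDerivWithin_of_isOpen isOpen_Ioi ht, iteratedDeriv_eq_iterate, iter_deriv_inv,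
      norm_mul, norm_mul, norm_pow, norm_neg, norm_one, one_pow, one_mul, pow_zero, mul_one,
      Real.norm_of_nonneg (by positivity), Real.norm_of_nonneg (by positivity)]
    have e : t ^ (-1 - n : ℤ) = (t⁻¹) ^ (n + 1) := by
      rw [inv_pow, ← zpow_natCast, ← zpow_neg]; congr 1; push_cast; ring
    have h2 : t⁻¹ ≤ 2 := by
      rw [inv_le_comm₀ ht0 two_pos]; linarith
    rw [e]
    calc (n.factorial : ℝ) * t⁻¹ ^ (n + 1) ≤ N.factorial * 2 ^ (n + 1) := by
          gcongr
      _ ≤ N.factorial * 2 ^ (N + 1) := by gcongr; norm_num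

/-- The profile decays like 4/|x|², so its inverse grows quadratically. With t = |x|²/4 it is (1 +
t) divided by (1 + t)`prof`, and this last product is bounded smooth and at least 1. -/
lemma inv_prof_temperate : (fun x => (prof x)⁻¹).HasTemperateGrowth := by
  have h := inv_temperate bddSmooth_weight_mul_prof.temperate one_le_weight_mul_prof
  have h2 : (fun x : Plane => 1 + ‖x‖ ^ 2 / 4).HasTemperateGrowth := by
    have : (fun x : Plane => 1 + ‖x‖ ^ 2 / 4) = fun x => 1 + ‖x‖ ^ 2 * (1 / 4) := by
      funext x; ring
    rw [this]
    exact (Function.HasTemperateGrowth.const 1).add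
      ((Function.hasTemperateGrowth_norm_sq Plane).mul (Function.HasTemperateGrowth.const _))
  have e : (fun x => (prof x)⁻¹) =
      fun x => (1 + ‖x‖ ^ 2 / 4) * ((1 + ‖x‖ ^ 2 / 4) * prof x)⁻¹ := by
    funext x
    rw [mul_inv, mul_inv_cancel_left₀ (by positivity)]
  rw [e]
  exact h2.mul h

/-! ### Convolution of Schwartz functions with admissible kernels -/

/-- The reference weight `(1 + |x|)⁻³`, which is integrable on the plane. -/
def wt (x : Plane) : ℝ := ((1 + ‖x‖) ^ 3)⁻¹

lemma wt_pos (x : Plane) : 0 < wt x := by rw [wt]; positivity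

lemma wt_le_one (x : Plane) : wt x ≤ 1 := by
  rw [wt]; exact inv_le_one_of_one_le₀ (one_le_pow₀ (by simp))

lemma wt_continuous : Continuous wt := by
  unfold wt
  exact Continuous.inv₀ (by fun_prop) fun x => by positivity

lemma wt_integrable : Integrable wt := by
  have h := integrable_one_add_norm (E := Plane) (μ := volume) (r := 3) (by simp; norm_num)
  refine h.congr (Eventually.of_forall fun x => ?_)
  simp only [wt]
  rw [Real.rpow_neg (by positivity)]
  norm_cast

lemma wt_sub_le (x y : Plane) : wt (x - y) ≤ (1 + ‖x‖) ^ 3 * wt y := by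
  rw [wt, wt, ← div_eq_mul_inv, ← one_div, div_le_div_iff₀ (by positivity) (by positivity), one_mul,
    ← mul_pow]
  gcongr
  have : ‖y‖ ≤ ‖x‖ + ‖x - y‖ := by
    have := norm_sub_le x (x - y)
    simpa using this
  nlinarith [norm_nonneg x, norm_nonneg (x - y)]

lemma schwartz_le_wt {F : Type*} [NormedAddCommGroup F] [NormedSpace ℝ F] (f : 𝓢(Plane, F)) :
    ∃ C, 0 ≤ C ∧ ∀ x, ‖f x‖ ≤ C * wt x := by
  refine ⟨2 ^ 3 * ((Finset.Iic (3, 0)).sup fun m => SchwartzMap.seminorm ℝ m.1 m.2) f,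
    by positivity, fun x => ?_⟩
  have := SchwartzMap.one_add_le_sup_seminorm_apply (𝕜 := ℝ) (m := (3, 0)) (k := 3) (n := 0)
    le_rfl le_rfl f x
  rw [norm_iteratedFDeriv_zero] at this
  rw [wt, ← div_eq_mul_inv, le_div_iff₀ (by positivity), mul_comm]
  exact this

/-- Kernels whose convolution with Schwartz functions makes sense. -/
def Adm (κ : Plane → ℝ) : Prop := Integrable fun y => κ y * wt y

lemma Adm.aesm {κ : Plane → ℝ} (hκ : Adm κ) : AEStronglyMeasurable κ := by
  have h : κ = fun y => κ y * wt y * (wt y)⁻¹ := by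
    funext y; rw [mul_inv_cancel_right₀ (wt_pos y).ne']
  rw [h]
  exact hκ.aestronglyMeasurable.mul
    (wt_continuous.inv₀ fun y => (wt_pos y).ne').aestronglyMeasurable

lemma Adm.add {κ κ' : Plane → ℝ} (hκ : Adm κ) (hκ' : Adm κ') : Adm fun y => κ y + κ' y := by
  have := Integrable.add hκ hκ'
  refine this.congr (Eventually.of_forall fun y => ?_)
  simp only [Pi.add_apply]; ring

lemma Adm.of_integrable {κ : Plane → ℝ} (hκ : Integrable κ) : Adm κ := by
  refine hκ.mono (hκ.aestronglyMeasurable.mul wt_continuous.aestronglyMeasurable)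
    (Eventually.of_forall fun y => ?_)
  rw [norm_mul, Real.norm_of_nonneg (wt_pos y).le]
  exact mul_le_of_le_one_right (norm_nonneg _) (wt_le_one y)

lemma Adm.of_bounded {κ : Plane → ℝ} (hc : Continuous κ) {B : ℝ} (hB : ∀ y, |κ y| ≤ B) : Adm κ := by
  refine (wt_integrable.const_mul B).mono'
    (hc.mul wt_continuous).aestronglyMeasurable (Eventually.of_forall fun y => ?_)
  rw [norm_mul, Real.norm_of_nonneg (wt_pos y).le]
  have := wt_pos y
  gcongr; exact hB y

/-- Convolution with a scalar kernel. -/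
def conv {F : Type*} [NormedAddCommGroup F] [NormedSpace ℝ F] (κ : Plane → ℝ) (f : Plane → F)
    (x : Plane) : F := ∫ y, κ y • f (x - y)

section Conv

variable {F : Type*} [NormedAddCommGroup F] [NormedSpace ℝ F]

lemma conv_integrable {κ : Plane → ℝ} (hκ : Adm κ) (f : 𝓢(Plane, F)) (x : Plane) :
    Integrable fun y => κ y • f (x - y) := by
  obtain ⟨C, hC0, hC⟩ := schwartz_le_wt f
  refine (hκ.norm.const_mul (C * (1 + ‖x‖) ^ 3)).mono'
    (hκ.aesm.smul (Continuous.aestronglyMeasurable (by fun_prop)))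
    (Eventually.of_forall fun y => ?_)
  have hw := wt_pos y
  rw [norm_smul, norm_mul, Real.norm_of_nonneg hw.le]
  calc ‖κ y‖ * ‖f (x - y)‖ ≤ ‖κ y‖ * (C * ((1 + ‖x‖) ^ 3 * wt y)) := by
        gcongr
        exact (hC _).trans (by gcongr; exact wt_sub_le x y)
    _ = _ := by ring

lemma conv_norm_le {κ : Plane → ℝ} (hκ : Adm κ) (f : 𝓢(Plane, F)) :
    ∃ C, ∀ x, ‖conv κ f x‖ ≤ C * (1 + ‖x‖) ^ 3 := by
  obtain ⟨C, hC0, hC⟩ := schwartz_le_wt f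
  refine ⟨C * ∫ y, ‖κ y * wt y‖, fun x => ?_⟩
  rw [conv]
  calc ‖∫ y, κ y • f (x - y)‖ ≤ ∫ y, C * (1 + ‖x‖) ^ 3 * ‖κ y * wt y‖ := by
        refine norm_integral_le_of_norm_le (hκ.norm.const_mul _) (Eventually.of_forall fun y => ?_)
        have hw := wt_pos y
        rw [norm_smul, norm_mul, Real.norm_of_nonneg hw.le]
        calc ‖κ y‖ * ‖f (x - y)‖ ≤ ‖κ y‖ * (C * ((1 + ‖x‖) ^ 3 * wt y)) := by
              gcongr
              exact (hC _).trans (by gcongr; exact wt_sub_le x y)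
          _ = _ := by ring
    _ = _ := by rw [integral_const_mul]; ring

/-- The derivative falls on the Schwartz factor, so the kernel needs integrability only. The
domination is uniform on the unit ball around x, whence 2 + |x|. -/
lemma conv_hasFDerivAt {κ : Plane → ℝ} (hκ : Adm κ) (f : 𝓢(Plane, F)) (x : Plane) :
    HasFDerivAt (conv κ f) (conv κ (SchwartzMap.fderivCLM ℝ Plane F f) x) x := by
  obtain ⟨C, hC0, hC⟩ := schwartz_le_wt (SchwartzMap.fderivCLM ℝ Plane F f)
  refine hasFDerivAt_integral_of_dominated_of_fderiv_le (μ := volume)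
    (F := fun x y => κ y • f (x - y))
    (F' := fun x y => κ y • SchwartzMap.fderivCLM ℝ Plane F f (x - y))
    (bound := fun y => C * (2 + ‖x‖) ^ 3 * ‖κ y * wt y‖) (Metric.ball_mem_nhds x one_pos)
    (Eventually.of_forall fun x => (conv_integrable hκ f x).aestronglyMeasurable)
    (conv_integrable hκ f x) (conv_integrable hκ _ x).aestronglyMeasurable
    (Eventually.of_forall fun y x' hx' => ?_) (hκ.norm.const_mul _)
    (Eventually.of_forall fun y x' _ => ?_)
  · have hw := wt_pos y
    have hx : ‖x'‖ ≤ 1 + ‖x‖ := by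
      rw [mem_ball_iff_norm] at hx'
      have := norm_le_norm_add_norm_sub' x' x
      linarith
    rw [norm_smul, norm_mul, Real.norm_of_nonneg hw.le]
    calc ‖κ y‖ * ‖SchwartzMap.fderivCLM ℝ Plane F f (x' - y)‖
        ≤ ‖κ y‖ * (C * ((2 + ‖x‖) ^ 3 * wt y)) := by
          gcongr
          refine (hC _).trans ?_
          gcongr
          refine (wt_sub_le x' y).trans ?_
          gcongr ?_ ^ 3 * _
          linarith
      _ = _ := by ring
  · have h1 : HasFDerivAt (fun x : Plane => x - y) (ContinuousLinearMap.id ℝ Plane) x' :=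
      (hasFDerivAt_id x').sub_const y
    exact ((f.hasFDerivAt (x' - y)).comp x' h1).const_smul (κ y)

end Conv

lemma conv_contDiff_bound {κ : Plane → ℝ} (hκ : Adm κ) (n : ℕ) :
    ∀ {F : Type} [NormedAddCommGroup F] [NormedSpace ℝ F] (f : 𝓢(Plane, F)),
      ContDiff ℝ n (conv κ f) ∧ ∃ C, ∀ x, ‖iteratedFDeriv ℝ n (conv κ f) x‖ ≤ C * (1 + ‖x‖) ^ 3 := by
  induction n with
  | zero =>
    intro F _ _ f
    refine ⟨?_, ?_⟩
    · simp only [Nat.cast_zero, contDiff_zero]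
      exact continuous_iff_continuousAt.2 fun x => (conv_hasFDerivAt hκ f x).continuousAt
    · obtain ⟨C, hC⟩ := conv_norm_le hκ f
      exact ⟨C, fun x => by rw [norm_iteratedFDeriv_zero]; exact hC x⟩
  | succ n ih =>
    intro F _ _ f
    obtain ⟨h1, C, hC⟩ := ih (SchwartzMap.fderivCLM ℝ Plane F f)
    have e : fderiv ℝ (conv κ f) = conv κ (SchwartzMap.fderivCLM ℝ Plane F f) :=
      funext fun x => (conv_hasFDerivAt hκ f x).fderiv
    refine ⟨?_, C, fun x => ?_⟩
    · push_cast
      rw [contDiff_succ_iff_fderiv]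
      exact ⟨fun x => (conv_hasFDerivAt hκ f x).differentiableAt, by simp, by rw [e]; exact h1⟩
    · rw [← norm_iteratedFDeriv_fderiv, e]; exact hC x

/-- This is what makes multiplication by a convolution an operator on Schwartz functions, and so
gives `nonlocalOp` its meaning. -/
lemma conv_temperate {κ : Plane → ℝ} (hκ : Adm κ) (f : Sch) : (conv κ f).HasTemperateGrowth :=
  ⟨contDiff_infty.2 fun n => (conv_contDiff_bound hκ n f).1, fun n => by
    obtain ⟨C, hC⟩ := (conv_contDiff_bound hκ n f).2; exact ⟨3, C, hC⟩⟩

lemma fderiv_conv {κ : Plane → ℝ} (hκ : Adm κ) (f : Sch) (x : Plane) (i : Fin 2) :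
    fderiv ℝ (conv κ f) x (unitVec i) = conv κ (pd i f) x := by
  rw [(conv_hasFDerivAt hκ f x).fderiv, conv, ContinuousLinearMap.integral_apply
    (conv_integrable hκ _ x)]
  simp only [conv, pd_apply]
  rfl

lemma conv_add_right {κ : Plane → ℝ} (hκ : Adm κ) (f g : Sch) (x : Plane) :
    conv κ (f + g) x = conv κ f x + conv κ g x := by
  rw [conv, conv, conv, ← integral_add (conv_integrable hκ f x) (conv_integrable hκ g x)]
  congr 1; ext y
  change κ y • (f (x - y) + g (x - y)) = _
  rw [smul_add]

lemma conv_smul_right (κ : Plane → ℝ) (c : ℝ) (f : Sch) (x : Plane) :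
    conv κ (c • f) x = c * conv κ f x := by
  rw [conv, conv, ← integral_const_mul]
  congr 1; ext y
  change κ y * (c * f (x - y)) = c * (κ y * f (x - y))
  ring

lemma conv_add_left {κ κ' : Plane → ℝ} (hκ : Adm κ) (hκ' : Adm κ') (f : Sch) (x : Plane) :
    conv (fun y => κ y + κ' y) f x = conv κ f x + conv κ' f x := by
  rw [conv, conv, conv, ← integral_add (conv_integrable hκ f x) (conv_integrable hκ' f x)]
  congr 1; ext y
  rw [add_smul]

/-! ### Localised convolution operators -/

/-- The operator `u ↦ g₁ · (κ ∗ (g₂ u))` on Schwartz functions. -/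
def nonlocalOp (κ : Plane → ℝ) (g₁ g₂ u : Sch) : Sch := mulS (conv κ (mulS g₂ u)) g₁

section Nonlocal

variable {κ : Plane → ℝ} (hκ : Adm κ) (g₁ g₂ u : Sch)

lemma mulS_sch_apply (g u : Sch) (x : Plane) : mulS g u x = g x * u x :=
  mulS_apply g.hasTemperateGrowth u x

include hκ

lemma nonlocalOp_apply (x : Plane) :
    nonlocalOp κ g₁ g₂ u x = g₁ x * conv κ (mulS g₂ u) x := by
  rw [nonlocalOp, mulS_apply (conv_temperate hκ _), mul_comm]

lemma nonlocalOp_add (v : Sch) :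
    nonlocalOp κ g₁ g₂ (u + v) = nonlocalOp κ g₁ g₂ u + nonlocalOp κ g₁ g₂ v := by
  ext x
  change _ = nonlocalOp κ g₁ g₂ u x + nonlocalOp κ g₁ g₂ v x
  rw [nonlocalOp_apply hκ, nonlocalOp_apply hκ, nonlocalOp_apply hκ, map_add, conv_add_right hκ]
  ring

lemma nonlocalOp_smul (c : ℝ) :
    nonlocalOp κ g₁ g₂ (c • u) = c • nonlocalOp κ g₁ g₂ u := by
  ext x
  change _ = c * nonlocalOp κ g₁ g₂ u x
  rw [nonlocalOp_apply hκ, nonlocalOp_apply hκ, map_smul, conv_smul_right]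
  ring

lemma pd_nonlocalOp' (i : Fin 2) : pd i (nonlocalOp κ g₁ g₂ u) =
    nonlocalOp κ (pd i g₁) g₂ u + mulS (conv κ (pd i (mulS g₂ u))) g₁ := by
  rw [nonlocalOp, pd_mulS (conv_temperate hκ _), add_comm]
  congr 2
  congr 1
  funext x
  exact fderiv_conv hκ _ x i

lemma pd_nonlocalOp (i : Fin 2) : pd i (nonlocalOp κ g₁ g₂ u) =
    nonlocalOp κ (pd i g₁) g₂ u + (nonlocalOp κ g₁ (pd i g₂) u + nonlocalOp κ g₁ g₂ (pd i u)) := by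
  rw [pd_nonlocalOp' hκ]
  congr 1
  ext x
  change _ = nonlocalOp κ g₁ (pd i g₂) u x + nonlocalOp κ g₁ g₂ (pd i u) x
  have e : pd i (mulS g₂ u) = mulS (pd i g₂) u + mulS g₂ (pd i u) := by
    rw [pd_mulS g₂.hasTemperateGrowth]
    congr 2
  rw [mulS_apply (conv_temperate hκ _), e, conv_add_right hκ, nonlocalOp_apply hκ,
    nonlocalOp_apply hκ]
  ring

lemma xm_nonlocalOp (i : Fin 2) :
    xm i (nonlocalOp κ g₁ g₂ u) = nonlocalOp κ (xm i g₁) g₂ u := by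
  ext x
  rw [xm_apply, nonlocalOp_apply hκ, nonlocalOp_apply hκ, xm_apply]
  ring

end Nonlocal

/-- `L²` bounds on `u ↦ g₁ · (κ ∗ (g₂ u))` for all Schwartz `g₁, g₂` extend to all weighted Sobolev
seminorms, uniformly over a family of kernels. -/
lemma sob_nonlocalOp_le_of_zero {ι : Type*} {κ : ι → Plane → ℝ} {M : ι → ℝ} (hκ : ∀ i, Adm (κ i))
    (hM : ∀ i, 0 ≤ M i)
    (h : ∀ g₁ g₂ : Sch, ∃ C, 0 ≤ C ∧ ∀ i u,
      sob 0 (nonlocalOp (κ i) g₁ g₂ u) ≤ C * M i * sob 0 u) (k : ℕ) (g₁ g₂ : Sch) :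
    ∃ C, 0 ≤ C ∧ ∀ i u, sob k (nonlocalOp (κ i) g₁ g₂ u) ≤ C * M i * sob k u := by
  induction k generalizing g₁ g₂ with
  | zero => exact h g₁ g₂
  | succ k ih =>
    obtain ⟨C, hC0, hC⟩ := ih g₁ g₂
    have hX : ∀ j : Fin 2, ∃ C, 0 ≤ C ∧ ∀ i u,
        sob k (xm j (nonlocalOp (κ i) g₁ g₂ u)) ≤ C * M i * sob (k + 1) u := by
      intro j
      obtain ⟨A, hA0, hA⟩ := ih (xm j g₁) g₂
      refine ⟨A, hA0, fun i u => ?_⟩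
      rw [xm_nonlocalOp (hκ i)]
      have := hM i
      exact (hA i u).trans (by gcongr; exact sob_le_succ k u)
    -- By the Leibniz rule the derivative falls on g₁, on g₂ or on u. The induction hypothesis
    -- covers every pair of Schwartz factors, so all three terms are of the same kind.
    have hP : ∀ j : Fin 2, ∃ C, 0 ≤ C ∧ ∀ i u,
        sob k (pd j (nonlocalOp (κ i) g₁ g₂ u)) ≤ C * M i * sob (k + 1) u := by
      intro j
      obtain ⟨A, hA0, hA⟩ := ih (pd j g₁) g₂
      obtain ⟨B, hB0, hB⟩ := ih g₁ (pd j g₂)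
      refine ⟨A + (B + C), by positivity, fun i u => ?_⟩
      have := hM i
      rw [pd_nonlocalOp (hκ i)]
      have h1 : A * M i * sob k u ≤ A * M i * sob (k + 1) u := by gcongr; exact sob_le_succ k u
      have h2 : B * M i * sob k u ≤ B * M i * sob (k + 1) u := by gcongr; exact sob_le_succ k u
      have h3 : C * M i * sob k (pd j u) ≤ C * M i * sob (k + 1) u := by
        gcongr; exact sob_pd_le k j u
      have h4 := hA i u; have h5 := hB i u; have h6 := hC i (pd j u)
      have h7 := map_add_le_add (sob k) (nonlocalOp (κ i) (pd j g₁) g₂ u)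
        (nonlocalOp (κ i) g₁ (pd j g₂) u + nonlocalOp (κ i) g₁ g₂ (pd j u))
      have h8 := map_add_le_add (sob k) (nonlocalOp (κ i) g₁ (pd j g₂) u)
        (nonlocalOp (κ i) g₁ g₂ (pd j u))
      linarith
    obtain ⟨X0, hX00, hX0⟩ := hX 0
    obtain ⟨X1, hX10, hX1⟩ := hX 1
    obtain ⟨P0, hP00, hP0⟩ := hP 0
    obtain ⟨P1, hP10, hP1⟩ := hP 1
    refine ⟨C + (P0 + X0 + (P1 + X1)), by positivity, fun i u => ?_⟩
    have := hM i
    have h1 : C * M i * sob k u ≤ C * M i * sob (k + 1) u := by gcongr; exact sob_le_succ k u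
    have := hC i u; have := hX0 i u; have := hX1 i u; have := hP0 i u; have := hP1 i u
    rw [sob_succ, Fin.sum_univ_two]
    linarith

lemma schwartz_le_wt_sq (f : Sch) : ∃ C, 0 ≤ C ∧ ∀ x, |f x| ≤ C * wt x ^ 2 := by
  refine ⟨2 ^ 6 * ((Finset.Iic (6, 0)).sup fun m => SchwartzMap.seminorm ℝ m.1 m.2) f,
    by positivity, fun x => ?_⟩
  have := SchwartzMap.one_add_le_sup_seminorm_apply (𝕜 := ℝ) (m := (6, 0)) (k := 6) (n := 0)
    le_rfl le_rfl f x
  rw [norm_iteratedFDeriv_zero, Real.norm_eq_abs] at this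
  rw [wt, inv_pow, ← pow_mul, ← div_eq_mul_inv, le_div_iff₀ (by positivity), mul_comm]
  exact this

lemma conv_mul_integrable_prod {κ : Plane → ℝ} (hκ : Adm κ) (f h : Sch) :
    Integrable (fun p : Plane × Plane => κ p.2 * f (p.1 - p.2) * h p.1)
      (volume.prod volume) := by
  obtain ⟨C, hC0, hC⟩ := schwartz_le_wt f
  obtain ⟨D, hD0, hD⟩ := schwartz_le_wt_sq h
  have h1 : Integrable (fun p : Plane × Plane => (C * D) * (wt p.1 * ‖κ p.2 * wt p.2‖))
      (volume.prod volume) := (wt_integrable.mul_prod hκ.norm).const_mul _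
  refine h1.mono' ?_ (Eventually.of_forall fun p => ?_)
  · refine AEStronglyMeasurable.mul (AEStronglyMeasurable.mul hκ.aesm.comp_snd ?_) ?_
    · exact Continuous.aestronglyMeasurable (by fun_prop)
    · exact Continuous.aestronglyMeasurable (by fun_prop)
  · have hw := wt_pos p.2
    have hx := wt_pos p.1
    have e : (1 + ‖p.1‖) ^ 3 * wt p.1 = 1 := by
      rw [wt, mul_inv_cancel₀ (by positivity)]
    rw [norm_mul, norm_mul, norm_mul, Real.norm_of_nonneg hw.le]
    calc ‖κ p.2‖ * ‖f (p.1 - p.2)‖ * ‖h p.1‖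
        ≤ ‖κ p.2‖ * (C * ((1 + ‖p.1‖) ^ 3 * wt p.2)) * (D * wt p.1 ^ 2) := by
          gcongr
          · exact (hC _).trans (by gcongr; exact wt_sub_le _ _)
          · exact hD _
      _ = ((1 + ‖p.1‖) ^ 3 * wt p.1) * (C * D * (wt p.1 * (‖κ p.2‖ * wt p.2))) := by ring
      _ = _ := by rw [e, one_mul]

lemma integral_conv_mul {κ : Plane → ℝ} (hκ : Adm κ) (f h : Sch) :
    ∫ x, conv κ f x * h x = ∫ y, κ y * ∫ x, f (x - y) * h x := by
  have := integral_integral_swap (f := fun x y => κ y * f (x - y) * h x)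
    (μ := volume) (ν := volume) (conv_mul_integrable_prod hκ f h)
  have e1 : ∀ x, conv κ f x * h x = ∫ y, κ y * f (x - y) * h x := fun x => by
    rw [conv, ← integral_mul_const]; rfl
  simp_rw [e1]
  rw [this]
  congr 1; ext y
  rw [← integral_const_mul]
  congr 1; ext x; ring

/-- The L² adjoint of convolution with κ is convolution with the reflected kernel: Fubini, followed
by a translation. -/
lemma integral_conv_mul_reflect {κ : Plane → ℝ} (hκ : Adm κ) (hκ' : Adm fun y => κ (-y))
    (f h : Sch) : ∫ x, conv κ f x * h x = ∫ x, f x * conv (fun y => κ (-y)) h x := by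
  have e : ∫ x, f x * conv (fun y => κ (-y)) h x = ∫ x, conv (fun y => κ (-y)) h x * f x := by
    simp_rw [mul_comm]
  rw [e, integral_conv_mul hκ, integral_conv_mul hκ',
    ← integral_neg_eq_self fun y => κ y * ∫ x, f (x - y) * h x]
  congr 1; ext y
  congr 1
  rw [← integral_sub_right_eq_self _ y]
  congr 1; ext x
  rw [mul_comm, sub_neg_eq_add, sub_add_cancel]

/-- Translation of a Schwartz function. -/
lemma sob_zero_translate (f : Sch) (y : Plane) :
    ∃ g : Sch, (∀ x, g x = f (x - y)) ∧ sob 0 g = sob 0 f := by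
  refine ⟨SchwartzMap.compSubConstCLM ℝ y f, fun x => rfl, ?_⟩
  rw [sob_zero_eq_sqrt, sob_zero_eq_sqrt]
  congr 1
  exact integral_sub_right_eq_self (fun x => f x ^ 2) y

lemma sob_zero_mulS_le {B : ℝ} (g u : Sch) (hB : ∀ x, |g x| ≤ B) :
    sob 0 (mulS g u) ≤ B * sob 0 u := by
  refine sob_zero_le_of_abs_le ((abs_nonneg _).trans (hB 0)) fun x => ?_
  rw [mulS_sch_apply, abs_mul]
  gcongr; exact hB x

lemma schwartz_bounded (g : Sch) : ∃ B, 0 ≤ B ∧ ∀ x, |g x| ≤ B := by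
  obtain ⟨C, hC0, hC⟩ := schwartz_le_wt g
  exact ⟨C, hC0, fun x => (hC x).trans (mul_le_of_le_one_right hC0 (wt_le_one x))⟩

/-- Young's inequality, localised by Schwartz factors. -/
lemma sob_zero_nonlocalOp_integrable (g₁ g₂ : Sch) : ∃ C, 0 ≤ C ∧ ∀ κ : Plane → ℝ, Integrable κ →
    ∀ u, sob 0 (nonlocalOp κ g₁ g₂ u) ≤ C * (∫ y, |κ y|) * sob 0 u := by
  obtain ⟨B₁, hB₁0, hB₁⟩ := schwartz_bounded g₁
  obtain ⟨B₂, hB₂0, hB₂⟩ := schwartz_bounded g₂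
  refine ⟨B₁ * B₂, by positivity, fun κ hκ u => ?_⟩
  have hA := Adm.of_integrable hκ
  set v := nonlocalOp κ g₁ g₂ u with hv
  set f := mulS g₂ u
  set h := mulS g₁ v
  have hN : 0 ≤ ∫ y, |κ y| := integral_nonneg fun y => abs_nonneg _
  -- Duality: v is paired with itself. For each y the translate of f pairs with h at cost ‖f‖ ‖h‖,
  -- the kernel is integrated last, and one factor ‖v‖ is then divided out.
  have e1 : sob 0 v ^ 2 = ∫ x, conv κ f x * h x := by
    rw [← ip_self, ip]
    congr 1; ext x
    conv_lhs => enter [1]; rw [hv, nonlocalOp_apply hA]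
    rw [mulS_sch_apply]; ring
  have e2 : |∫ x, conv κ f x * h x| ≤ ∫ y, |κ y| * (sob 0 f * sob 0 h) := by
    rw [integral_conv_mul hA, ← Real.norm_eq_abs]
    refine norm_integral_le_of_norm_le (hκ.abs.mul_const _) (Eventually.of_forall fun y => ?_)
    obtain ⟨g, hg, hg'⟩ := sob_zero_translate f y
    rw [norm_mul, Real.norm_eq_abs, Real.norm_eq_abs]
    gcongr
    rw [← hg']
    have := ip_le g h
    simp only [ip, hg] at this
    exact this
  rw [integral_mul_const] at e2
  have hf : sob 0 f ≤ B₂ * sob 0 u := sob_zero_mulS_le _ _ hB₂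
  have hh : sob 0 h ≤ B₁ * sob 0 v := sob_zero_mulS_le _ _ hB₁
  have hv0 : 0 ≤ sob 0 v := apply_nonneg _ _
  have h3 : sob 0 v * sob 0 v ≤ (B₁ * B₂ * (∫ y, |κ y|) * sob 0 u) * sob 0 v := by
    calc sob 0 v * sob 0 v = ∫ x, conv κ f x * h x := by rw [← e1]; ring
      _ ≤ (∫ y, |κ y|) * (sob 0 f * sob 0 h) := (le_abs_self _).trans e2
      _ ≤ (∫ y, |κ y|) * ((B₂ * sob 0 u) * (B₁ * sob 0 v)) := by gcongr
      _ = _ := by ring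
  rcases hv0.eq_or_lt with h0 | h0
  · rw [← h0]
    have : 0 ≤ sob 0 u := apply_nonneg _ _
    positivity
  · exact le_of_mul_le_mul_right h3 h0

lemma integral_abs_mul_le (f g : Sch) : ∫ x, |f x * g x| ≤ sob 0 f * sob 0 g := by
  have hf : ∀ f : Sch, MemLp (fun x => |f x|) (ENNReal.ofReal 2) volume := fun f => by
    have := (f.memLp 2 volume).abs
    rw [ENNReal.ofReal_ofNat]; exact this
  have := integral_mul_le_Lp_mul_Lq_of_nonneg (μ := volume) Real.HolderConjugate.two_two
    (Eventually.of_forall fun x => abs_nonneg (f x))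
    (Eventually.of_forall fun x => abs_nonneg (g x)) (hf f) (hf g)
  simp_rw [abs_mul]
  refine this.trans (le_of_eq ?_)
  rw [sob_zero_eq_sqrt, sob_zero_eq_sqrt, Real.sqrt_eq_rpow, Real.sqrt_eq_rpow]
  simp

/-- A bounded kernel gives the supremum bound B ‖g₂‖ ‖u‖ on the convolution; the decay of g₁
supplies the L² norm. -/
lemma sob_zero_nonlocalOp_bounded (g₁ g₂ : Sch) : ∃ C, 0 ≤ C ∧ ∀ (κ : Plane → ℝ) (B : ℝ),
    Continuous κ → (∀ y, |κ y| ≤ B) → ∀ u,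
      sob 0 (nonlocalOp κ g₁ g₂ u) ≤ C * B * sob 0 u := by
  refine ⟨sob 0 g₁ * sob 0 g₂, by positivity, fun κ B hc hB u => ?_⟩
  have hA := Adm.of_bounded hc hB
  have hB0 : 0 ≤ B := (abs_nonneg _).trans (hB 0)
  have key : sob 0 (nonlocalOp κ g₁ g₂ u) ≤ sob 0 ((B * (sob 0 g₂ * sob 0 u)) • g₁) := by
    rw [← one_mul (sob 0 (_ • g₁))]
    refine sob_zero_le_of_abs_le zero_le_one fun x => ?_
    have h1 : |conv κ (mulS g₂ u) x| ≤ B * (sob 0 g₂ * sob 0 u) := by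
      rw [conv, ← Real.norm_eq_abs]
      have hi : Integrable fun y => B * |g₂ (x - y) * u (x - y)| := by
        have := ((mulS g₂ u).integrable (μ := volume)).comp_sub_left x
        simp only [mulS_sch_apply] at this
        exact this.abs.const_mul B
      refine (norm_integral_le_of_norm_le hi (Eventually.of_forall fun y => ?_)).trans ?_
      · rw [norm_smul, mulS_sch_apply, Real.norm_eq_abs, Real.norm_eq_abs]
        gcongr
        exact hB y
      · rw [integral_const_mul, integral_sub_left_eq_self (fun y => |g₂ y * u y|) volume x]
        gcongr
        exact integral_abs_mul_le _ _
    rw [nonlocalOp_apply hA, abs_mul, one_mul]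
    change _ ≤ |_ * g₁ x|
    rw [abs_mul, mul_comm, abs_of_nonneg (by positivity : 0 ≤ B * (sob 0 g₂ * sob 0 u))]
    gcongr
  refine key.trans (le_of_eq ?_)
  rw [map_smul_eq_mul, Real.norm_of_nonneg (by positivity)]
  ring

lemma sob_nonlocalOp_integrable (k : ℕ) (g₁ g₂ : Sch) : ∃ C, 0 ≤ C ∧ ∀ κ : Plane → ℝ,
    Integrable κ → ∀ u, sob k (nonlocalOp κ g₁ g₂ u) ≤ C * (∫ y, |κ y|) * sob k u := by
  obtain ⟨C, hC0, hC⟩ := sob_nonlocalOp_le_of_zero (ι := {κ : Plane → ℝ // Integrable κ})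
    (κ := fun i => i.1) (M := fun i => ∫ y, |i.1 y|) (fun i => Adm.of_integrable i.2)
    (fun i => integral_nonneg fun y => abs_nonneg _) (fun g₁ g₂ => by
      obtain ⟨C, hC0, hC⟩ := sob_zero_nonlocalOp_integrable g₁ g₂
      exact ⟨C, hC0, fun i u => hC i.1 i.2 u⟩) k g₁ g₂
  exact ⟨C, hC0, fun κ hκ u => hC ⟨κ, hκ⟩ u⟩

lemma sob_nonlocalOp_bounded (k : ℕ) (g₁ g₂ : Sch) {κ : Plane → ℝ} {B : ℝ} (hc : Continuous κ)
    (hB : ∀ y, |κ y| ≤ B) : ∃ C, 0 ≤ C ∧ ∀ u, sob k (nonlocalOp κ g₁ g₂ u) ≤ C * sob k u := by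
  have hB0 : 0 ≤ B := (abs_nonneg _).trans (hB 0)
  obtain ⟨C, hC0, hC⟩ := sob_nonlocalOp_le_of_zero (ι := Unit)
    (κ := fun _ => κ) (M := fun _ => B) (fun i => Adm.of_bounded hc hB)
    (fun i => hB0) (fun g₁ g₂ => by
      obtain ⟨C, hC0, hC⟩ := sob_zero_nonlocalOp_bounded g₁ g₂
      exact ⟨C, hC0, fun i u => hC κ B hc hB u⟩) k g₁ g₂
  exact ⟨C * B, by positivity, fun u => hC () u⟩

lemma conv_pd_eq {κ : Plane → ℝ} (j : Fin 2) (hκ : Differentiable ℝ κ) {B : ℝ}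
    (hB : ∀ y, |κ y| ≤ B) (hc' : Continuous fun y => fderiv ℝ κ y (unitVec j))
    (hB' : ∀ y, |fderiv ℝ κ y (unitVec j)| ≤ B) (f : Sch) (x : Plane) :
    conv κ (pd j f) x = conv (fun y => fderiv ℝ κ y (unitVec j)) f x := by
  have hd : ∀ y, HasFDerivAt (fun y => f (x - y)) (-(fderiv ℝ f (x - y))) y := fun y => by
    have h1 : HasFDerivAt (fun y : Plane => x - y) (-ContinuousLinearMap.id ℝ Plane) y :=
      (hasFDerivAt_id y).const_sub x
    refine ((f.hasFDerivAt (x - y)).comp y h1).congr_fderiv ?_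
    ext z; simp
  have e : ∀ y, fderiv ℝ (fun y => f (x - y)) y (unitVec j) = -(pd j f (x - y)) := fun y => by
    rw [(hd y).fderiv, pd_apply]; rfl
  have i1 := conv_integrable (Adm.of_bounded hc' hB') f x
  have i2 := conv_integrable (Adm.of_bounded hκ.continuous hB) (pd j f) x
  have i3 := conv_integrable (Adm.of_bounded hκ.continuous hB) f x
  have := integral_mul_fderiv_eq_neg_fderiv_mul_of_integrable (μ := volume) (𝕜 := ℝ) (f := κ)
    (g := fun y => f (x - y)) (v := unitVec j) i1 (by
      simp_rw [e, mul_neg]; exact i2.neg) i3 (fun y _ => hκ y)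
    (fun y _ => (hd y).differentiableAt)
  simp_rw [e, mul_neg] at this
  rw [integral_neg, neg_inj] at this
  exact this

/-- A derivative of the convolution is moved onto the kernel by `conv_pd_eq`, and coordinates are
absorbed by g₁. No letter falls on u, so one order is gained. -/
lemma sob_succ_nonlocalOp_le (k : ℕ) (g₁ g₂ : Sch) {κ : Plane → ℝ} (hκ : Differentiable ℝ κ) {B : ℝ}
    (hB : ∀ y, |κ y| ≤ B) (hc' : ∀ j, Continuous fun y => fderiv ℝ κ y (unitVec j))
    (hB' : ∀ j y, |fderiv ℝ κ y (unitVec j)| ≤ B) :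
    ∃ C, 0 ≤ C ∧ ∀ u, sob (k + 1) (nonlocalOp κ g₁ g₂ u) ≤ C * sob k u := by
  have hA := Adm.of_bounded hκ.continuous hB
  obtain ⟨C, hC0, hC⟩ := sob_nonlocalOp_bounded k g₁ g₂ hκ.continuous hB
  have hX : ∀ j : Fin 2, ∃ C, 0 ≤ C ∧ ∀ u, sob k (xm j (nonlocalOp κ g₁ g₂ u)) ≤ C * sob k u := by
    intro j
    obtain ⟨D, hD0, hD⟩ := sob_nonlocalOp_bounded k (xm j g₁) g₂ hκ.continuous hB
    refine ⟨D, hD0, fun u => ?_⟩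
    rw [xm_nonlocalOp hA]; exact hD u
  have hP : ∀ j : Fin 2, ∃ C, 0 ≤ C ∧ ∀ u, sob k (pd j (nonlocalOp κ g₁ g₂ u)) ≤ C * sob k u := by
    intro j
    obtain ⟨D, hD0, hD⟩ := sob_nonlocalOp_bounded k (pd j g₁) g₂ hκ.continuous hB
    obtain ⟨E, hE0, hE⟩ := sob_nonlocalOp_bounded k g₁ g₂ (hc' j) (hB' j)
    refine ⟨D + E, by positivity, fun u => ?_⟩
    rw [pd_nonlocalOp' hA]
    have e : conv κ (pd j (mulS g₂ u)) = conv (fun y => fderiv ℝ κ y (unitVec j)) (mulS g₂ u) :=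
      funext fun x => conv_pd_eq j hκ hB (hc' j) (hB' j) _ x
    rw [e]
    refine (map_add_le_add (sob k) _ _).trans ?_
    rw [add_mul]
    exact add_le_add (hD u) (hE u)
  obtain ⟨X0, hX00, hX0⟩ := hX 0
  obtain ⟨X1, hX10, hX1⟩ := hX 1
  obtain ⟨P0, hP00, hP0⟩ := hP 0
  obtain ⟨P1, hP10, hP1⟩ := hP 1
  refine ⟨C + (P0 + X0 + (P1 + X1)), by positivity, fun u => ?_⟩
  rw [sob_succ, Fin.sum_univ_two]
  have := hC u; have := hX0 u; have := hX1 u; have := hP0 u; have := hP1 u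
  linarith

/-! ### The Biot-Savart kernel and its regularisation -/

/-- The components of `y^⊥ / (|y|² + δ²)`; for `δ = 0` this is the Biot-Savart kernel (up to
`1/2π`), and otherwise a smooth regularisation of it. -/
def bsK (δ : ℝ) (i : Fin 2) (y : Plane) : ℝ := perp y i / (‖y‖ ^ 2 + δ ^ 2)

lemma perp_zero (y : Plane) : perp y 0 = -y 1 := by simp [perp]

lemma perp_one (y : Plane) : perp y 1 = y 0 := by simp [perp]

lemma norm_perp (y : Plane) : ‖perp y‖ = ‖y‖ := by
  rw [← sq_eq_sq₀ (norm_nonneg _) (norm_nonneg _), norm_sq_plane, norm_sq_plane, perp_zero,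
    perp_one]
  ring

lemma perp_temperate (i : Fin 2) : (fun y : Plane => perp y i).HasTemperateGrowth := by
  fin_cases i
  · simp only [Fin.zero_eta, perp_zero]; exact (coord_temperate 1).neg
  · simp only [Fin.mk_one, perp_one]; exact coord_temperate 0

lemma perp_contDiff (i : Fin 2) : ContDiff ℝ 1 fun y : Plane => perp y i :=
  (perp_temperate i).1.of_le (by exact_mod_cast le_top)

lemma abs_perp_le (y : Plane) (i : Fin 2) : |perp y i| ≤ ‖y‖ :=
  (abs_coord_le (perp y) i).trans (norm_perp y).le

lemma bsK_neg (δ : ℝ) (i : Fin 2) (y : Plane) : bsK δ i (-y) = -bsK δ i y := by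
  rw [bsK, bsK, norm_neg, ← neg_div]
  congr 1
  fin_cases i <;> simp [perp]

lemma bsK_contDiff {δ : ℝ} (hδ : 0 < δ) (i : Fin 2) : ContDiff ℝ 1 (bsK δ i) := by
  unfold bsK
  refine (perp_contDiff i).div ?_ fun y => by positivity
  exact (contDiff_norm_sq ℝ).add contDiff_const

lemma abs_bsK_le {δ : ℝ} (hδ : 0 < δ) (i : Fin 2) (y : Plane) : |bsK δ i y| ≤ δ⁻¹ := by
  rw [bsK, abs_div, abs_of_pos (by positivity : 0 < ‖y‖ ^ 2 + δ ^ 2), div_le_iff₀ (by positivity)]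
  refine (abs_perp_le y i).trans ?_
  rw [inv_mul_eq_div, le_div_iff₀ hδ]
  nlinarith [sq_nonneg (‖y‖ - δ), sq_nonneg ‖y‖, sq_nonneg δ]

lemma fderiv_bsK {δ : ℝ} (hδ : 0 < δ) (i j : Fin 2) (y : Plane) :
    fderiv ℝ (bsK δ i) y (unitVec j) =
      perp (unitVec j) i / (‖y‖ ^ 2 + δ ^ 2) - 2 * perp y i * y j / (‖y‖ ^ 2 + δ ^ 2) ^ 2 := by
  have hp : HasFDerivAt (fun y : Plane => perp y i) (fderiv ℝ (fun y : Plane => perp y i) y) y :=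
    ((perp_contDiff i).differentiable (by norm_num) y).hasFDerivAt
  have hp' : fderiv ℝ (fun y : Plane => perp y i) y (unitVec j) = perp (unitVec j) i := by
    fin_cases i
    · simp only [Fin.zero_eta, perp_zero]
      rw [fderiv_fun_neg, neg_apply, fderiv_coord]
    · simp only [Fin.mk_one, perp_one]
      rw [fderiv_coord]
  have hn : HasFDerivAt (fun y : Plane => ‖y‖ ^ 2 + δ ^ 2) (2 • innerSL ℝ y) y :=
    (HasStrictFDerivAt.hasFDerivAt (hasStrictFDerivAt_norm_sq y)).add_const _
  have hne : ‖y‖ ^ 2 + δ ^ 2 ≠ 0 := by positivity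
  have hi := (hasDerivAt_inv hne).comp_hasFDerivAt y hn
  have := (hp.mul hi).fderiv
  have e : bsK δ i = (fun y : Plane => perp y i) * (Inv.inv ∘ fun y : Plane => ‖y‖ ^ 2 + δ ^ 2) := by
    funext y; simp [bsK, div_eq_mul_inv]
  rw [e, this]
  simp only [smul_apply, add_apply, hp', innerSL_apply_apply, inner_unitVec,
    smul_eq_mul, nsmul_eq_mul, Function.comp_apply]
  field_simp
  norm_num
  ring

lemma abs_fderiv_bsK_le {δ : ℝ} (hδ : 0 < δ) (i j : Fin 2) (y : Plane) :
    |fderiv ℝ (bsK δ i) y (unitVec j)| ≤ 3 / δ ^ 2 := by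
  have hd : 0 < ‖y‖ ^ 2 + δ ^ 2 := by positivity
  rw [fderiv_bsK hδ]
  refine (abs_sub _ _).trans ?_
  rw [abs_div, abs_div, abs_of_pos hd, abs_of_pos (pow_pos hd 2)]
  have h1 : |perp (unitVec j) i| / (‖y‖ ^ 2 + δ ^ 2) ≤ 1 / δ ^ 2 := by
    have := abs_perp_le (unitVec j) i
    rw [norm_unitVec] at this
    gcongr
    nlinarith [sq_nonneg ‖y‖]
  have h2 : |2 * perp y i * y j| / (‖y‖ ^ 2 + δ ^ 2) ^ 2 ≤ 2 / δ ^ 2 := by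
    rw [abs_mul, abs_mul, abs_two, div_le_div_iff₀ (by positivity) (by positivity)]
    have h3 : |perp y i| * |y j| ≤ ‖y‖ * ‖y‖ :=
      mul_le_mul (abs_perp_le y i) (abs_coord_le y j) (abs_nonneg _) (norm_nonneg _)
    have : |perp y i| * |y j| * δ ^ 2 ≤ (‖y‖ ^ 2 + δ ^ 2) ^ 2 := by
      calc |perp y i| * |y j| * δ ^ 2 ≤ ‖y‖ * ‖y‖ * δ ^ 2 := by gcongr
        _ ≤ _ := by nlinarith [sq_nonneg (‖y‖ ^ 2), sq_nonneg (δ ^ 2), sq_nonneg (‖y‖ * δ)]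
    linarith
  calc _ ≤ 1 / δ ^ 2 + 2 / δ ^ 2 := add_le_add h1 h2
    _ = _ := by ring

/-- The singular part of the Biot-Savart kernel. -/
def bsN (δ : ℝ) (i : Fin 2) (y : Plane) : ℝ := bsK 0 i y - bsK δ i y

lemma bsK_measurable (δ : ℝ) (i : Fin 2) : Measurable (bsK δ i) :=
  (perp_contDiff i).continuous.measurable.div (by fun_prop)

lemma abs_bsN_le (i : Fin 2) (y : Plane) : |bsN 1 i y| ≤ ‖y‖⁻¹ * (1 + ‖y‖ ^ 2)⁻¹ := by
  rcases eq_or_ne y 0 with rfl | hy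
  · have : perp (0 : Plane) i = 0 := by
      have := abs_perp_le (0 : Plane) i
      simpa using this
    simp [bsN, bsK, this]
  have hn : 0 < ‖y‖ := norm_pos_iff.2 hy
  have e : bsN 1 i y = perp y i / ‖y‖ * (‖y‖⁻¹ * (1 + ‖y‖ ^ 2)⁻¹) := by
    rw [bsN, bsK, bsK]; field_simp; ring
  rw [e, abs_mul, abs_of_pos (by positivity : 0 < ‖y‖⁻¹ * (1 + ‖y‖ ^ 2)⁻¹)]
  refine mul_le_of_le_one_left (by positivity) ?_
  rw [abs_div, abs_of_pos hn]
  exact div_le_one_of_le₀ (abs_perp_le y i) hn.le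

lemma bsN_one_integrable (i : Fin 2) : Integrable (bsN 1 i) := by
  have h : Integrable fun y : Plane => ‖y‖⁻¹ * (1 + ‖y‖ ^ 2)⁻¹ := by
    rw [integrable_fun_norm_addHaar volume (f := fun r : ℝ => r⁻¹ * (1 + r ^ 2)⁻¹)]
    have h1 : IntegrableOn (fun r : ℝ => (1 + r ^ 2)⁻¹) (Set.Ioi 0) :=
      integrable_inv_one_add_sq.integrableOn
    refine h1.congr_fun (fun r hr => ?_) measurableSet_Ioi
    have : r ≠ 0 := (Set.mem_Ioi.1 hr).ne'
    simp only [finrank_euclideanSpace, Fintype.card_fin]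
    have : 1 + r ^ 2 ≠ 0 := by positivity
    simp only [Nat.add_one_sub_one, pow_one, smul_eq_mul]
    field_simp
  exact h.mono' ((bsK_measurable 0 i).sub (bsK_measurable 1 i)).aestronglyMeasurable
    (Eventually.of_forall fun y => abs_bsN_le i y)

lemma bsN_scale {δ : ℝ} (hδ : 0 < δ) (i : Fin 2) (y : Plane) :
    bsN δ i y = δ⁻¹ * bsN 1 i (δ⁻¹ • y) := by
  have hp : perp (δ⁻¹ • y) i = δ⁻¹ * perp y i := by
    fin_cases i <;> simp [perp]
  have hn : ‖δ⁻¹ • y‖ ^ 2 = (δ ^ 2)⁻¹ * ‖y‖ ^ 2 := by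
    rw [norm_smul, mul_pow, Real.norm_of_nonneg (by positivity), inv_pow]
  rw [bsN, bsN, bsK, bsK, bsK, bsK, hp, hn]
  have e1 : (δ ^ 2)⁻¹ * ‖y‖ ^ 2 + 1 ^ 2 = (δ ^ 2)⁻¹ * (‖y‖ ^ 2 + δ ^ 2) := by field_simp
  have e0 : (δ ^ 2)⁻¹ * ‖y‖ ^ 2 + 0 ^ 2 = (δ ^ 2)⁻¹ * (‖y‖ ^ 2 + 0 ^ 2) := by ring
  rw [e1, e0, mul_div_mul_comm, mul_div_mul_comm]
  field_simp

lemma bsN_integrable {δ : ℝ} (hδ : 0 < δ) (i : Fin 2) : Integrable (bsN δ i) := by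
  have h := ((bsN_one_integrable i).comp_smul (inv_ne_zero hδ.ne')).const_mul δ⁻¹
  exact h.congr (Eventually.of_forall fun y => (bsN_scale hδ i y).symm)

/-- Homogeneity of degree -1 against the area factor δ²: the singular part of the kernel becomes
small in L¹ as δ tends to 0. -/
lemma integral_abs_bsN {δ : ℝ} (hδ : 0 < δ) (i : Fin 2) :
    ∫ y, |bsN δ i y| = δ * ∫ y, |bsN 1 i y| := by
  simp_rw [bsN_scale hδ i, abs_mul, abs_of_pos (inv_pos.2 hδ)]
  rw [integral_const_mul, Measure.integral_comp_inv_smul volume (fun y : Plane => |bsN 1 i y|) δ]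
  rw [finrank_euclideanSpace, Fintype.card_fin, smul_eq_mul, abs_of_pos (by positivity)]
  field_simp

lemma bsK_eq_add (δ : ℝ) (i : Fin 2) : bsK 0 i = fun y => bsN δ i y + bsK δ i y := by
  funext y; rw [bsN]; ring

lemma bsK_pos_adm {δ : ℝ} (hδ : 0 < δ) (i : Fin 2) : Adm (bsK δ i) :=
  Adm.of_bounded (bsK_contDiff hδ i).continuous (abs_bsK_le hδ i)

lemma bsK_adm (i : Fin 2) : Adm (bsK 0 i) := by
  rw [bsK_eq_add 1 i]
  exact (Adm.of_integrable (bsN_integrable one_pos i)).add (bsK_pos_adm one_pos i)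

lemma nonlocalOp_split {δ : ℝ} (hδ : 0 < δ) (i : Fin 2) (g₁ g₂ u : Sch) :
    nonlocalOp (bsK 0 i) g₁ g₂ u = nonlocalOp (bsN δ i) g₁ g₂ u + nonlocalOp (bsK δ i) g₁ g₂ u := by
  have hN := Adm.of_integrable (bsN_integrable hδ i)
  have hK := bsK_pos_adm hδ i
  ext x
  change _ = nonlocalOp (bsN δ i) g₁ g₂ u x + nonlocalOp (bsK δ i) g₁ g₂ u x
  rw [nonlocalOp_apply (bsK_adm i), nonlocalOp_apply hN, nonlocalOp_apply hK, bsK_eq_add δ i,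
    conv_add_left hN hK, mul_add]

lemma sob_nonlocalOp_bsK_le (k : ℕ) (i : Fin 2) (g₁ g₂ : Sch) :
    ∃ C, 0 ≤ C ∧ ∀ u, sob k (nonlocalOp (bsK 0 i) g₁ g₂ u) ≤ C * sob k u := by
  obtain ⟨C, hC0, hC⟩ := sob_nonlocalOp_integrable k g₁ g₂
  obtain ⟨D, hD0, hD⟩ := sob_nonlocalOp_bounded k g₁ g₂ (bsK_contDiff one_pos i).continuous
    (abs_bsK_le one_pos i)
  have hN : 0 ≤ ∫ y, |bsN 1 i y| := integral_nonneg fun y => abs_nonneg _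
  refine ⟨C * (∫ y, |bsN 1 i y|) + D, by positivity, fun u => ?_⟩
  rw [nonlocalOp_split one_pos, add_mul]
  exact (map_add_le_add (sob k) _ _).trans
    (add_le_add (hC _ (bsN_integrable one_pos i) u) (hD u))

/-- The Biot-Savart operator, localised by Schwartz factors, gains a derivative up to an
arbitrarily small error. -/
lemma sob_succ_nonlocalOp_bsK_le (k : ℕ) (i : Fin 2) (g₁ g₂ : Sch) {η : ℝ} (hη : 0 < η) :
    ∃ B, 0 ≤ B ∧ ∀ u, sob (k + 1) (nonlocalOp (bsK 0 i) g₁ g₂ u) ≤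
      η * sob (k + 1) u + B * sob k u := by
  obtain ⟨C, hC0, hC⟩ := sob_nonlocalOp_integrable (k + 1) g₁ g₂
  have hN : 0 ≤ ∫ y, |bsN 1 i y| := integral_nonneg fun y => abs_nonneg _
  set A := C * ∫ y, |bsN 1 i y| with hA
  have hA0 : 0 ≤ A := by positivity
  -- The scale δ is chosen so that the singular part has operator norm at most η on `sob (k + 1)`.
  -- The smooth part gains a derivative, with a constant that depends on δ and hence on η.
  obtain ⟨δ, hδ, hδη⟩ : ∃ δ, 0 < δ ∧ A * δ ≤ η := by
    refine ⟨η / (A + 1), by positivity, ?_⟩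
    rw [mul_div_assoc', div_le_iff₀ (by positivity)]
    nlinarith
  have hB1 := fun y => (abs_bsK_le hδ i y).trans (le_add_of_nonneg_right
    (by positivity : 0 ≤ 3 / δ ^ 2))
  have hB2 := fun j y => (abs_fderiv_bsK_le hδ i j y).trans (le_add_of_nonneg_left
    (by positivity : 0 ≤ δ⁻¹))
  obtain ⟨B, hB0, hB⟩ := sob_succ_nonlocalOp_le k g₁ g₂
    ((bsK_contDiff hδ i).differentiable (by norm_num)) hB1
    (fun j => ((bsK_contDiff hδ i).continuous_fderiv (by norm_num)).clm_apply continuous_const) hB2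
  refine ⟨B, hB0, fun u => ?_⟩
  rw [nonlocalOp_split hδ]
  refine (map_add_le_add (sob (k + 1)) _ _).trans (add_le_add ?_ (hB u))
  refine (hC _ (bsN_integrable hδ i) u).trans ?_
  have : 0 ≤ sob (k + 1) u := apply_nonneg _ _
  rw [integral_abs_bsN hδ]
  gcongr
  calc C * (δ * ∫ y, |bsN 1 i y|) = A * δ := by rw [hA]; ring
    _ ≤ η := hδη

/-! ### The conjugated vorticity operator and its skewness -/

/-- The angular derivative `∂_θ = x₀ ∂₁ - x₁ ∂₀`. -/
def dth : Sch →L[ℝ] Sch := xm 0 ∘L pd 1 - xm 1 ∘L pd 0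

lemma dth_eq (f : Sch) : dth f = xm 0 (pd 1 f) - xm 1 (pd 0 f) := rfl

lemma ip_sub_left (f g h : Sch) : ip (f - g) h = ip f h - ip g h := by
  rw [ip_comm, ip_sub_right, ip_comm h f, ip_comm h g]

lemma ip_dth (f g : Sch) : ip f (dth g) = -ip (dth f) g := by
  have h : ∀ i j : Fin 2, i ≠ j → ip f (xm i (pd j g)) = -ip (xm i (pd j f)) g := by
    intro i j hij
    rw [ip_xm, ip_pd, pd_xm]
    simp [hij.symm]
  rw [dth_eq, dth_eq, ip_sub_right, ip_sub_left, h 0 1 (by simp), h 1 0 (by simp)]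
  ring

lemma dth_apply (f : Sch) (x : Plane) : dth f x = fderiv ℝ f x (perp x) := by
  have e : perp x = x 0 • unitVec 1 - x 1 • unitVec 0 := by
    ext i; fin_cases i <;> simp [perp, unitVec]
  rw [e, map_sub, map_smul, map_smul, ← pd_apply, ← pd_apply]
  change xm 0 (pd 1 f) x - xm 1 (pd 0 f) x = _
  rw [xm_apply, xm_apply]; rfl

lemma inner_perp_self (x : Plane) : inner ℝ x (perp x) = 0 := by
  rw [EuclideanSpace.inner_eq_star_dotProduct]
  simp [perp, dotProduct, Fin.sum_univ_two]
  ring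

lemma fderiv_prof_perp (x : Plane) : fderiv ℝ prof x (perp x) = 0 := by
  have h1 : HasFDerivAt (fun x : Plane => ‖x‖ ^ 2 / 4) ((4 : ℝ)⁻¹ • (2 • innerSL ℝ x)) x := by
    have := ((hasStrictFDerivAt_norm_sq x).hasFDerivAt).const_smul (4 : ℝ)⁻¹
    refine this.congr_of_eventuallyEq (Eventually.of_forall fun y => ?_)
    simp [div_eq_inv_mul]
  have := ((expMoment_hasDerivAt 0 (‖x‖ ^ 2 / 4)).comp_hasFDerivAt x h1).fderiv
  change fderiv ℝ prof x = _ at this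
  rw [this]
  simp [inner_perp_self]

lemma dth_mulS_prof (f : Sch) : dth (mulS prof f) = mulS prof (dth f) := by
  have e : ∀ x, mulS prof f x = prof x * f x := mulS_apply bddSmooth_prof.temperate f
  ext x
  have hp : DifferentiableAt ℝ prof x := (bddSmooth_prof.1.differentiable (by simp)) x
  have : (mulS prof f : Plane → ℝ) = fun x => prof x * f x := funext e
  rw [dth_apply, this, mulS_apply bddSmooth_prof.temperate, dth_apply,
    fderiv_fun_mul hp f.differentiableAt]
  simp [fderiv_prof_perp]

/-- The angular derivative is skew and commutes with multiplication by the radial profile. -/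
lemma ip_mulS_prof_dth (u : Sch) : ip (mulS prof (dth u)) u = 0 := by
  have h : ip (mulS prof (dth u)) u = -ip (mulS prof (dth u)) u := by
    conv_lhs => rw [← dth_mulS_prof, ip_comm, ip_dth, ip_comm, ← ip_mulS bddSmooth_prof.temperate]
    rw [ip_comm]
  linarith

/-- `u ↦ γ x · (K ∗ (γ u))`, where `γ` is the Gaussian weight and `K(y) = y^⊥ / |y|²`. -/
def nlA : Sch →ₗ[ℝ] Sch where
  toFun u := nonlocalOp (bsK 0 0) (xm 0 gam) gam u + nonlocalOp (bsK 0 1) (xm 1 gam) gam u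
  map_add' u v := by
    rw [nonlocalOp_add (bsK_adm 0), nonlocalOp_add (bsK_adm 1)]; abel
  map_smul' c u := by
    rw [nonlocalOp_smul (bsK_adm 0), nonlocalOp_smul (bsK_adm 1), smul_add]; rfl

lemma nlA_eq (u : Sch) : nlA u =
    nonlocalOp (bsK 0 0) (xm 0 gam) gam u + nonlocalOp (bsK 0 1) (xm 1 gam) gam u := rfl

/-- `x · (K ∗ ω)`, with `K(y) = y^⊥ / |y|²`. -/
def bsDot (ω : Plane → ℝ) (x : Plane) : ℝ :=
  x 0 * conv (bsK 0 0) ω x + x 1 * conv (bsK 0 1) ω x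

lemma nlA_apply (u : Sch) (x : Plane) : nlA u x = gam x * bsDot (mulS gam u) x := by
  rw [nlA_eq]
  change nonlocalOp (bsK 0 0) (xm 0 gam) gam u x + nonlocalOp (bsK 0 1) (xm 1 gam) gam u x = _
  rw [nonlocalOp_apply (bsK_adm 0), nonlocalOp_apply (bsK_adm 1), xm_apply, xm_apply, bsDot]
  ring

/-- Because y · y^⊥ = 0, the factor x may be replaced by x - y, the argument of ω. -/
lemma bsDot_eq (ω : Sch) (x : Plane) :
    bsDot ω x = conv (bsK 0 0) (xm 0 ω) x + conv (bsK 0 1) (xm 1 ω) x := by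
  have h := fun i => conv_integrable (bsK_adm i) ω x
  rw [bsDot, conv, conv, conv, conv, ← integral_const_mul, ← integral_const_mul,
    ← integral_add ((h 0).const_mul _) ((h 1).const_mul _),
    ← integral_add (conv_integrable (bsK_adm 0) (xm 0 ω) x)
      (conv_integrable (bsK_adm 1) (xm 1 ω) x)]
  congr 1; ext y
  simp only [xm_apply, smul_eq_mul, bsK, perp_zero, perp_one, PiLp.sub_apply]
  ring

/-- With ω = γu the pairing is ∫ (K ∗ ω) · xω. Oddness of K turns it into -∫ ω K ∗ (xω), while
`bsDot_eq` identifies the same pairing with +∫ ω K ∗ (xω). -/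
lemma ip_nlA (u : Sch) : ip (nlA u) u = 0 := by
  set ω := mulS gam u
  have hr : ∀ i, ∫ x, conv (bsK 0 i) ω x * xm i ω x = -∫ x, ω x * conv (bsK 0 i) (xm i ω) x := by
    intro i
    have hn : (fun y => bsK 0 i (-y)) = fun y => -bsK 0 i y := funext (bsK_neg 0 i)
    have ha : Adm fun y => bsK 0 i (-y) := by
      rw [hn]
      refine (bsK_adm i).neg.congr (Eventually.of_forall fun y => ?_)
      simp
    rw [integral_conv_mul_reflect (bsK_adm i) ha, ← integral_neg]
    congr 1; ext x
    rw [hn]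
    simp [conv, integral_neg]
  have hi : ∀ (i : Fin 2) (f h : Sch), Integrable fun x => conv (bsK 0 i) f x * h x := fun i f h => by
    have := (mulS (conv (bsK 0 i) f) h).integrable (μ := volume)
    exact this.congr (Eventually.of_forall fun x => mulS_apply (conv_temperate (bsK_adm i) f) h x)
  have e1 : ip (nlA u) u =
      (∫ x, conv (bsK 0 0) ω x * xm 0 ω x) + ∫ x, conv (bsK 0 1) ω x * xm 1 ω x := by
    rw [← integral_add (hi _ _ _) (hi _ _ _), ip]
    congr 1; ext x
    rw [nlA_apply, bsDot, xm_apply, xm_apply]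
    change gam x * (_ * conv _ ω x + _ * conv _ ω x) * u x = _
    have : ω x = gam x * u x := mulS_sch_apply _ _ _
    rw [this]; ring
  have e2 : ip (nlA u) u =
      (∫ x, ω x * conv (bsK 0 0) (xm 0 ω) x) + ∫ x, ω x * conv (bsK 0 1) (xm 1 ω) x := by
    simp_rw [mul_comm (ω _)]
    rw [← integral_add (hi _ _ _) (hi _ _ _), ip]
    congr 1; ext x
    rw [nlA_apply, bsDot_eq]
    have : ω x = gam x * u x := mulS_sch_apply _ _ _
    rw [this]; ring
  rw [hr, hr] at e1
  linarith

/-- The operator `Λ` conjugated by the Gaussian weight: `Λ (γ u) = γ A u`. -/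
def vorA : Sch →ₗ[ℝ] Sch :=
  (1 / (8 * Real.pi)) • ((mulS prof ∘L dth : Sch →L[ℝ] Sch) : Sch →ₗ[ℝ] Sch) -
    (1 / (16 * Real.pi ^ 2)) • nlA

lemma vorA_eq (u : Sch) : vorA u =
    (1 / (8 * Real.pi)) • mulS prof (dth u) - (1 / (16 * Real.pi ^ 2)) • nlA u := rfl

lemma ip_vorA (u : Sch) : ip (vorA u) u = 0 := by
  rw [vorA_eq, ip_sub_left, ip_smul_left, ip_smul_left, ip_mulS_prof_dth, ip_nlA]
  simp

lemma sob_nlA_le (k : ℕ) : ∃ C, 0 ≤ C ∧ ∀ u, sob k (nlA u) ≤ C * sob k u := by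
  obtain ⟨C, hC0, hC⟩ := sob_nonlocalOp_bsK_le k 0 (xm 0 gam) gam
  obtain ⟨D, hD0, hD⟩ := sob_nonlocalOp_bsK_le k 1 (xm 1 gam) gam
  refine ⟨C + D, by positivity, fun u => ?_⟩
  rw [nlA_eq, add_mul]
  exact (map_add_le_add (sob k) _ _).trans (add_le_add (hC u) (hD u))

/-- Exhibits the transport term as a first-order operator with bounded smooth coefficients x_i
`prof`, so that it costs one order and no extra weight. -/
lemma mulS_prof_dth (u : Sch) : mulS prof (dth u) =
    mulS (fun x => x 0 * prof x) (pd 1 u) - mulS (fun x => x 1 * prof x) (pd 0 u) := by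
  ext x
  change _ = mulS (fun x => x 0 * prof x) (pd 1 u) x - mulS (fun x => x 1 * prof x) (pd 0 u) x
  rw [mulS_apply bddSmooth_prof.temperate, mulS_apply (bddSmooth_coord_mul_prof 0).temperate,
    mulS_apply (bddSmooth_coord_mul_prof 1).temperate]
  change prof x * (xm 0 (pd 1 u) x - xm 1 (pd 0 u) x) = _
  rw [xm_apply, xm_apply]; ring

lemma sob_vorA_le (k : ℕ) : ∃ C, 0 ≤ C ∧ ∀ u, sob k (vorA u) ≤ C * sob (k + 1) u := by
  obtain ⟨C, hC0, hC⟩ := sob_mulS_le k (bddSmooth_coord_mul_prof 0)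
  obtain ⟨D, hD0, hD⟩ := sob_mulS_le k (bddSmooth_coord_mul_prof 1)
  obtain ⟨E, hE0, hE⟩ := sob_nlA_le k
  refine ⟨1 / (8 * Real.pi) * (C + D) + 1 / (16 * Real.pi ^ 2) * E, by positivity, fun u => ?_⟩
  rw [vorA_eq]
  have h1 : sob k (mulS prof (dth u)) ≤ (C + D) * sob (k + 1) u := by
    rw [mulS_prof_dth, add_mul]
    refine (map_sub_le_add (sob k) _ _).trans (add_le_add ?_ ?_)
    · exact (hC _).trans (by gcongr; exact sob_pd_le k 1 u)
    · exact (hD _).trans (by gcongr; exact sob_pd_le k 0 u)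
  have h2 : sob k (nlA u) ≤ E * sob (k + 1) u := (hE u).trans (by gcongr; exact sob_le_succ k u)
  refine (map_sub_le_add (sob k) _ _).trans ?_
  rw [map_smul_eq_mul, map_smul_eq_mul, Real.norm_of_nonneg (by positivity),
    Real.norm_of_nonneg (by positivity), add_mul, mul_assoc, mul_assoc]
  gcongr

/-! ### The resolvent equation in the Schwartz space -/

lemma mul_ip_oscH_eq (ε s : ℝ) (u : Sch) :
    ε * ip (oscH u) u = ip (ε • oscH u + s • vorA u) u := by
  rw [ip_add_left, ip_smul_left, ip_smul_left, ip_vorA, mul_zero, add_zero]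

/-- The resolvent estimate in `L²`. -/
lemma sob_zero_le_of_skew {ε : ℝ} (hε : ε ≠ 0) (u : Sch) :
    sob 0 u ≤ 2 / |ε| * sob 0 (ε • oscH u + vorA u) := by
  have h1 := mul_ip_oscH_eq ε 1 u
  rw [one_smul] at h1
  have h2 := half_sob_zero_sq_le u
  have h3 := ip_le (ε • oscH u + vorA u) u
  rw [← h1, abs_mul] at h3
  have hε' : 0 < |ε| := abs_pos.2 hε
  have h0 : 0 ≤ sob 0 u := apply_nonneg _ _
  rcases h0.eq_or_lt with h | h
  · rw [← h]; positivity
  · have h4 : |ε| * (1 / 2 * sob 0 u ^ 2) ≤ sob 0 (ε • oscH u + vorA u) * sob 0 u :=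
      (mul_le_mul_of_nonneg_left (h2.trans (le_abs_self _)) hε'.le).trans h3
    rw [div_mul_eq_mul_div, le_div_iff₀ hε']
    nlinarith

/-- The L² pairing does not see s, which gives the first-order bound. Then εHu = f - sAu, where A
costs one order and H gains two, so each level yields the next with constants uniform in s. -/
lemma sob_succ_le_of_skew {ε : ℝ} (hε : ε ≠ 0) (k : ℕ) : ∃ C, 0 ≤ C ∧
    ∀ s ∈ Set.Icc (0 : ℝ) 1, ∀ u, sob (k + 1) u ≤ C * sob k (ε • oscH u + s • vorA u) ∧
      sob (k + 2) u ≤ C * sob k (ε • oscH u + s • vorA u) := by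
  have hε' : 0 < |ε| := abs_pos.2 hε
  have step : ∀ k, (∃ C, 0 ≤ C ∧ ∀ s ∈ Set.Icc (0 : ℝ) 1, ∀ u,
      sob (k + 1) u ≤ C * sob k (ε • oscH u + s • vorA u)) → ∃ C, 0 ≤ C ∧
      ∀ s ∈ Set.Icc (0 : ℝ) 1, ∀ u, sob (k + 2) u ≤ C * sob k (ε • oscH u + s • vorA u) := by
    rintro k ⟨C, hC0, hC⟩
    obtain ⟨D, hD0, hD⟩ := sob_add_two_le k
    obtain ⟨E, hE0, hE⟩ := sob_vorA_le k
    refine ⟨D * (|ε|⁻¹ * (1 + E * C)), by positivity, fun s hs u => (hD u).trans ?_⟩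
    rw [mul_assoc]
    gcongr
    rw [mul_assoc, inv_mul_eq_div, le_div_iff₀ hε', mul_comm, ← Real.norm_eq_abs,
      ← map_smul_eq_mul (sob k)]
    have e : ε • oscH u = (ε • oscH u + s • vorA u) - s • vorA u := by abel
    conv_lhs => rw [e]
    refine (map_sub_le_add (sob k) _ _).trans ?_
    rw [add_mul, one_mul]
    gcongr
    rw [map_smul_eq_mul, Real.norm_of_nonneg hs.1]
    calc s * sob k (vorA u) ≤ 1 * (E * sob (k + 1) u) := by
          gcongr
          · exact hs.2
          · exact hE u
      _ ≤ 1 * (E * (C * sob k (ε • oscH u + s • vorA u))) := by gcongr; exact hC s hs u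
      _ = _ := by ring
  have base : ∀ k, ∃ C, 0 ≤ C ∧ ∀ s ∈ Set.Icc (0 : ℝ) 1, ∀ u,
      sob (k + 1) u ≤ C * sob k (ε • oscH u + s • vorA u) := by
    intro k
    induction k with
    | zero =>
      refine ⟨80 / |ε|, by positivity, fun s hs u => ?_⟩
      have h1 := mul_ip_oscH_eq ε s u
      have h2 := sob_one_sq_le u
      have h3 := ip_le (ε • oscH u + s • vorA u) u
      rw [← h1, abs_mul] at h3
      have h01 := sob_le_succ 0 u
      have h0 : 0 ≤ sob 1 u := apply_nonneg _ _
      have hn : 0 ≤ sob 0 (ε • oscH u + s • vorA u) := apply_nonneg _ _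
      rcases h0.eq_or_lt with h | h
      · rw [← h]; positivity
      · have h4 : |ε| * sob 1 u ^ 2 ≤ 80 * (sob 0 (ε • oscH u + s • vorA u) * sob 1 u) := by
          calc |ε| * sob 1 u ^ 2 ≤ |ε| * (80 * |ip (oscH u) u|) := by
                gcongr; exact h2.trans (by gcongr; exact le_abs_self _)
            _ = 80 * (|ε| * |ip (oscH u) u|) := by ring
            _ ≤ 80 * (sob 0 (ε • oscH u + s • vorA u) * sob 0 u) := by gcongr
            _ ≤ _ := by gcongr
        rw [div_mul_eq_mul_div, le_div_iff₀ hε']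
        nlinarith
    | succ k ih =>
      obtain ⟨C, hC0, hC⟩ := step k ih
      exact ⟨C, hC0, fun s hs u => (hC s hs u).trans (by gcongr; exact sob_le_succ k _)⟩
  obtain ⟨C, hC0, hC⟩ := base k
  obtain ⟨D, hD0, hD⟩ := step k ⟨C, hC0, hC⟩
  refine ⟨max C D, by positivity, fun s hs u => ⟨(hC s hs u).trans ?_, (hD s hs u).trans ?_⟩⟩
  · gcongr; exact le_max_left _ _
  · gcongr; exact le_max_right _ _

/-- Solvability of `ε H u + A u = f` in the Schwartz space. -/
theorem exists_oscH_add_vorA_eq {ε : ℝ} (hε : ε ≠ 0) (f : Sch) : ∃ u, ε • oscH u + vorA u = f := by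
  -- The path starts at εH, whose range is dense, and ends at εH + A. The seminorms on the source
  -- are shifted by two, the order of H.
  refine surjective_of_continuity (ε • (oscH : Sch →ₗ[ℝ] Sch)) vorA (fun k => sob (k + 2)) sob
    ?_ ?_ ?_ ?_ sob_mono ?_ (fun f hf => sob_zero_eq_zero hf) f
  · intro k f δ hδ
    obtain ⟨u, hu⟩ := oscH_dense_range k f hδ
    refine ⟨ε⁻¹ • u, ?_⟩
    simpa [smul_smul, inv_mul_cancel₀ hε] using hu
  · intro k
    obtain ⟨C, hC0, hC⟩ := sob_succ_le_of_skew hε k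
    exact ⟨C, fun s hs u => (hC s hs u).2⟩
  · intro k
    refine ⟨|ε| * 4, fun u => ?_⟩
    change sob k (ε • oscH u) ≤ _
    rw [map_smul_eq_mul, Real.norm_eq_abs, mul_assoc]
    gcongr; exact sob_oscH_le k u
  · intro k
    obtain ⟨C, hC0, hC⟩ := sob_vorA_le k
    exact ⟨C, fun u => (hC u).trans (by gcongr; exact sob_le_succ _ u)⟩
  · intro u hu
    obtain ⟨v, hv⟩ := exists_sob_limit u (fun k η hη => by
      obtain ⟨N, hN⟩ := hu k η hη
      exact ⟨N, fun m hm l hl => (sob_mono (by omega : k ≤ k + 2) _).trans_lt (hN m hm l hl)⟩)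
    exact ⟨v, fun k => hv (k + 2)⟩

lemma oscH_add_vorA_injective {ε : ℝ} (hε : ε ≠ 0) {u v : Sch}
    (h : ε • oscH u + vorA u = ε • oscH v + vorA v) : u = v := by
  have h1 := sob_zero_le_of_skew hε (u - v)
  have e : ε • oscH (u - v) + vorA (u - v) = 0 := by
    rw [map_sub, map_sub, smul_sub, sub_add_sub_comm, h, sub_self]
  rw [e, map_zero, mul_zero] at h1
  exact sub_eq_zero.1 (sob_zero_eq_zero (le_antisymm h1 (apply_nonneg _ _)))

/-! ### Rotations and equivariance of the operators -/

/-- The linear rotation of the plane by the angle `α`. -/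
def rotL (α : ℝ) : Plane →ₗ[ℝ] Plane where
  toFun x := !₂[Real.cos α * x 0 - Real.sin α * x 1, Real.sin α * x 0 + Real.cos α * x 1]
  map_add' x y := by ext i; fin_cases i <;> simp <;> ring
  map_smul' c x := by ext i; fin_cases i <;> simp <;> ring

lemma rotL_zero' (α : ℝ) (x : Plane) : rotL α x 0 = Real.cos α * x 0 - Real.sin α * x 1 := rfl

lemma rotL_one' (α : ℝ) (x : Plane) : rotL α x 1 = Real.sin α * x 0 + Real.cos α * x 1 := rfl

lemma plane_ext {x y : Plane} (h0 : x 0 = y 0) (h1 : x 1 = y 1) : x = y := by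
  ext i; fin_cases i <;> assumption

lemma rotL_rotL (α β : ℝ) (x : Plane) : rotL α (rotL β x) = rotL (α + β) x := by
  refine plane_ext ?_ ?_ <;>
    simp only [rotL_zero', rotL_one', Real.cos_add, Real.sin_add] <;> ring

lemma rotL_zero (x : Plane) : rotL 0 x = x := by
  refine plane_ext ?_ ?_ <;> simp [rotL_zero', rotL_one']

lemma norm_rotL (α : ℝ) (x : Plane) : ‖rotL α x‖ = ‖x‖ := by
  rw [← sq_eq_sq₀ (norm_nonneg _) (norm_nonneg _), norm_sq_plane, norm_sq_plane, rotL_zero',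
    rotL_one']
  linear_combination (x 0 ^ 2 + x 1 ^ 2) * Real.sin_sq_add_cos_sq α

/-- The rotation of the plane by the angle `α`. -/
def rot (α : ℝ) : Plane ≃ₗᵢ[ℝ] Plane where
  toLinearEquiv := LinearEquiv.ofLinearMap (rotL α) (rotL (-α))
    (by ext1 x; simp [rotL_rotL, rotL_zero]) (by ext1 x; simp [rotL_rotL, rotL_zero])
  norm_map' x := norm_rotL α x

lemma rot_apply_zero (α : ℝ) (x : Plane) : rot α x 0 = Real.cos α * x 0 - Real.sin α * x 1 := rfl

lemma rot_apply_one (α : ℝ) (x : Plane) : rot α x 1 = Real.sin α * x 0 + Real.cos α * x 1 := rfl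

lemma rot_rot (α β : ℝ) (x : Plane) : rot α (rot β x) = rot (α + β) x := rotL_rotL α β x

lemma rot_zero (x : Plane) : rot 0 x = x := rotL_zero x

/-- Composition of a Schwartz function with a rotation. -/
def rotS (α : ℝ) : Sch →L[ℝ] Sch :=
  SchwartzMap.compCLMOfContinuousLinearEquiv ℝ (rot α).toContinuousLinearEquiv

lemma rotS_apply (α : ℝ) (f : Sch) (x : Plane) : rotS α f x = f (rot α x) := rfl

lemma rotS_rotS (α β : ℝ) (f : Sch) : rotS α (rotS β f) = rotS (α + β) f := by
  ext x; rw [rotS_apply, rotS_apply, rotS_apply, rot_rot, add_comm]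

lemma rotS_zero (f : Sch) : rotS 0 f = f := by ext x; rw [rotS_apply, rot_zero]

lemma fderiv_rotS (α : ℝ) (f : Sch) (x v : Plane) :
    fderiv ℝ (rotS α f) x v = fderiv ℝ f (rot α x) (rot α v) := by
  have h1 : HasFDerivAt (rot α) ((rot α).toContinuousLinearEquiv : Plane →L[ℝ] Plane) x :=
    (rot α).toContinuousLinearEquiv.hasFDerivAt
  have := ((f.hasFDerivAt (rot α x)).comp x h1).fderiv
  change fderiv ℝ (rotS α f) x = _ at this
  rw [this]; rfl

lemma rot_unitVec_zero (α : ℝ) :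
    rot α (unitVec 0) = Real.cos α • unitVec 0 + Real.sin α • unitVec 1 := by
  refine plane_ext ?_ ?_ <;> simp [rot_apply_zero, rot_apply_one, unitVec]

lemma rot_unitVec_one (α : ℝ) :
    rot α (unitVec 1) = -Real.sin α • unitVec 0 + Real.cos α • unitVec 1 := by
  refine plane_ext ?_ ?_ <;> simp [rot_apply_zero, rot_apply_one, unitVec]

lemma pd_zero_rotS (α : ℝ) (f : Sch) :
    pd 0 (rotS α f) = Real.cos α • rotS α (pd 0 f) + Real.sin α • rotS α (pd 1 f) := by
  ext x
  rw [pd_apply, fderiv_rotS, rot_unitVec_zero, map_add, map_smul, map_smul, ← pd_apply, ← pd_apply]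
  rfl

lemma pd_one_rotS (α : ℝ) (f : Sch) :
    pd 1 (rotS α f) = -Real.sin α • rotS α (pd 0 f) + Real.cos α • rotS α (pd 1 f) := by
  ext x
  rw [pd_apply, fderiv_rotS, rot_unitVec_one, map_add, map_smul, map_smul, ← pd_apply, ← pd_apply]
  rfl

lemma xm_zero_rotS (α : ℝ) (f : Sch) :
    xm 0 (rotS α f) = Real.cos α • rotS α (xm 0 f) + Real.sin α • rotS α (xm 1 f) := by
  ext x
  change _ = Real.cos α * xm 0 f (rot α x) + Real.sin α * xm 1 f (rot α x)
  rw [xm_apply, xm_apply, xm_apply, rotS_apply, rot_apply_zero, rot_apply_one]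
  linear_combination -(x 0 * f (rot α x)) * Real.sin_sq_add_cos_sq α

lemma xm_one_rotS (α : ℝ) (f : Sch) :
    xm 1 (rotS α f) = -Real.sin α • rotS α (xm 0 f) + Real.cos α • rotS α (xm 1 f) := by
  ext x
  change _ = -Real.sin α * xm 0 f (rot α x) + Real.cos α * xm 1 f (rot α x)
  rw [xm_apply, xm_apply, xm_apply, rotS_apply, rot_apply_zero, rot_apply_one]
  linear_combination -(x 1 * f (rot α x)) * Real.sin_sq_add_cos_sq α

lemma oscH_rotS (α : ℝ) (f : Sch) : oscH (rotS α f) = rotS α (oscH f) := by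
  have hcs := Real.sin_sq_add_cos_sq α
  ext x
  simp only [oscH_eq, pd_zero_rotS, pd_one_rotS, xm_zero_rotS, xm_one_rotS, map_add, map_smul,
    map_neg, add_apply, neg_apply, smul_apply, smul_eq_mul,
    pd_comm 1 0 f, xm_comm 1 0 f]
  linear_combination (-(rotS α (pd 0 (pd 0 f)) x) - rotS α (pd 1 (pd 1 f)) x +
    1 / 16 * (rotS α (xm 0 (xm 0 f)) x + rotS α (xm 1 (xm 1 f)) x)) * hcs

lemma rot_perp (α : ℝ) (x : Plane) : rot α (perp x) = perp (rot α x) := by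
  refine plane_ext ?_ ?_ <;> simp [rot_apply_zero, rot_apply_one, perp] <;> ring

lemma dth_rotS (α : ℝ) (f : Sch) : dth (rotS α f) = rotS α (dth f) := by
  ext x
  rw [dth_apply, fderiv_rotS, rotS_apply, dth_apply, rot_perp]

lemma rotS_mulS {g : Plane → ℝ} (hg : g.HasTemperateGrowth) (hr : ∀ α x, g (rot α x) = g x)
    (α : ℝ) (f : Sch) : rotS α (mulS g f) = mulS g (rotS α f) := by
  ext x
  rw [rotS_apply, mulS_apply hg, mulS_apply hg, rotS_apply, hr]

lemma gam_rot (α : ℝ) (x : Plane) : gam (rot α x) = gam x := by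
  rw [gam_apply, gam_apply, LinearIsometryEquiv.norm_map]

lemma prof_rot (α : ℝ) (x : Plane) : prof (rot α x) = prof x := by
  rw [prof, prof, LinearIsometryEquiv.norm_map]

lemma bsDot_eq_integral (ω : Sch) (x : Plane) :
    bsDot ω x = ∫ y, (x 1 * y 0 - x 0 * y 1) / ‖y‖ ^ 2 * ω (x - y) := by
  have h := fun i => conv_integrable (bsK_adm i) ω x
  rw [bsDot, conv, conv, ← integral_const_mul, ← integral_const_mul,
    ← integral_add ((h 0).const_mul _) ((h 1).const_mul _)]
  congr 1; ext y
  simp only [smul_eq_mul, bsK, perp_zero, perp_one]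
  ring

lemma bsDot_integrable (ω : Sch) (x : Plane) :
    Integrable fun y => (x 1 * y 0 - x 0 * y 1) / ‖y‖ ^ 2 * ω (x - y) := by
  have h := fun i => conv_integrable (bsK_adm i) ω x
  refine (((h 0).const_mul (x 0)).add ((h 1).const_mul (x 1))).congr
    (Eventually.of_forall fun y => ?_)
  simp only [Pi.add_apply, smul_eq_mul, bsK, perp_zero, perp_one]
  ring

lemma bsDot_rotS (α : ℝ) (ω : Sch) (x : Plane) : bsDot (rotS α ω) x = bsDot ω (rot α x) := by
  rw [bsDot_eq_integral, bsDot_eq_integral]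
  conv_rhs =>
    rw [← (rot α).measurePreserving.integral_comp (rot α).toHomeomorph.measurableEmbedding]
  congr 1; ext y
  rw [rotS_apply, map_sub, LinearIsometryEquiv.norm_map, rot_apply_zero, rot_apply_one,
    rot_apply_zero, rot_apply_one]
  congr 2
  linear_combination -(x 1 * y 0 - x 0 * y 1) * Real.sin_sq_add_cos_sq α

lemma nlA_rotS (α : ℝ) (u : Sch) : nlA (rotS α u) = rotS α (nlA u) := by
  ext x
  rw [rotS_apply, nlA_apply, nlA_apply, gam_rot, ← bsDot_rotS,
    rotS_mulS gam.hasTemperateGrowth gam_rot]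

lemma vorA_rotS (α : ℝ) (u : Sch) : vorA (rotS α u) = rotS α (vorA u) := by
  rw [vorA_eq, vorA_eq, map_sub, map_smul, map_smul, dth_rotS, nlA_rotS,
    rotS_mulS bddSmooth_prof.temperate prof_rot]

lemma sob_rotS_le (k : ℕ) : ∃ C, 0 ≤ C ∧ ∀ α f, sob k (rotS α f) ≤ C * sob k f := by
  induction k with
  | zero =>
    refine ⟨1, zero_le_one, fun α f => ?_⟩
    rw [one_mul, sob_zero_eq_sqrt, sob_zero_eq_sqrt]
    refine le_of_eq (congrArg _ ?_)
    exact (rot α).measurePreserving.integral_comp (rot α).toHomeomorph.measurableEmbedding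
      fun x => f x ^ 2
  | succ k ih =>
    obtain ⟨C, hC0, hC⟩ := ih
    have aux : ∀ (a b : ℝ), |a| ≤ 1 → |b| ≤ 1 → ∀ (α : ℝ) (f g h : Sch),
        sob k f ≤ sob (k + 1) h → sob k g ≤ sob (k + 1) h →
        sob k (a • rotS α f + b • rotS α g) ≤ 2 * C * sob (k + 1) h := by
      intro a b ha hb α f g h hf hg
      refine (map_add_le_add (sob k) _ _).trans ?_
      rw [map_smul_eq_mul, map_smul_eq_mul, Real.norm_eq_abs, Real.norm_eq_abs]
      have h1 : |a| * sob k (rotS α f) ≤ 1 * (C * sob (k + 1) h) := by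
        gcongr; exact (hC α f).trans (by gcongr)
      have h2 : |b| * sob k (rotS α g) ≤ 1 * (C * sob (k + 1) h) := by
        gcongr; exact (hC α g).trans (by gcongr)
      linarith
    refine ⟨9 * C, by positivity, fun α f => ?_⟩
    have hc := Real.abs_cos_le_one α
    have hs := Real.abs_sin_le_one α
    have hs' : |-Real.sin α| ≤ 1 := by rwa [abs_neg]
    rw [sob_succ k (rotS α f), Fin.sum_univ_two, pd_zero_rotS, pd_one_rotS, xm_zero_rotS, xm_one_rotS]
    have h0 := (hC α f).trans (mul_le_mul_of_nonneg_left (sob_le_succ k f) hC0)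
    have h1 := aux _ _ hc hs α _ _ f (sob_pd_le k 0 f) (sob_pd_le k 1 f)
    have h2 := aux _ _ hs' hc α _ _ f (sob_pd_le k 0 f) (sob_pd_le k 1 f)
    have h3 := aux _ _ hc hs α _ _ f (sob_xm_le k 0 f) (sob_xm_le k 1 f)
    have h4 := aux _ _ hs' hc α _ _ f (sob_xm_le k 0 f) (sob_xm_le k 1 f)
    linarith

/-! ### Angular modes -/

/-- The Schwartz functions of angular frequency `n`. -/
def modeS (n : ℕ) : Submodule ℝ Sch where
  carrier := {f | ∀ α, rotS α f + rotS (-α) f = (2 * Real.cos (n * α)) • f}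
  add_mem' {f g} hf hg α := by
    rw [map_add, map_add, smul_add, ← hf α, ← hg α]; abel
  zero_mem' α := by simp
  smul_mem' c f hf α := by
    rw [map_smul, map_smul, ← smul_add, hf α, smul_comm]

lemma modeS_map {n : ℕ} (T : Sch →ₗ[ℝ] Sch) (hT : ∀ α f, T (rotS α f) = rotS α (T f)) {f : Sch}
    (hf : f ∈ modeS n) : T f ∈ modeS n := by
  intro α
  rw [← hT, ← hT, ← map_add, hf α, map_smul]

lemma oscH_mem_modeS {n : ℕ} {f : Sch} (hf : f ∈ modeS n) : oscH f ∈ modeS n :=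
  modeS_map (oscH : Sch →ₗ[ℝ] Sch) oscH_rotS hf

lemma rotS_mem_modeS {n : ℕ} {f : Sch} (β : ℝ) (hf : f ∈ modeS n) : rotS β f ∈ modeS n :=
  modeS_map (rotS β : Sch →ₗ[ℝ] Sch) (fun α f => by simp [rotS_rotS, add_comm]) hf

lemma mulS_mem_modeS {n : ℕ} {f : Sch} {g : Plane → ℝ} (hg : g.HasTemperateGrowth)
    (hr : ∀ α x, g (rot α x) = g x) (hf : f ∈ modeS n) : mulS g f ∈ modeS n :=
  modeS_map (mulS g : Sch →ₗ[ℝ] Sch) (fun α f => (rotS_mulS hg hr α f).symm) hf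

/-- The rotation by a quarter of the angular period. -/
def quarter (n : ℕ) : Sch →L[ℝ] Sch := rotS (Real.pi / (2 * n))

lemma mul_quarter_angle {n : ℕ} (hn : n ≠ 0) : (n : ℝ) * (Real.pi / (2 * n)) = Real.pi / 2 := by
  have : (n : ℝ) ≠ 0 := by exact_mod_cast hn
  field_simp

/-- At the angle π/(2n) the cosine vanishes. The quarter turn thus acts on mode n as a complex
structure. -/
lemma quarter_quarter {n : ℕ} (hn : n ≠ 0) {f : Sch} (hf : f ∈ modeS n) :
    quarter n (quarter n f) = -f := by
  have h := congrArg (quarter n) (hf (Real.pi / (2 * n)))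
  rw [mul_quarter_angle hn, Real.cos_pi_div_two, mul_zero, zero_smul, map_zero, map_add] at h
  have e : quarter n (rotS (-(Real.pi / (2 * n))) f) = f := by
    rw [quarter, rotS_rotS, add_neg_cancel, rotS_zero]
  rw [e] at h
  exact eq_neg_of_add_eq_zero_left h

/-- D'Alembert's equation gives the even part f∘R_γ + f∘R_{-γ}. Applied to rotated copies of f
around the quarter angle, it also gives the odd part, and the two are added. -/
lemma rotS_eq_of_mem_modeS {n : ℕ} (hn : n ≠ 0) {f : Sch} (hf : f ∈ modeS n) (γ : ℝ) :
    rotS γ f = Real.cos (n * γ) • f + Real.sin (n * γ) • quarter n f := by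
  set β := Real.pi / (2 * n) with hβ
  have hnβ : (n : ℝ) * β = Real.pi / 2 := mul_quarter_angle hn
  have h1 := hf γ
  have h2 := rotS_mem_modeS β hf (β - γ)
  have h3 := rotS_mem_modeS (-γ) hf β
  rw [hnβ, Real.cos_pi_div_two, mul_zero, zero_smul, rotS_rotS, rotS_rotS] at h3
  rw [rotS_rotS, rotS_rotS, mul_sub, hnβ, Real.cos_pi_div_two_sub] at h2
  have e1 : β - γ + β = (β + -γ) + β := by ring
  have e2 : -(β - γ) + β = γ := by ring
  have h4 := rotS_mem_modeS (β - γ) hf β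
  rw [hnβ, Real.cos_pi_div_two, mul_zero, zero_smul, rotS_rotS, rotS_rotS] at h4
  have e3 : β + (β - γ) = β - γ + β := by ring
  have e4 : -β + (β - γ) = -γ := by ring
  rw [e3, e4] at h4
  rw [e2, eq_neg_of_add_eq_zero_left h4] at h2
  have h5 : (2 : ℝ) • rotS γ f =
      (2 : ℝ) • (Real.cos (n * γ) • f + Real.sin (n * γ) • quarter n f) := by
    rw [smul_add, smul_smul, smul_smul, ← h1, quarter, ← hβ, ← h2, two_smul]
    abel
  exact (smul_right_injective Sch (two_ne_zero' ℝ)) h5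

/-- Differentiate `rotS_eq_of_mem_modeS` at angle zero. -/
lemma dth_eq_of_mem_modeS {n : ℕ} (hn : n ≠ 0) {f : Sch} (hf : f ∈ modeS n) :
    dth f = (n : ℝ) • quarter n f := by
  ext x
  have hr : HasDerivAt (fun α : ℝ => rot α x) (perp x) 0 := by
    have h1 : HasDerivAt (fun α : ℝ => Real.cos α • x + Real.sin α • perp x)
        (-Real.sin 0 • x + Real.cos 0 • perp x) 0 :=
      ((Real.hasDerivAt_cos 0).smul_const x).add ((Real.hasDerivAt_sin 0).smul_const (perp x))
    simp only [Real.sin_zero, neg_zero, zero_smul, Real.cos_zero, one_smul, zero_add] at h1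
    refine h1.congr_of_eventuallyEq (Eventually.of_forall fun α => ?_)
    refine plane_ext ?_ ?_
    · simp [rot_apply_zero, perp]; ring
    · simp [rot_apply_one, perp]; ring
  have h1 : HasDerivAt (fun α => f (rot α x)) (dth f x) 0 := by
    rw [dth_apply]
    have h2 := (f.hasFDerivAt (rot 0 x)).comp_hasDerivAt 0 hr
    rw [rot_zero] at h2
    exact h2
  have h2 : HasDerivAt (fun α : ℝ => Real.cos (n * α) * f x + Real.sin (n * α) * quarter n f x)
      (n * quarter n f x) 0 := by
    have hl : HasDerivAt (fun α : ℝ => (n : ℝ) * α) n 0 := by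
      simpa using (hasDerivAt_id (0 : ℝ)).const_mul (n : ℝ)
    have := (hl.cos.mul_const (f x)).add (hl.sin.mul_const (quarter n f x))
    simp only [mul_zero, Real.sin_zero, Real.cos_zero, neg_zero, zero_mul, one_mul, zero_add] at this
    exact this
  have e : (fun α => f (rot α x)) =
      fun α : ℝ => Real.cos (n * α) * f x + Real.sin (n * α) * quarter n f x := by
    funext α
    rw [← rotS_apply, rotS_eq_of_mem_modeS hn hf]; rfl
  rw [e] at h1
  exact h1.unique h2

/-! ### The angular integral of the Biot-Savart kernel -/

lemma poisson_den_pos {ρ : ℝ} (h0 : 0 ≤ ρ) (α : ℝ) :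
    (1 - ρ) ^ 2 ≤ 1 - 2 * ρ * Real.cos α + ρ ^ 2 := by
  nlinarith [mul_le_mul_of_nonneg_left (Real.cos_le_one α) h0]

/-- The conjugate Poisson kernel integrated against `sin (nα)`. -/
def conjPoisson (ρ : ℝ) (n : ℕ) : ℝ :=
  ∫ α in (-Real.pi)..Real.pi,
    ρ * Real.sin α * Real.sin (n * α) / (1 - 2 * ρ * Real.cos α + ρ ^ 2)

lemma integral_sin_mul_sin_zero {n : ℕ} (hn : 2 ≤ n) :
    ∫ α in (-Real.pi)..Real.pi, Real.sin α * Real.sin (n * α) = 0 := by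
  have hn1 : (n : ℝ) - 1 ≠ 0 := by
    have : (2 : ℝ) ≤ n := by exact_mod_cast hn
    linarith
  have hn2 : (n : ℝ) + 1 ≠ 0 := by positivity
  have hd : ∀ α ∈ Set.uIcc (-Real.pi) Real.pi, HasDerivAt
      (fun α => Real.sin ((n - 1) * α) / (2 * (n - 1)) - Real.sin ((n + 1) * α) / (2 * (n + 1)))
      (Real.sin α * Real.sin (n * α)) α := by
    intro α _
    have h : ∀ c : ℝ, HasDerivAt (fun α : ℝ => Real.sin (c * α)) (Real.cos (c * α) * c) α :=
      fun c => by simpa using ((hasDerivAt_id α).const_mul c).sin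
    refine ((h _).div_const _ |>.sub ((h _).div_const _)).congr_deriv ?_
    have e1 : Real.cos (((n : ℝ) - 1) * α) = Real.cos (n * α) * Real.cos α +
        Real.sin (n * α) * Real.sin α := by rw [← Real.cos_sub]; ring_nf
    have e2 : Real.cos (((n : ℝ) + 1) * α) = Real.cos (n * α) * Real.cos α -
        Real.sin (n * α) * Real.sin α := by rw [← Real.cos_add]; ring_nf
    rw [e1, e2]
    field_simp
    ring
  rw [intervalIntegral.integral_eq_sub_of_hasDerivAt hd
    ((by fun_prop : Continuous _).intervalIntegrable _ _)]
  have s1 : Real.sin (((n : ℝ) - 1) * Real.pi) = 0 := by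
    have := Real.sin_int_mul_pi ((n : ℤ) - 1)
    push_cast at this; exact this
  have s2 : Real.sin (((n : ℝ) + 1) * Real.pi) = 0 := by
    have := Real.sin_int_mul_pi ((n : ℤ) + 1)
    push_cast at this; exact this
  simp [s1, s2, mul_neg]

lemma integral_sin_mul_sin_one : ∫ α in (-Real.pi)..Real.pi, Real.sin α * Real.sin α = Real.pi := by
  have : (fun α => Real.sin α * Real.sin α) = fun α => Real.sin α ^ 2 := by funext α; ring
  rw [this, integral_sin_sq]
  simp

lemma conjPoisson_continuous {ρ : ℝ} (h0 : 0 ≤ ρ) (h1 : ρ < 1) {g : ℝ → ℝ} (hg : Continuous g) :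
    Continuous fun α => ρ * Real.sin α * g α / (1 - 2 * ρ * Real.cos α + ρ ^ 2) := by
  refine Continuous.div (by fun_prop) (by fun_prop) fun α => ?_
  have := poisson_den_pos h0 α
  have : 0 < (1 - ρ) ^ 2 := by have : 0 < 1 - ρ := by linarith
                               positivity
  linarith

/-- With D the denominator, sin((n+2)α) + sin(nα) = 2 cos α sin((n+1)α) and 2ρ cos α = 1 + ρ² - D;
the term with D cancels the denominator. -/
lemma conjPoisson_rec {ρ : ℝ} (h0 : 0 ≤ ρ) (h1 : ρ < 1) (n : ℕ) :
    ρ * (conjPoisson ρ (n + 2) + conjPoisson ρ n) = (1 + ρ ^ 2) * conjPoisson ρ (n + 1) -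
      ρ * ∫ α in (-Real.pi)..Real.pi, Real.sin α * Real.sin ((n + 1 : ℕ) * α) := by
  have hi : ∀ m : ℕ, IntervalIntegrable (fun α => ρ * Real.sin α * Real.sin (m * α) /
      (1 - 2 * ρ * Real.cos α + ρ ^ 2)) volume (-Real.pi) Real.pi := fun m =>
    (conjPoisson_continuous h0 h1 (by fun_prop)).intervalIntegrable _ _
  rw [conjPoisson, conjPoisson, conjPoisson, ← intervalIntegral.integral_add (hi _) (hi _),
    ← intervalIntegral.integral_const_mul, ← intervalIntegral.integral_const_mul,
    ← intervalIntegral.integral_const_mul, ← intervalIntegral.integral_sub ((hi _).const_mul _)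
      ((by fun_prop : Continuous _).intervalIntegrable _ _)]
  congr 1; ext α
  have hD : (1 - 2 * ρ * Real.cos α + ρ ^ 2) ≠ 0 := by
    have := poisson_den_pos h0 α
    have : 0 < (1 - ρ) ^ 2 := by have : 0 < 1 - ρ := by linarith
                                 positivity
    linarith
  have e1 : Real.sin ((n + 2 : ℕ) * α) = Real.sin ((n + 1 : ℕ) * α) * Real.cos α +
      Real.cos ((n + 1 : ℕ) * α) * Real.sin α := by
    rw [← Real.sin_add]; push_cast; ring_nf
  have e2 : Real.sin (n * α) = Real.sin ((n + 1 : ℕ) * α) * Real.cos α -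
      Real.cos ((n + 1 : ℕ) * α) * Real.sin α := by
    rw [← Real.sin_sub]; push_cast; ring_nf
  rw [e1, e2]
  obtain ⟨D, hD'⟩ : ∃ D, D = 1 - 2 * ρ * Real.cos α + ρ ^ 2 := ⟨_, rfl⟩
  rw [← hD'] at hD ⊢
  field_simp
  rw [hD']
  ring

lemma abs_conjPoisson_le {ρ : ℝ} (h0 : 0 ≤ ρ) (h1 : ρ < 1) (n : ℕ) :
    |conjPoisson ρ n| ≤ 1 / (1 - ρ) ^ 2 * |Real.pi - -Real.pi| := by
  have hp : 0 < (1 - ρ) ^ 2 := by have : 0 < 1 - ρ := by linarith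
                                  positivity
  rw [conjPoisson, ← Real.norm_eq_abs]
  refine intervalIntegral.norm_integral_le_of_norm_le_const fun α _ => ?_
  have hD := poisson_den_pos h0 α
  rw [Real.norm_eq_abs, abs_div, abs_mul, abs_mul, abs_of_nonneg h0,
    abs_of_pos (hp.trans_le hD)]
  gcongr
  calc ρ * |Real.sin α| * |Real.sin (n * α)| ≤ 1 * 1 * 1 := by
        gcongr
        · exact Real.abs_sin_le_one _
        · exact Real.abs_sin_le_one _
    _ = 1 := by norm_num

/-- The recursion has characteristic roots ρ and 1/ρ. The combination c_{n+2} - ρc_{n+1} isolates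
the growing root and must vanish because the integrals are bounded; the remaining geometric sequence
is fixed by its first term. -/
lemma conjPoisson_eq {ρ : ℝ} (h0 : 0 < ρ) (h1 : ρ < 1) (n : ℕ) (hn : n ≠ 0) :
    conjPoisson ρ n = Real.pi * ρ ^ n := by
  have step : ∀ n, conjPoisson ρ (n + 2) - ρ * conjPoisson ρ (n + 1) =
      ρ * (conjPoisson ρ (n + 3) - ρ * conjPoisson ρ (n + 2)) := by
    intro n
    have := conjPoisson_rec h0.le h1 (n + 1)
    rw [integral_sin_mul_sin_zero (by omega)] at this
    linear_combination -this
  have iter : ∀ n m, conjPoisson ρ (n + 2) - ρ * conjPoisson ρ (n + 1) =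
      ρ ^ m * (conjPoisson ρ (n + m + 2) - ρ * conjPoisson ρ (n + m + 1)) := by
    intro n m
    induction m with
    | zero => simp
    | succ m ih => rw [ih, step (n + m), pow_succ]; ring_nf
  have zero : ∀ n, conjPoisson ρ (n + 2) - ρ * conjPoisson ρ (n + 1) = 0 := by
    intro n
    set B := 1 / (1 - ρ) ^ 2 * |Real.pi - -Real.pi|
    have hB : ∀ m, ‖conjPoisson ρ (n + 2) - ρ * conjPoisson ρ (n + 1)‖ ≤ ρ ^ m * (2 * B) := by
      intro m
      rw [iter n m, norm_mul, norm_pow, Real.norm_of_nonneg h0.le, Real.norm_eq_abs]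
      gcongr
      have a1 := abs_conjPoisson_le h0.le h1 (n + m + 2)
      have a2 := abs_conjPoisson_le h0.le h1 (n + m + 1)
      refine (abs_sub _ _).trans ?_
      rw [abs_mul, abs_of_pos h0]
      have : ρ * |conjPoisson ρ (n + m + 1)| ≤ 1 * B := by gcongr
      linarith
    have ht : Tendsto (fun m : ℕ => ρ ^ m * (2 * B)) atTop (𝓝 (0 * (2 * B))) :=
      (tendsto_pow_atTop_nhds_zero_of_lt_one h0.le h1).mul_const _
    rw [zero_mul] at ht
    exact norm_le_zero_iff.1 (ge_of_tendsto' ht hB)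
  have hz : conjPoisson ρ 0 = 0 := by simp [conjPoisson]
  have h2 := zero 0
  have h3 := conjPoisson_rec h0.le h1 0
  have e : ∫ α in (-Real.pi)..Real.pi, Real.sin α * Real.sin ((0 + 1 : ℕ) * α) = Real.pi := by
    simpa using integral_sin_mul_sin_one
  rw [e, hz] at h3
  have hone : conjPoisson ρ 1 = Real.pi * ρ := by
    simp only [zero_add] at h2 h3
    linear_combination -h3 + ρ * h2
  obtain ⟨m, rfl⟩ := Nat.exists_eq_succ_of_ne_zero hn
  clear hn
  induction m with
  | zero => simpa using hone
  | succ m ih =>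
    have := zero m
    rw [Nat.succ_eq_add_one, pow_succ]
    rw [Nat.succ_eq_add_one] at ih
    linear_combination this + ρ * ih

/-- The ratio of the smaller to the larger of two radii. -/
def radRatio (r s : ℝ) : ℝ := min r s / max r s

/-- Dividing by max(r, s)² makes the kernel a conjugate Poisson kernel in ρ = `radRatio r s`. It is
odd in the angle, so only the sine component survives. -/
lemma integral_angular_kernel {r s : ℝ} (hr : 0 < r) (hs : 0 < s) (hrs : s ≠ r) {n : ℕ}
    (hn : n ≠ 0) (a b : ℝ) :
    ∫ α in (-Real.pi)..Real.pi, r * s * Real.sin α / (r ^ 2 + s ^ 2 - 2 * r * s * Real.cos α) *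
      (Real.cos (n * α) * a + Real.sin (n * α) * b) = Real.pi * radRatio r s ^ n * b := by
  set ρ := radRatio r s with hρ
  have hmax : 0 < max r s := lt_max_of_lt_left hr
  have h0 : 0 < ρ := div_pos (lt_min hr hs) hmax
  have h1 : ρ < 1 := by
    rw [hρ, radRatio, div_lt_one hmax]
    exact min_lt_max.2 hrs.symm
  have ek : ∀ α, r * s * Real.sin α / (r ^ 2 + s ^ 2 - 2 * r * s * Real.cos α) =
      ρ * Real.sin α / (1 - 2 * ρ * Real.cos α + ρ ^ 2) := by
    intro α
    have hD : 1 - 2 * ρ * Real.cos α + ρ ^ 2 =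
        (r ^ 2 + s ^ 2 - 2 * r * s * Real.cos α) / max r s ^ 2 := by
      rw [hρ, radRatio]
      rcases le_total r s with h | h
      · rw [min_eq_left h, max_eq_right h]; field_simp; ring
      · rw [min_eq_right h, max_eq_left h]; field_simp; ring
    have hN : ρ * Real.sin α = r * s * Real.sin α / max r s ^ 2 := by
      rw [hρ, radRatio]
      rcases le_total r s with h | h
      · rw [min_eq_left h, max_eq_right h]; field_simp
      · rw [min_eq_right h, max_eq_left h]; field_simp
    rw [hD, hN, div_div_div_cancel_right₀ (by positivity)]
  simp_rw [ek]
  have hc := conjPoisson_eq h0 h1 n hn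
  have i1 : IntervalIntegrable (fun α => ρ * Real.sin α * Real.cos (n * α) /
      (1 - 2 * ρ * Real.cos α + ρ ^ 2)) volume (-Real.pi) Real.pi :=
    (conjPoisson_continuous h0.le h1 (by fun_prop)).intervalIntegrable _ _
  have i2 : IntervalIntegrable (fun α => ρ * Real.sin α * Real.sin (n * α) /
      (1 - 2 * ρ * Real.cos α + ρ ^ 2)) volume (-Real.pi) Real.pi :=
    (conjPoisson_continuous h0.le h1 (by fun_prop)).intervalIntegrable _ _
  have hodd : ∫ α in (-Real.pi)..Real.pi, ρ * Real.sin α * Real.cos (n * α) /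
      (1 - 2 * ρ * Real.cos α + ρ ^ 2) = 0 := by
    have := intervalIntegral.integral_comp_neg (a := -Real.pi) (b := Real.pi)
      (fun α => ρ * Real.sin α * Real.cos (n * α) / (1 - 2 * ρ * Real.cos α + ρ ^ 2))
    simp only [Real.sin_neg, Real.cos_neg, mul_neg, neg_mul, neg_div, neg_neg,
      intervalIntegral.integral_neg] at this
    linarith
  have e : ∀ α, ρ * Real.sin α / (1 - 2 * ρ * Real.cos α + ρ ^ 2) *
      (Real.cos (n * α) * a + Real.sin (n * α) * b) =
      a * (ρ * Real.sin α * Real.cos (n * α) / (1 - 2 * ρ * Real.cos α + ρ ^ 2)) +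
      b * (ρ * Real.sin α * Real.sin (n * α) / (1 - 2 * ρ * Real.cos α + ρ ^ 2)) := fun α => by ring
  simp_rw [e]
  rw [intervalIntegral.integral_add (i1.const_mul _) (i2.const_mul _),
    intervalIntegral.integral_const_mul, intervalIntegral.integral_const_mul, hodd,
    show (∫ α in (-Real.pi)..Real.pi, ρ * Real.sin α * Real.sin (n * α) /
      (1 - 2 * ρ * Real.cos α + ρ ^ 2)) = conjPoisson ρ n from rfl, hc]
  ring

/-! ### Polar coordinates and the velocity bound -/

lemma integral_polarPt {g : Plane → ℝ} (hg : Integrable g) :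
    ∫ x, g x = ∫ s in Set.Ioi (0 : ℝ), ∫ α in (-Real.pi)..Real.pi, s * g (polarPt s α) := by
  have hg' := integrable_comp_planeEquiv hg
  rw [← integral_comp_planeEquiv, ← integral_comp_polarCoord_symm]
  have hi : IntegrableOn (fun p : ℝ × ℝ => p.1 * g (polarPt p.1 p.2)) polarCoord.target := by
    have h1 := (integrableOn_image_iff_integrableOn_abs_det_fderiv_smul (μ := volume)
      polarCoord.open_target.measurableSet
      (fun p _ => (hasFDerivAt_polarCoord_symm p).hasFDerivWithinAt) polarCoord.symm.injOn
      (fun p : ℝ × ℝ => g !₂[p.1, p.2])).1 hg'.integrableOn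
    refine h1.congr_fun (fun p hp => ?_) polarCoord.open_target.measurableSet
    simp only [det_fderivPolarCoordSymm, abs_of_pos (Set.mem_Ioi.1 hp.1), smul_eq_mul]
    rfl
  have e : polarCoord.target = Set.Ioi (0 : ℝ) ×ˢ Set.Ioo (-Real.pi) Real.pi := rfl
  rw [e] at hi
  have := setIntegral_prod (μ := volume) (ν := volume) _ hi
  calc _ = ∫ p in Set.Ioi (0 : ℝ) ×ˢ Set.Ioo (-Real.pi) Real.pi, p.1 * g (polarPt p.1 p.2) := rfl
    _ = _ := this
    _ = _ := by
      congr 1; ext s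
      rw [intervalIntegral.integral_of_le (by linarith [Real.pi_pos]), integral_Ioc_eq_integral_Ioo]

/-- The integral splits at s = r, and each side contributes 1/n. -/
lemma radRatio_integral {r : ℝ} (hr : 0 < r) {n : ℕ} (hn : n ≠ 0) :
    IntegrableOn (fun s => s⁻¹ * radRatio r s ^ n) (Set.Ioi 0) ∧
      ∫ s in Set.Ioi 0, s⁻¹ * radRatio r s ^ n = 2 / n := by
  have hn0 : (n : ℝ) ≠ 0 := by exact_mod_cast hn
  have hnpos : (0 : ℝ) < n := by positivity
  obtain ⟨m, rfl⟩ := Nat.exists_eq_succ_of_ne_zero hn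
  have e1 : ∀ s ∈ Set.Ioc 0 r, (r ^ (m + 1))⁻¹ * s ^ m = s⁻¹ * radRatio r s ^ (m + 1) := by
    intro s hs
    have : s ≠ 0 := hs.1.ne'
    rw [radRatio, min_eq_right hs.2, max_eq_left hs.2, div_pow]
    field_simp
    ring
  have e2 : ∀ s ∈ Set.Ioi r, r ^ (m + 1) * s ^ (-((m : ℝ) + 1) - 1) =
      s⁻¹ * radRatio r s ^ (m + 1) := by
    intro s hs
    have hs0 : 0 < s := hr.trans hs
    rw [radRatio, min_eq_left (le_of_lt hs), max_eq_right (le_of_lt hs), Real.rpow_sub_one hs0.ne',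
      Real.rpow_neg hs0.le]
    have : s ^ ((m : ℝ) + 1) = s ^ (m + 1) := by exact_mod_cast Real.rpow_natCast s (m + 1)
    rw [this, div_pow]
    field_simp
  have ha : -((m : ℝ) + 1) - 1 < -1 := by
    push_cast at hnpos; linarith
  have i1 : IntegrableOn (fun s => s⁻¹ * radRatio r s ^ (m + 1)) (Set.Ioc 0 r) := by
    refine IntegrableOn.congr_fun ?_ e1 measurableSet_Ioc
    exact (by fun_prop : Continuous fun s : ℝ => (r ^ (m + 1))⁻¹ * s ^ m).integrableOn_Ioc
  have i2 : IntegrableOn (fun s => s⁻¹ * radRatio r s ^ (m + 1)) (Set.Ioi r) := by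
    refine IntegrableOn.congr_fun ?_ e2 measurableSet_Ioi
    exact (integrableOn_Ioi_rpow_of_lt ha hr).const_mul _
  have hu : Set.Ioi (0 : ℝ) = Set.Ioc 0 r ∪ Set.Ioi r := (Set.Ioc_union_Ioi_eq_Ioi hr.le).symm
  rw [hu]
  refine ⟨i1.union i2, ?_⟩
  rw [setIntegral_union Set.Ioc_disjoint_Ioi_same measurableSet_Ioi i1 i2,
    ← setIntegral_congr_fun measurableSet_Ioc e1, ← setIntegral_congr_fun measurableSet_Ioi e2,
    integral_const_mul, integral_const_mul, ← intervalIntegral.integral_of_le hr.le, integral_pow,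
    integral_Ioi_rpow_of_lt ha hr, sub_add_cancel, Real.rpow_neg hr.le]
  have : r ^ ((m : ℝ) + 1) = r ^ (m + 1) := by exact_mod_cast Real.rpow_natCast r (m + 1)
  rw [this]
  push_cast at hn0 ⊢
  field_simp
  simp
  ring

lemma polarPt_eq_rot (s α : ℝ) : polarPt s α = rot α (polarPt s 0) := by
  refine plane_ext ?_ ?_ <;> simp [polarPt, rot_apply_zero, rot_apply_one] <;> ring

lemma norm_polarPt {s : ℝ} (hs : 0 ≤ s) (α : ℝ) : ‖polarPt s α‖ = s := by
  rw [← sq_eq_sq₀ (norm_nonneg _) hs, norm_sq_plane]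
  simp only [polarPt, PiLp.toLp_apply, Matrix.cons_val_zero, Matrix.cons_val_one]
  linear_combination s ^ 2 * Real.sin_sq_add_cos_sq α

lemma bsDot_polarPt_zero {r : ℝ} (ω : Sch) :
    Integrable (fun η : Plane => r * η 1 / ‖polarPt r 0 - η‖ ^ 2 * ω η) ∧
      bsDot ω (polarPt r 0) = ∫ η : Plane, r * η 1 / ‖polarPt r 0 - η‖ ^ 2 * ω η := by
  set x := polarPt r 0 with hx
  have h0 : x 0 = r := by simp [hx, polarPt]
  have h1 : x 1 = 0 := by simp [hx, polarPt]
  have e : ∀ η : Plane, (x 1 * (x - η) 0 - x 0 * (x - η) 1) / ‖x - η‖ ^ 2 * ω (x - (x - η)) =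
      r * η 1 / ‖x - η‖ ^ 2 * ω η := by
    intro η
    rw [sub_sub_cancel, h0, PiLp.sub_apply, PiLp.sub_apply, h1]
    ring
  constructor
  · exact ((bsDot_integrable ω x).comp_sub_left x).congr (Eventually.of_forall e)
  · rw [bsDot_eq_integral, ← integral_sub_left_eq_self _ volume x]
    congr 1; ext η
    exact e η

/-- The decisive bound on the velocity of a vorticity of angular frequency `n`. -/
lemma abs_bsDot_polarPt_le {n : ℕ} (hn : n ≠ 0) {ω : Sch} (hω : ω ∈ modeS n) {M : ℝ}
    (hM : ∀ x, ‖x‖ ^ 2 * |ω x| ≤ M) {r : ℝ} (hr : 0 < r) :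
    |bsDot ω (polarPt r 0)| ≤ 2 * Real.pi * M / n := by
  obtain ⟨hi, he⟩ := bsDot_polarPt_zero (r := r) ω
  obtain ⟨ji, je⟩ := radRatio_integral hr hn
  rw [he, integral_polarPt hi, ← Real.norm_eq_abs]
  have e : 2 * Real.pi * M / n = ∫ s in Set.Ioi 0, Real.pi * M * (s⁻¹ * radRatio r s ^ n) := by
    rw [integral_const_mul, je]; ring
  rw [e]
  refine norm_integral_le_of_norm_le (ji.const_mul _) ?_
  -- The angular formula needs distinct radii; the exceptional radius is a null set.
  have hne : ∀ᵐ s ∂(volume.restrict (Set.Ioi (0 : ℝ))), s ≠ r :=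
    ae_restrict_of_ae (by simp [ae_iff])
  filter_upwards [hne, ae_restrict_mem measurableSet_Ioi] with s hsr hs
  have hs0 : 0 < s := hs
  set X := polarPt s 0 with hX
  have hXn : ‖X‖ = s := norm_polarPt hs0.le 0
  have ek : ∀ α, s * (r * polarPt s α 1 / ‖polarPt r 0 - polarPt s α‖ ^ 2 * ω (polarPt s α)) =
      s * (r * s * Real.sin α / (r ^ 2 + s ^ 2 - 2 * r * s * Real.cos α) *
        (Real.cos (n * α) * ω X + Real.sin (n * α) * quarter n ω X)) := by
    intro α
    have e1 : ω (polarPt s α) = Real.cos (n * α) * ω X + Real.sin (n * α) * quarter n ω X := by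
      rw [polarPt_eq_rot, ← rotS_apply, rotS_eq_of_mem_modeS hn hω]; rfl
    have e2 : ‖polarPt r 0 - polarPt s α‖ ^ 2 = r ^ 2 + s ^ 2 - 2 * r * s * Real.cos α := by
      rw [norm_sq_plane]
      simp only [polarPt, PiLp.sub_apply, Matrix.cons_val_zero,
        Matrix.cons_val_one, Real.cos_zero, Real.sin_zero]
      linear_combination s ^ 2 * Real.sin_sq_add_cos_sq α
    rw [e1, e2]
    simp [polarPt, mul_assoc]
  simp_rw [ek]
  rw [intervalIntegral.integral_const_mul, integral_angular_kernel hr hs0 hsr hn, Real.norm_eq_abs,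
    abs_mul, abs_mul, abs_mul, abs_of_pos hs0, abs_of_pos Real.pi_pos]
  have hρ : 0 ≤ radRatio r s := div_nonneg (le_min hr.le hs0.le) (le_max_of_le_left hr.le)
  rw [abs_of_nonneg (pow_nonneg hρ n)]
  -- The quarter turn preserves the radius, so the hypothesis on ω also bounds its conjugate
  -- component.
  have hb : s ^ 2 * |quarter n ω X| ≤ M := by
    have := hM (rot (Real.pi / (2 * n)) X)
    rwa [LinearIsometryEquiv.norm_map, hXn] at this
  calc s * (Real.pi * radRatio r s ^ n * |quarter n ω X|)
      = Real.pi * (s ^ 2 * |quarter n ω X|) * (s⁻¹ * radRatio r s ^ n) := by field_simp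
    _ ≤ Real.pi * M * (s⁻¹ * radRatio r s ^ n) := by
      have := Real.pi_pos
      gcongr

lemma eq_rot_angle (x : Plane) : x = rot (angle x) (polarPt ‖x‖ 0) := by
  rw [← polarPt_eq_rot]
  have hn : ‖(⟨x 0, x 1⟩ : ℂ)‖ = ‖x‖ := by
    rw [← sq_eq_sq₀ (norm_nonneg _) (norm_nonneg _), norm_sq_plane, Complex.sq_norm,
      Complex.normSq_mk]
    ring
  have h0 := Complex.norm_mul_cos_arg ⟨x 0, x 1⟩
  have h1 := Complex.norm_mul_sin_arg ⟨x 0, x 1⟩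
  rw [hn] at h0 h1
  refine plane_ext ?_ ?_
  · simpa [polarPt, angle] using h0.symm
  · simpa [polarPt, angle] using h1.symm

/-- By equivariance the point may be rotated onto the positive half-axis. -/
lemma abs_bsDot_le {n : ℕ} (hn : n ≠ 0) {ω : Sch} (hω : ω ∈ modeS n) {M : ℝ}
    (hM : ∀ x, ‖x‖ ^ 2 * |ω x| ≤ M) (x : Plane) : |bsDot ω x| ≤ 2 * Real.pi * M / n := by
  have hM0 : 0 ≤ M := le_trans (by positivity) (hM 0)
  have hα := eq_rot_angle x
  rcases eq_or_ne x 0 with rfl | hx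
  · simp only [bsDot, PiLp.zero_apply, zero_mul, add_zero, abs_zero]
    have := Real.pi_pos
    positivity
  · rw [hα, ← bsDot_rotS]
    refine abs_bsDot_polarPt_le hn (rotS_mem_modeS _ hω) (fun y => ?_) (norm_pos_iff.2 hx)
    rw [rotS_apply, ← LinearIsometryEquiv.norm_map (rot (angle x)) y]
    exact hM _

/-! ### Inverting the vorticity operator on modes n ≥ 2 -/

lemma prof_eq (x : Plane) : ‖x‖ ^ 2 / 4 * prof x = 1 - gam x ^ 2 := by
  rw [prof, mul_expMoment_zero, gam_apply, ← Real.exp_nat_mul]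
  congr 2
  push_cast; ring

/-- `|ξ|² γ² / (8πφ) = 4t² / (eᵗ - 1)` with `t = |ξ|²/4`. -/
lemma norm_sq_mul_gam_sq_le (x : Plane) : ‖x‖ ^ 2 * gam x ^ 2 ≤ 31 / 10 * prof x := by
  set t := ‖x‖ ^ 2 / 4 with ht
  have ht0 : 0 ≤ t := by positivity
  have hg : gam x ^ 2 = Real.exp (-t) := by
    rw [gam_apply, ← Real.exp_nat_mul]; congr 1; push_cast; rw [ht]; ring
  have hp : t * prof x = 1 - Real.exp (-t) := by rw [ht, prof_eq, hg]
  have he : Real.exp t * Real.exp (-t) = 1 := by rw [← Real.exp_add]; simp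
  have hb : 1 + t + t ^ 2 / 2 + t ^ 3 / 6 ≤ Real.exp t := by
    have := Real.sum_le_exp_of_nonneg ht0 4
    simpa [Finset.sum_range_succ, Nat.factorial] using this
  have hx : ‖x‖ ^ 2 = 4 * t := by rw [ht]; ring
  rw [hg, hx]
  rcases ht0.eq_or_lt with h | h
  · rw [← h]; have := prof_pos x; simp; positivity
  · refine le_of_mul_le_mul_left ?_ h
    have e : t * (31 / 10 * prof x) = 31 / 10 * (Real.exp t - 1) * Real.exp (-t) := by
      linear_combination 31 / 10 * hp - 31 / 10 * he
    rw [e, ← mul_assoc]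
    refine mul_le_mul_of_nonneg_right ?_ (Real.exp_pos _).le
    -- After the cubic Taylor bound for eᵗ, what remains is (31/60)t² - (49/20)t + 31/10 ≥ 0; its
    -- minimum, at t = 147/62, is positive. Any constant below 4 would serve the contraction, and
    -- 31/10 is one for which this cubic suffices.
    nlinarith [mul_nonneg ht0 (sq_nonneg (t - 147 / 62))]

lemma inv_prof_rot (α : ℝ) (x : Plane) : (prof (rot α x))⁻¹ = (prof x)⁻¹ := by rw [prof_rot]

/-- The compact perturbation in the equation for `∂_θ u` equivalent to `A u = f` on functions of
angular frequency `n`. -/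
def nlQ (n : ℕ) : Sch →ₗ[ℝ] Sch :=
  (1 / (2 * Real.pi * n)) • ((mulS fun x => (prof x)⁻¹ : Sch →L[ℝ] Sch) : Sch →ₗ[ℝ] Sch) ∘ₗ
    nlA ∘ₗ (quarter n : Sch →ₗ[ℝ] Sch)

lemma nlQ_eq (n : ℕ) (u : Sch) : nlQ n u =
    (1 / (2 * Real.pi * n)) • mulS (fun x => (prof x)⁻¹) (nlA (quarter n u)) := rfl

lemma nlQ_rotS (n : ℕ) (α : ℝ) (u : Sch) : nlQ n (rotS α u) = rotS α (nlQ n u) := by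
  rw [nlQ_eq, nlQ_eq, map_smul, rotS_mulS inv_prof_temperate inv_prof_rot, ← nlA_rotS, quarter,
    rotS_rotS, rotS_rotS, add_comm]

lemma nlQ_mem_modeS {n : ℕ} {f : Sch} (hf : f ∈ modeS n) : nlQ n f ∈ modeS n :=
  modeS_map (nlQ n) (nlQ_rotS n) hf

lemma mulS_inv_prof_nlA (u : Sch) : mulS (fun x => (prof x)⁻¹) (nlA u) =
    nonlocalOp (bsK 0 0) (mulS (fun x => (prof x)⁻¹) (xm 0 gam)) gam u +
      nonlocalOp (bsK 0 1) (mulS (fun x => (prof x)⁻¹) (xm 1 gam)) gam u := by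
  ext x
  rw [nlA_eq, map_add]
  change mulS _ (nonlocalOp (bsK 0 0) _ _ _) x + mulS _ (nonlocalOp (bsK 0 1) _ _ _) x =
    nonlocalOp (bsK 0 0) _ _ _ x + nonlocalOp (bsK 0 1) _ _ _ x
  simp only [nonlocalOp_apply (bsK_adm _), mulS_apply inv_prof_temperate]
  ring

lemma sob_nlQ_le {n : ℕ} (hn : n ≠ 0) (k : ℕ) : ∃ C, 0 ≤ C ∧ ∀ u, sob k (nlQ n u) ≤ C * sob k u := by
  obtain ⟨C, hC0, hC⟩ := sob_nonlocalOp_bsK_le k 0 (mulS (fun x => (prof x)⁻¹) (xm 0 gam)) gam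
  obtain ⟨D, hD0, hD⟩ := sob_nonlocalOp_bsK_le k 1 (mulS (fun x => (prof x)⁻¹) (xm 1 gam)) gam
  obtain ⟨E, hE0, hE⟩ := sob_rotS_le k
  have := Real.pi_pos
  refine ⟨1 / (2 * Real.pi * n) * ((C + D) * E), by positivity, fun u => ?_⟩
  rw [nlQ_eq, map_smul_eq_mul, Real.norm_of_nonneg (by positivity), mul_assoc (1 / _)]
  refine mul_le_mul_of_nonneg_left ?_ (by positivity)
  rw [mulS_inv_prof_nlA]
  have h1 := hC (quarter n u)
  have h2 := hD (quarter n u)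
  calc _ ≤ C * sob k (quarter n u) + D * sob k (quarter n u) :=
        (map_add_le_add (sob k) _ _).trans (add_le_add h1 h2)
    _ = (C + D) * sob k (quarter n u) := by ring
    _ ≤ (C + D) * (E * sob k u) := by gcongr; exact hE _ u
    _ = _ := by ring

/-- A quantitative form of compactness: the coefficient 1/2 can be absorbed, leaving a term of one
order less. -/
lemma sob_succ_nlQ_le {n : ℕ} (hn : n ≠ 0) (k : ℕ) : ∃ B, 0 ≤ B ∧ ∀ u,
    sob (k + 1) (nlQ n u) ≤ 1 / 2 * sob (k + 1) u + B * sob k u := by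
  obtain ⟨E, hE0, hE⟩ := sob_rotS_le (k + 1)
  obtain ⟨E', hE'0, hE'⟩ := sob_rotS_le k
  have hpi := Real.pi_pos
  have hnpos : (1 : ℝ) ≤ n := by exact_mod_cast Nat.one_le_iff_ne_zero.2 hn
  -- There are two kernel components, each weighted by η, and the quarter turn costs at most E + 1,
  -- so 2η(E + 1) = 1/2.
  set η := 1 / (4 * (E + 1)) with hη
  have hη0 : 0 < η := by positivity
  obtain ⟨C, hC0, hC⟩ := sob_succ_nonlocalOp_bsK_le k 0
    (mulS (fun x => (prof x)⁻¹) (xm 0 gam)) gam hη0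
  obtain ⟨D, hD0, hD⟩ := sob_succ_nonlocalOp_bsK_le k 1
    (mulS (fun x => (prof x)⁻¹) (xm 1 gam)) gam hη0
  refine ⟨(C + D) * E', by positivity, fun u => ?_⟩
  have hc : 1 / (2 * Real.pi * n) ≤ 1 := by
    rw [div_le_one (by positivity)]
    nlinarith [Real.pi_gt_three]
  have h1 := hC (quarter n u)
  have h2 := hD (quarter n u)
  have hs : sob (k + 1) (nlQ n u) ≤ sob (k + 1) (mulS (fun x => (prof x)⁻¹) (nlA (quarter n u))) := by
    rw [nlQ_eq, map_smul_eq_mul, Real.norm_of_nonneg (by positivity)]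
    exact mul_le_of_le_one_left (apply_nonneg _ _) hc
  refine hs.trans ?_
  rw [mulS_inv_prof_nlA]
  have h3 : sob (k + 1) (quarter n u) ≤ (E + 1) * sob (k + 1) u :=
    (hE _ u).trans (by gcongr; linarith)
  have h4 : sob k (quarter n u) ≤ E' * sob k u := hE' _ u
  calc _ ≤ 2 * η * sob (k + 1) (quarter n u) + (C + D) * sob k (quarter n u) := by
        refine (map_add_le_add (sob (k + 1)) _ _).trans ?_
        linarith
    _ ≤ 2 * η * ((E + 1) * sob (k + 1) u) + (C + D) * (E' * sob k u) := by gcongr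
    _ = _ := by rw [hη]; field_simp; ring

/-- The normalised velocity term in `nlQ`. -/
lemma nlQ_apply (n : ℕ) (u : Sch) (x : Plane) : nlQ n u x =
    gam x * (prof x)⁻¹ * (1 / (2 * Real.pi * n) * bsDot (mulS gam (quarter n u)) x) := by
  rw [nlQ_eq]
  change 1 / (2 * Real.pi * n) * mulS (fun x => (prof x)⁻¹) (nlA (quarter n u)) x = _
  rw [mulS_apply inv_prof_temperate, nlA_apply]
  ring

lemma norm_sq_mul_bounded (f : Sch) : ∃ M, ∀ x, ‖x‖ ^ 2 * |f x| ≤ M := by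
  refine ⟨SchwartzMap.seminorm ℝ 2 0 f, fun x => ?_⟩
  have := f.le_seminorm ℝ 2 0 x
  rwa [norm_iteratedFDeriv_zero] at this

/-- The normalisation contributes one factor 1/n and `abs_bsDot_le` another; n² ≥ 4 then produces
the quarter. -/
lemma abs_normalised_le {n : ℕ} (hn : 2 ≤ n) {u : Sch} (hu : u ∈ modeS n) {M : ℝ}
    (hM : ∀ x, ‖x‖ ^ 2 * |gam x * u x| ≤ M) (x : Plane) :
    |1 / (2 * Real.pi * n) * bsDot (mulS gam (quarter n u)) x| ≤ M / 4 := by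
  have hn0 : n ≠ 0 := by omega
  have hpi := Real.pi_pos
  have hn2 : (2 : ℝ) ≤ n := by exact_mod_cast hn
  have hM0 : 0 ≤ M := le_trans (by positivity) (hM 0)
  have h := abs_bsDot_le hn0 (ω := mulS gam (quarter n u))
    (mulS_mem_modeS gam.hasTemperateGrowth gam_rot (rotS_mem_modeS _ hu)) (M := M) (fun y => by
      rw [mulS_sch_apply]
      have := hM (rot (Real.pi / (2 * n)) y)
      rwa [LinearIsometryEquiv.norm_map, gam_rot] at this) x
  rw [abs_mul, abs_of_nonneg (by positivity)]
  calc _ ≤ 1 / (2 * Real.pi * n) * (2 * Real.pi * M / n) := by gcongr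
    _ = M / (n * n) := by field_simp
    _ ≤ M / 4 := by gcongr; nlinarith

/-- The a priori bound behind the invertibility of `1 + nlQ n` for `n ≥ 2`. -/
lemma abs_normalised_apriori {n : ℕ} (hn : 2 ≤ n) {U F : Sch} (hU : U ∈ modeS n) {s : ℝ}
    (hs : s ∈ Set.Icc (0 : ℝ) 1) (h : U + s • nlQ n U = F) {M : ℝ}
    (hM : ∀ x, ‖x‖ ^ 2 * |gam x * F x| ≤ M) (x : Plane) :
    |1 / (2 * Real.pi * n) * bsDot (mulS gam (quarter n U)) x| ≤ 2 * M := by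
  set ψ : Plane → ℝ := fun x => 1 / (2 * Real.pi * n) * bsDot (mulS gam (quarter n U)) x with hψ
  have hM0 : 0 ≤ M := le_trans (by positivity) (hM 0)
  -- The equation gives γU = γF - sγ²ψ/`prof`. By `norm_sq_mul_gam_sq_le`, the last term weighted by
  -- |x|² is at most (31/10)B, so B improves to (M + (31/10)B)/4.
  have step : ∀ B, (∀ x, |ψ x| ≤ B) → ∀ x, |ψ x| ≤ (M + 31 / 10 * B) / 4 := by
    intro B hB
    refine abs_normalised_le hn hU fun y => ?_
    have hpy := prof_pos y
    have e : gam y * U y = gam y * F y - s * (gam y ^ 2 * (prof y)⁻¹ * ψ y) := by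
      have h1 : U y + s * nlQ n U y = F y := by rw [← h]; rfl
      rw [nlQ_apply] at h1
      rw [← h1]; simp only [hψ]; ring
    rw [e]
    have h2 : ‖y‖ ^ 2 * |s * (gam y ^ 2 * (prof y)⁻¹ * ψ y)| ≤ 31 / 10 * B := by
      have hs0 := hs.1
      rw [abs_mul, abs_mul, abs_of_nonneg hs.1, abs_of_nonneg (by positivity)]
      have h3 := norm_sq_mul_gam_sq_le y
      calc ‖y‖ ^ 2 * (s * (gam y ^ 2 * (prof y)⁻¹ * |ψ y|))
          = s * (‖y‖ ^ 2 * gam y ^ 2 * (prof y)⁻¹ * |ψ y|) := by ring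
        _ ≤ 1 * (31 / 10 * prof y * (prof y)⁻¹ * B) := by
          gcongr
          · exact hs.2
          · exact hB y
        _ = _ := by field_simp
    calc ‖y‖ ^ 2 * |gam y * F y - s * (gam y ^ 2 * (prof y)⁻¹ * ψ y)|
        ≤ ‖y‖ ^ 2 * (|gam y * F y| + |s * (gam y ^ 2 * (prof y)⁻¹ * ψ y)|) := by
          gcongr; exact abs_sub _ _
      _ ≤ _ := by rw [mul_add]; exact add_le_add (hM y) h2
  obtain ⟨M', hM'⟩ := norm_sq_mul_bounded (mulS gam U)
  simp only [mulS_sch_apply] at hM'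
  -- The supremum must be finite before it can be absorbed, and decay of U ensures this. Then B ≤ (M
  -- + (31/10)B)/4 gives (9/10)B ≤ M, which is stronger than the stated 2M.
  have hbdd : BddAbove (Set.range fun x => |ψ x|) :=
    ⟨M' / 4, by rintro _ ⟨x, rfl⟩; exact abs_normalised_le hn hU hM' x⟩
  set B := ⨆ x, |ψ x|
  have hB : ∀ x, |ψ x| ≤ B := fun x => le_ciSup hbdd x
  have hB' : B ≤ (M + 31 / 10 * B) / 4 := ciSup_le (step B hB)
  have := hB x
  linarith

/-- The base case turns the supremum bound on the normalised velocity into an L² bound on U; it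
measures F in the supremum norm, hence the 4. Higher orders follow by absorbing the term with
coefficient 1/2. -/
lemma sob_le_of_add_nlQ {n : ℕ} (hn : 2 ≤ n) (k : ℕ) : ∃ C, 0 ≤ C ∧ ∀ s ∈ Set.Icc (0 : ℝ) 1,
    ∀ U ∈ modeS n, sob k U ≤ C * sob (max k 4) (U + s • nlQ n U) := by
  have hn0 : n ≠ 0 := by omega
  induction k with
  | zero =>
    obtain ⟨C, hC0, hC⟩ := abs_le_sob
    obtain ⟨M, hM⟩ := norm_sq_mul_bounded gam
    have hM0 : 0 ≤ M := le_trans (by positivity) (hM 0)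
    set g := mulS (fun x => (prof x)⁻¹) gam with hg
    refine ⟨1 + 2 * M * C * sob 0 g, by positivity, fun s hs U hU => ?_⟩
    set F := U + s • nlQ n U with hF
    rw [show max 0 4 = 4 from rfl]
    have hb := abs_normalised_apriori hn hU hs hF.symm (M := M * (C * sob 4 F)) (fun x => by
      rw [abs_mul, ← mul_assoc]
      gcongr
      · exact hM x
      · exact hC F x)
    have e : U = F - s • nlQ n U := by rw [hF]; abel
    have h1 : sob 0 (nlQ n U) ≤ 2 * (M * (C * sob 4 F)) * sob 0 g := by
      have : 2 * (M * (C * sob 4 F)) * sob 0 g = sob 0 ((2 * (M * (C * sob 4 F))) • g) := by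
        rw [map_smul_eq_mul, Real.norm_of_nonneg (by positivity)]
      rw [this, ← one_mul (sob 0 (_ • g))]
      refine sob_zero_le_of_abs_le zero_le_one fun x => ?_
      rw [one_mul, nlQ_apply]
      change _ ≤ |_ * g x|
      rw [hg, mulS_apply inv_prof_temperate, abs_mul, abs_mul (2 * _),
        abs_of_nonneg (by positivity : 0 ≤ 2 * (M * (C * sob 4 F))), mul_comm (gam x),
        mul_comm (2 * (M * (C * sob 4 F)))]
      gcongr
      exact hb x
    have h2 : sob 0 U ≤ sob 0 F + sob 0 (nlQ n U) := by
      conv_lhs => rw [e]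
      refine (map_sub_le_add (sob 0) _ _).trans ?_
      rw [map_smul_eq_mul, Real.norm_of_nonneg hs.1]
      gcongr
      exact mul_le_of_le_one_left (apply_nonneg _ _) hs.2
    have h3 : sob 0 F ≤ sob 4 F := sob_mono (by norm_num) F
    calc sob 0 U ≤ sob 4 F + 2 * (M * (C * sob 4 F)) * sob 0 g := by linarith
      _ = _ := by ring
  | succ k ih =>
    obtain ⟨C, hC0, hC⟩ := ih
    obtain ⟨B, hB0, hB⟩ := sob_succ_nlQ_le hn0 k
    refine ⟨2 * (1 + B * C), by positivity, fun s hs U hU => ?_⟩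
    set F := U + s • nlQ n U with hF
    have e : U = F - s • nlQ n U := by rw [hF]; abel
    have h2 : sob (k + 1) U ≤ sob (k + 1) F + sob (k + 1) (nlQ n U) := by
      conv_lhs => rw [e]
      refine (map_sub_le_add (sob (k + 1)) _ _).trans ?_
      rw [map_smul_eq_mul, Real.norm_of_nonneg hs.1]
      gcongr
      exact mul_le_of_le_one_left (apply_nonneg _ _) hs.2
    have h3 := hB U
    have h4 : sob (k + 1) F ≤ sob (max (k + 1) 4) F := sob_mono (le_max_left _ _) F
    have h5 : B * sob k U ≤ B * (C * sob (max (k + 1) 4) F) := by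
      gcongr
      refine (hC s hs U hU).trans ?_
      gcongr
      exact sob_mono (max_le_max_right 4 (Nat.le_succ k)) F
    linarith

lemma modeS_of_sob_tendsto {n : ℕ} {u : ℕ → Sch} (hu : ∀ m, u m ∈ modeS n) {v : Sch}
    (hv : Tendsto (fun m => sob 0 (u m - v)) atTop (𝓝 0)) : v ∈ modeS n := by
  intro α
  rw [← sub_eq_zero]
  refine sob_zero_eq_zero (le_antisymm ?_ (apply_nonneg _ _))
  set L : Sch → Sch := fun f => rotS α f + rotS (-α) f - (2 * Real.cos (n * α)) • f with hL
  change sob 0 (L v) ≤ 0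
  obtain ⟨C, hC0, hC⟩ := sob_rotS_le 0
  have h1 : ∀ f, sob 0 (L f) ≤ (2 * C + 2) * sob 0 f := by
    intro f
    have h2 := map_sub_le_add (sob 0) (rotS α f + rotS (-α) f) ((2 * Real.cos (n * α)) • f)
    have h3 := map_add_le_add (sob 0) (rotS α f) (rotS (-α) f)
    have h4 := hC α f
    have h5 := hC (-α) f
    have h6 : sob 0 ((2 * Real.cos (n * α)) • f) ≤ 2 * sob 0 f := by
      rw [map_smul_eq_mul, norm_mul, Real.norm_ofNat]
      have := Real.abs_cos_le_one (n * α)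
      rw [Real.norm_eq_abs]
      gcongr
      linarith
    simp only [hL]
    linarith
  have h2 : ∀ m, sob 0 (L v) ≤ (2 * C + 2) * sob 0 (u m - v) := by
    intro m
    have e : L v = -L (u m - v) := by
      have h0 : L (u m) = 0 := sub_eq_zero.2 (hu m α)
      have : L (u m - v) = L (u m) - L v := by
        simp only [hL, map_sub, smul_sub]; abel
      rw [this, h0, zero_sub, neg_neg]
    rw [e, map_neg_eq_map]
    exact h1 _
  have := (hv.const_mul (2 * C + 2))
  rw [mul_zero] at this
  exact ge_of_tendsto' this h2

/-- The weighted Sobolev seminorms on the functions of angular frequency `n`, with shifted index. -/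
def modeSob (n k : ℕ) : Seminorm ℝ (modeS n) := (sob (k + 4)).comp (modeS n).subtype

lemma modeSob_apply (n k : ℕ) (u : modeS n) : modeSob n k u = sob (k + 4) (u : Sch) := rfl

/-- `nlQ n` as an operator on the functions of angular frequency `n`. -/
def modeQ (n : ℕ) : modeS n →ₗ[ℝ] modeS n := (nlQ n).restrict fun _ hu => nlQ_mem_modeS hu

lemma coe_modeQ (n : ℕ) (u : modeS n) : (modeQ n u : Sch) = nlQ n u := rfl

/-- Invertibility of `1 + nlQ n` on Schwartz functions of angular frequency `n ≥ 2`. -/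
theorem exists_add_nlQ_eq {n : ℕ} (hn : 2 ≤ n) {F : Sch} (hF : F ∈ modeS n) :
    ∃ U ∈ modeS n, U + nlQ n U = F := by
  have hn0 : n ≠ 0 := by omega
  suffices h : ∃ U, (LinearMap.id : modeS n →ₗ[ℝ] modeS n) U + modeQ n U = ⟨F, hF⟩ by
    obtain ⟨U, hU⟩ := h
    exact ⟨U, U.2, congrArg Subtype.val hU⟩
  -- The path starts at the identity and loses no orders. Shifting the index by 4 on both sides
  -- removes the maximum with 4 from the estimate.
  refine surjective_of_continuity _ _ (modeSob n) (modeSob n) ?_ ?_ ?_ ?_ ?_ ?_ ?_ _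
  · intro k f δ hδ
    refine ⟨f, ?_⟩
    rwa [LinearMap.id_apply, sub_self, map_zero]
  · intro k
    obtain ⟨C, hC0, hC⟩ := sob_le_of_add_nlQ hn (k + 4)
    refine ⟨C, fun s hs u => ?_⟩
    have := hC s hs u u.2
    rw [max_eq_left (by omega)] at this
    simpa only [modeSob_apply, LinearMap.id_apply, Submodule.coe_add, Submodule.coe_smul,
      coe_modeQ] using this
  · intro k
    exact ⟨1, fun u => by rw [one_mul, LinearMap.id_apply]⟩
  · intro k
    obtain ⟨C, hC0, hC⟩ := sob_nlQ_le hn0 (k + 4)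
    refine ⟨C, fun u => ?_⟩
    rw [modeSob_apply, modeSob_apply, coe_modeQ]
    exact hC u
  · intro i j hij u
    rw [modeSob_apply, modeSob_apply]
    exact sob_mono (Nat.add_le_add_right hij 4) _
  · intro u hu
    simp only [modeSob_apply, Submodule.coe_sub] at hu ⊢
    obtain ⟨v, hv⟩ := exists_sob_limit (fun m => (u m : Sch)) (fun k η hη => by
      obtain ⟨N, hN⟩ := hu k η hη
      exact ⟨N, fun m hm l hl =>
        (sob_mono (Nat.le_add_right k 4) _).trans_lt (hN m hm l hl)⟩)
    exact ⟨⟨v, modeS_of_sob_tendsto (fun m => (u m).2) (hv 0)⟩, fun k => hv (k + 4)⟩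
  · intro f hf
    rw [modeSob_apply] at hf
    refine Subtype.ext (sob_zero_eq_zero (le_antisymm ?_ (apply_nonneg _ _)))
    rw [← hf]
    exact sob_mono (Nat.zero_le _) _

lemma mulS_prof_inv_prof (f : Sch) : mulS prof (mulS (fun x => (prof x)⁻¹) f) = f := by
  ext x
  rw [mulS_apply bddSmooth_prof.temperate, mulS_apply inv_prof_temperate,
    mul_inv_cancel_left₀ (prof_pos x).ne']

/-- Change of unknown U = ∂_θ u: on mode n, ∂_θ is n times the quarter turn, whose square is -1, so
u = -(1/n) `quarter n` U. Factoring out `prof` leaves U + `nlQ n` U. -/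
lemma vorA_neg_quarter {n : ℕ} (hn : n ≠ 0) {U : Sch} (hU : U ∈ modeS n) :
    vorA (-(1 / n : ℝ) • quarter n U) = (1 / (8 * Real.pi)) • mulS prof (U + nlQ n U) := by
  have hn0 : (n : ℝ) ≠ 0 := by exact_mod_cast hn
  have hpi := Real.pi_ne_zero
  have h1 : dth (-(1 / n : ℝ) • quarter n U) = U := by
    rw [map_smul, dth_eq_of_mem_modeS hn (f := quarter n U) (rotS_mem_modeS _ hU),
      quarter_quarter hn hU, smul_smul, smul_neg, ← neg_smul]
    rw [show -(-(1 / (n : ℝ)) * n) = 1 by field_simp, one_smul]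
  rw [vorA_eq, h1, map_smul, nlQ_eq, map_add, map_smul, mulS_prof_inv_prof, smul_add, smul_smul,
    smul_smul, sub_eq_add_neg, ← neg_smul]
  congr 2
  field_simp
  norm_num

/-- Solvability of `A u = f` on Schwartz functions of angular frequency `n ≥ 2`. -/
theorem exists_vorA_eq {n : ℕ} (hn : 2 ≤ n) {f : Sch} (hf : f ∈ modeS n) :
    ∃ u ∈ modeS n, vorA u = f := by
  have hn0 : n ≠ 0 := by omega
  have hF : (8 * Real.pi) • mulS (fun x => (prof x)⁻¹) f ∈ modeS n :=
    (modeS n).smul_mem _ (mulS_mem_modeS inv_prof_temperate inv_prof_rot hf)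
  obtain ⟨U, hU, hUF⟩ := exists_add_nlQ_eq hn hF
  refine ⟨-(1 / n : ℝ) • quarter n U, (modeS n).smul_mem _ (rotS_mem_modeS _ hU), ?_⟩
  rw [vorA_neg_quarter hn0 hU, hUF, map_smul, mulS_prof_inv_prof, smul_smul,
    one_div_mul_cancel (by have := Real.pi_pos; positivity), one_smul]

lemma eq_zero_of_vorA_eq_zero {n : ℕ} (hn : 2 ≤ n) {u : Sch} (hu : u ∈ modeS n) (h : vorA u = 0) :
    u = 0 := by
  have hn0 : n ≠ 0 := by omega
  have hn' : (n : ℝ) ≠ 0 := by exact_mod_cast hn0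
  have hpi := Real.pi_pos
  set U := (n : ℝ) • quarter n u with hU
  have hUm : U ∈ modeS n := (modeS n).smul_mem _ (rotS_mem_modeS _ hu)
  have e : -(1 / n : ℝ) • quarter n U = u := by
    rw [hU, map_smul, quarter_quarter hn0 hu, smul_smul, smul_neg, ← neg_smul,
      show -(-(1 / (n : ℝ)) * n) = 1 by field_simp, one_smul]
  have h1 := vorA_neg_quarter hn0 hUm
  rw [e, h, eq_comm, smul_eq_zero] at h1
  have h2 : mulS prof (U + nlQ n U) = 0 := h1.resolve_left (by positivity)
  have h3 : U + (1 : ℝ) • nlQ n U = 0 := by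
    rw [one_smul]
    ext x
    have := congrArg (fun f : Sch => f x) h2
    simp only [mulS_apply bddSmooth_prof.temperate] at this
    exact (mul_eq_zero.1 this).resolve_left (prof_pos x).ne'
  obtain ⟨C, hC0, hC⟩ := sob_le_of_add_nlQ hn 0
  have h4 := hC 1 ⟨zero_le_one, le_rfl⟩ U hUm
  rw [h3, map_zero, mul_zero] at h4
  have h5 : U = 0 := sob_zero_eq_zero (le_antisymm h4 (apply_nonneg _ _))
  rw [← e, h5, map_zero, smul_zero]

/-! ### Conjugation of the original operators by the Gaussian -/

/-- Multiplication by the Gaussian weight, which maps the Schwartz space onto `Z`. -/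
def wgt (f : Sch) : Plane → ℝ := mulS gam f

lemma wgt_apply (f : Sch) (x : Plane) : wgt f x = gam x * f x := mulS_sch_apply gam f x

lemma wgt_injective {f g : Sch} (h : wgt f = wgt g) : f = g := by
  ext x
  have := congrFun h x
  rw [wgt_apply, wgt_apply] at this
  exact mul_left_cancel₀ (gam_pos x).ne' this

lemma exp_mul_gam (x : Plane) : Real.exp (‖x‖ ^ 2 / 8) * gam x = 1 := by
  rw [gam_apply, ← Real.exp_add]; ring_nf; simp

lemma mem_Z_iff {w : Plane → ℝ} : w ∈ Z ↔ ∃ f, w = wgt f := by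
  constructor
  · rintro ⟨f, hf⟩
    refine ⟨f, funext fun x => ?_⟩
    rw [wgt_apply, ← hf, ← mul_assoc, mul_comm (gam x), exp_mul_gam, one_mul]
  · rintro ⟨f, rfl⟩
    refine ⟨f, fun x => ?_⟩
    rw [wgt_apply, ← mul_assoc, exp_mul_gam, one_mul]

lemma pd_mulS_gam (i : Fin 2) (f : Sch) :
    pd i (mulS gam f) = mulS gam (pd i f - (1 / 4 : ℝ) • xm i f) := by
  ext x
  rw [pd_mulS gam.hasTemperateGrowth, map_sub, map_smul]
  change mulS _ f x + mulS gam (pd i f) x = mulS gam (pd i f) x - 1 / 4 * mulS gam (xm i f) x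
  have e : (fun x => fderiv ℝ gam x (unitVec i)) = pd i gam := by
    funext x; rw [pd_apply]
  rw [e, mulS_sch_apply, mulS_sch_apply, mulS_sch_apply, xm_apply, pd_gam]
  change -(1 / 4) * xm i gam x * f x + _ = _
  rw [xm_apply]; ring

lemma laplacian_eq_pd (f : Sch) (x : Plane) :
    Laplacian.laplacian (f : Plane → ℝ) x = pd 0 (pd 0 f) x + pd 1 (pd 1 f) x := by
  have h1 : Laplacian.laplacian (f : Plane → ℝ) x = (Laplacian.laplacian f : Sch) x :=
    (SchwartzMap.laplacian_apply f x).symm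
  rw [h1, SchwartzMap.laplacian_eq_sum (EuclideanSpace.basisFun (Fin 2) ℝ), Fin.sum_univ_two]
  simp only [EuclideanSpace.basisFun_apply]
  rfl

lemma fderiv_apply_eq (f : Sch) (x v : Plane) : fderiv ℝ f x v = v 0 * pd 0 f x + v 1 * pd 1 f x := by
  have e : v = v 0 • unitVec 0 + v 1 • unitVec 1 := by
    refine plane_ext ?_ ?_ <;> simp [unitVec]
  conv_lhs => rw [e]
  rw [map_add, map_smul, map_smul, ← pd_apply, ← pd_apply]
  rfl

/-- Conjugation replaces ∂_i by ∂_i - x_i/4. The cross term of the Laplacian then cancels the drift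
½ξ·∇. -/
lemma wgt_sub_calL (f : Sch) : wgt f - calL (wgt f) = wgt (oscH f) := by
  funext x
  rw [Pi.sub_apply, calL, wgt, wgt, laplacian_eq_pd, fderiv_apply_eq]
  simp only [pd_mulS_gam, map_sub, map_smul, pd_xm, if_true, mulS_sch_apply, oscH_eq, map_add, map_neg,
    xm_apply, pd_apply, sub_apply, add_apply, smul_apply, neg_apply, smul_eq_mul]
  ring

lemma dth_mulS_gam (f : Sch) : dth (mulS gam f) = mulS gam (dth f) := by
  ext x
  simp only [dth_eq, pd_mulS_gam, sub_apply, xm_apply, mulS_sch_apply, smul_apply, smul_eq_mul]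
  ring

lemma vG_eq (x : Plane) : vG x = (1 / (8 * Real.pi) * prof x) • perp x := by
  rcases eq_or_ne x 0 with rfl | hx
  · have : perp (0 : Plane) = 0 := by refine plane_ext ?_ ?_ <;> simp [perp]
    simp [vG, this]
  · have hn : ‖x‖ ≠ 0 := norm_ne_zero_iff.2 hx
    rw [vG]
    congr 1
    have h1 : ‖x‖ ^ 2 / 4 * prof x = 1 - Real.exp (-‖x‖ ^ 2 / 4) := by
      rw [prof, mul_expMoment_zero, neg_div]
    rw [← h1]
    field_simp
    ring

lemma G_eq : G = ((1 / (4 * Real.pi)) • gaussS (1 / 4) (by norm_num) : Sch) := by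
  funext x
  change _ = 1 / (4 * Real.pi) * gaussS (1 / 4) _ x
  rw [G, gaussS_apply]
  congr 2; ring

lemma fderiv_G (x v : Plane) :
    fderiv ℝ G x v = -(1 / (8 * Real.pi)) * gam x ^ 2 * inner ℝ x v := by
  have hg : gam x ^ 2 = gaussS (1 / 4) (by norm_num) x := by
    rw [gam_apply, gaussS_apply, ← Real.exp_nat_mul]; congr 1; push_cast; ring
  have e : G = fun x => 1 / (4 * Real.pi) * gaussS (1 / 4) (by norm_num) x := G_eq
  rw [e, fderiv_const_mul (SchwartzMap.differentiableAt _), smul_apply, fderiv_gaussS, hg,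
    smul_eq_mul]
  ring

lemma inner_plane (x y : Plane) : inner ℝ x y = x 0 * y 0 + x 1 * y 1 := by
  rw [EuclideanSpace.inner_eq_star_dotProduct]
  simp [dotProduct, Fin.sum_univ_two]
  ring

lemma inner_biotSavart (ω : Sch) (x : Plane) :
    inner ℝ x (biotSavart ω x) = 1 / (2 * Real.pi) * bsDot ω x := by
  have e : ∀ y, (ω (x - y) / ‖y‖ ^ 2) • perp y =
      (bsK 0 0 y * ω (x - y)) • unitVec 0 + (bsK 0 1 y * ω (x - y)) • unitVec 1 := by
    intro y
    refine plane_ext ?_ ?_ <;> simp [unitVec, bsK, perp] <;> ring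
  have hi : Integrable fun y => (ω (x - y) / ‖y‖ ^ 2) • perp y := by
    simp_rw [e]
    exact ((conv_integrable (bsK_adm 0) ω x).smul_const _).add
      ((conv_integrable (bsK_adm 1) ω x).smul_const _)
  have hs : ∫ η : Plane, (ω η / ‖x - η‖ ^ 2) • perp (x - η) =
      ∫ y : Plane, (ω (x - y) / ‖y‖ ^ 2) • perp y := by
    rw [← integral_sub_left_eq_self _ volume x]
    simp only [sub_sub_cancel]
  rw [biotSavart, inner_smul_right, hs, ← integral_inner hi, bsDot_eq_integral]
  congr 2; ext y
  rw [inner_smul_right, inner_plane, perp_zero, perp_one]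
  ring

/-- The field v^G is tangential, so it does not differentiate γ. As ∇G = -(8π)⁻¹γ²x, only the radial
component x · v of the velocity enters, and one of the two factors γ is left for A. -/
lemma Lam_wgt (f : Sch) : Lam (wgt f) = wgt (vorA f) := by
  funext x
  rw [Lam, vG_eq, map_smul, fderiv_G, wgt, wgt, inner_biotSavart, ← dth_apply, dth_mulS_gam,
    vorA_eq, mulS_sch_apply, mulS_sch_apply]
  simp only [sub_apply, smul_apply, smul_eq_mul, mulS_apply bddSmooth_prof.temperate, nlA_apply]
  have := Real.pi_ne_zero
  field_simp
  ring

lemma normY_wgt (f : Sch) : normY (wgt f) = sob 0 f := by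
  rw [normY, sob_zero_eq_sqrt]
  congr 2; ext x
  rw [wgt_apply]
  have h : Real.exp (‖x‖ ^ 2 / 4) = Real.exp (‖x‖ ^ 2 / 8) ^ 2 := by
    rw [← Real.exp_nat_mul]; congr 1; push_cast; ring
  have := exp_mul_gam x
  rw [h]
  calc (gam x * f x) ^ 2 * Real.exp (‖x‖ ^ 2 / 8) ^ 2
      = (Real.exp (‖x‖ ^ 2 / 8) * gam x) ^ 2 * f x ^ 2 := by ring
    _ = _ := by rw [this]; ring

lemma wgt_mem_Y (f : Sch) : wgt f ∈ Y := by
  refine ⟨(mulS gam f).memLp 2 volume, ?_⟩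
  have h1 : Integrable fun x => f x ^ 2 := (f.memLp 2 volume).integrable_sq
  refine h1.congr (Eventually.of_forall fun x => ?_)
  have h : Real.exp (‖x‖ ^ 2 / 4) = Real.exp (‖x‖ ^ 2 / 8) ^ 2 := by
    rw [← Real.exp_nat_mul]; congr 1; push_cast; ring
  have := exp_mul_gam x
  change f x ^ 2 = wgt f x ^ 2 * Real.exp (‖x‖ ^ 2 / 4)
  rw [h, wgt_apply]
  calc f x ^ 2 = (Real.exp (‖x‖ ^ 2 / 8) * gam x) ^ 2 * f x ^ 2 := by rw [this]; ring
    _ = _ := by ring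

lemma wgt_add (f g : Sch) : wgt (f + g) = wgt f + wgt g := by
  rw [wgt, map_add]; rfl

lemma wgt_sub (f g : Sch) : wgt (f - g) = wgt f - wgt g := by
  rw [wgt, map_sub]; rfl

lemma wgt_smul (c : ℝ) (f : Sch) : wgt (c • f) = c • wgt f := by
  rw [wgt, map_smul]; rfl

/-! ### The projection P_n and the angular modes -/

lemma integral_cos_mul_cos {n : ℕ} (hn : n ≠ 0) (A : ℝ) :
    ∫ θ in (0 : ℝ)..(2 * Real.pi), Real.cos (n * θ) * Real.cos (n * (A - θ)) =
      Real.pi * Real.cos (n * A) := by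
  have hn0 : (n : ℝ) ≠ 0 := by exact_mod_cast hn
  have hd : ∀ θ ∈ Set.uIcc (0 : ℝ) (2 * Real.pi), HasDerivAt
      (fun θ => Real.cos (n * A) / 2 * θ + Real.sin (2 * n * θ - n * A) / (4 * n))
      (Real.cos (n * θ) * Real.cos (n * (A - θ))) θ := by
    intro θ _
    have h1 : HasDerivAt (fun θ : ℝ => 2 * n * θ - n * A) (2 * n) θ := by
      simpa using ((hasDerivAt_id θ).const_mul (2 * (n : ℝ))).sub_const (n * A)
    have h2 : HasDerivAt (fun θ : ℝ => Real.cos (n * A) / 2 * θ) (Real.cos (n * A) / 2) θ := by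
      simpa using (hasDerivAt_id θ).const_mul (Real.cos (n * A) / 2)
    refine (h2.add (h1.sin.div_const _)).congr_deriv ?_
    have e1 : Real.cos (n * A) = Real.cos (n * θ) * Real.cos (n * (A - θ)) -
        Real.sin (n * θ) * Real.sin (n * (A - θ)) := by rw [← Real.cos_add]; ring_nf
    have e2 : Real.cos (2 * n * θ - n * A) = Real.cos (n * θ) * Real.cos (n * (A - θ)) +
        Real.sin (n * θ) * Real.sin (n * (A - θ)) := by rw [← Real.cos_sub]; ring_nf
    rw [e1, e2]
    field_simp
    ring
  rw [intervalIntegral.integral_eq_sub_of_hasDerivAt hd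
    ((by fun_prop : Continuous _).intervalIntegrable _ _)]
  have : Real.sin (2 * n * (2 * Real.pi) - n * A) = Real.sin (2 * n * 0 - n * A) := by
    have := Real.sin_add_nat_mul_two_pi (2 * n * 0 - n * A) (2 * n)
    rw [← this]; push_cast; ring_nf
  rw [this]
  ring

lemma integral_sin_mul_cos {n : ℕ} (hn : n ≠ 0) (A : ℝ) :
    ∫ θ in (0 : ℝ)..(2 * Real.pi), Real.sin (n * θ) * Real.cos (n * (A - θ)) =
      Real.pi * Real.sin (n * A) := by
  have hn0 : (n : ℝ) ≠ 0 := by exact_mod_cast hn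
  have hd : ∀ θ ∈ Set.uIcc (0 : ℝ) (2 * Real.pi), HasDerivAt
      (fun θ => Real.sin (n * A) / 2 * θ - Real.cos (2 * n * θ - n * A) / (4 * n))
      (Real.sin (n * θ) * Real.cos (n * (A - θ))) θ := by
    intro θ _
    have h1 : HasDerivAt (fun θ : ℝ => 2 * n * θ - n * A) (2 * n) θ := by
      simpa using ((hasDerivAt_id θ).const_mul (2 * (n : ℝ))).sub_const (n * A)
    have h2 : HasDerivAt (fun θ : ℝ => Real.sin (n * A) / 2 * θ) (Real.sin (n * A) / 2) θ := by
      simpa using (hasDerivAt_id θ).const_mul (Real.sin (n * A) / 2)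
    refine (h2.sub (h1.cos.div_const _)).congr_deriv ?_
    have e1 : Real.sin (n * A) = Real.sin (n * θ) * Real.cos (n * (A - θ)) +
        Real.cos (n * θ) * Real.sin (n * (A - θ)) := by rw [← Real.sin_add]; ring_nf
    have e2 : Real.sin (2 * n * θ - n * A) = Real.sin (n * θ) * Real.cos (n * (A - θ)) -
        Real.cos (n * θ) * Real.sin (n * (A - θ)) := by rw [← Real.sin_sub]; ring_nf
    rw [e1, e2]
    field_simp
    ring
  rw [intervalIntegral.integral_eq_sub_of_hasDerivAt hd
    ((by fun_prop : Continuous _).intervalIntegrable _ _)]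
  have : Real.cos (2 * n * (2 * Real.pi) - n * A) = Real.cos (2 * n * 0 - n * A) := by
    have := Real.cos_add_nat_mul_two_pi (2 * n * 0 - n * A) (2 * n)
    rw [← this]; push_cast; ring_nf
  rw [this]
  ring

lemma P_eq_self_of_mem_modeS {n : ℕ} (hn : n ≠ 0) {f : Sch} (hf : f ∈ modeS n) :
    P n (f : Plane → ℝ) = f := by
  funext x
  set X := polarPt ‖x‖ 0
  have hpol : ∀ θ, f (polarPt ‖x‖ θ) = Real.cos (n * θ) * f X + Real.sin (n * θ) * quarter n f X := by
    intro θ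
    rw [polarPt_eq_rot, ← rotS_apply, rotS_eq_of_mem_modeS hn hf]; rfl
  have hx : f x = Real.cos (n * angle x) * f X + Real.sin (n * angle x) * quarter n f X := by
    rw [← hpol, polarPt_eq_rot, ← eq_rot_angle]
  rw [P, if_neg hn]
  simp_rw [hpol]
  have e : ∀ θ, (Real.cos (n * θ) * f X + Real.sin (n * θ) * quarter n f X) *
      Real.cos (n * (angle x - θ)) = f X * (Real.cos (n * θ) * Real.cos (n * (angle x - θ))) +
      quarter n f X * (Real.sin (n * θ) * Real.cos (n * (angle x - θ))) := fun θ => by ring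
  simp_rw [e]
  rw [intervalIntegral.integral_add ((by fun_prop : Continuous _).intervalIntegrable _ _)
    ((by fun_prop : Continuous _).intervalIntegrable _ _), intervalIntegral.integral_const_mul,
    intervalIntegral.integral_const_mul, integral_cos_mul_cos hn, integral_sin_mul_cos hn, hx]
  have := Real.pi_ne_zero
  field_simp
  ring

/-- The principal argument is additive only up to 2πk; this is harmless in `P_rot` because n is an
integer. -/
lemma angle_rot {x : Plane} (hx : x ≠ 0) (α : ℝ) :
    ∃ k : ℤ, angle (rot α x) = angle x + α + 2 * Real.pi * k := by
  have hn : ‖x‖ ≠ 0 := norm_ne_zero_iff.2 hx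
  have h1 : polarPt ‖x‖ (angle (rot α x)) = polarPt ‖x‖ (angle x + α) := by
    have := eq_rot_angle (rot α x)
    rw [LinearIsometryEquiv.norm_map, ← polarPt_eq_rot] at this
    rw [← this, polarPt_eq_rot _ (angle x + α), add_comm (angle x), ← rot_rot, ← eq_rot_angle]
  have hc : Real.cos (angle (rot α x)) = Real.cos (angle x + α) := by
    have := congrArg (fun y : Plane => y 0) h1
    exact mul_left_cancel₀ hn this
  have hs : Real.sin (angle (rot α x)) = Real.sin (angle x + α) := by
    have := congrArg (fun y : Plane => y 1) h1
    exact mul_left_cancel₀ hn this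
  obtain ⟨k, hk⟩ := Real.Angle.angle_eq_iff_two_pi_dvd_sub.1 (Real.Angle.cos_sin_inj hc hs)
  exact ⟨k, by linarith⟩

lemma P_rot (n : ℕ) (w : Plane → ℝ) {x : Plane} (hx : x ≠ 0) (α : ℝ) :
    P n w (rot α x) = (2 - if n = 0 then 1 else 0) / (2 * Real.pi) *
      ∫ θ in (0 : ℝ)..(2 * Real.pi),
        w (polarPt ‖x‖ θ) * Real.cos (n * (angle x - θ) + n * α) := by
  rw [P, LinearIsometryEquiv.norm_map]
  obtain ⟨k, hk⟩ := angle_rot hx α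
  have e : ∀ θ : ℝ, Real.cos (n * (angle (rot α x) - θ)) =
      Real.cos (n * (angle x - θ) + n * α) := by
    intro θ
    rw [hk, ← Real.cos_add_int_mul_two_pi (n * (angle x - θ) + n * α) (n * k)]
    push_cast; ring_nf
  simp_rw [e]

/-- The addition formula for the cosine, applied under the integral: everything produced by P_n
satisfies the relation defining `modeS`. -/
lemma P_rot_add {n : ℕ} {w : Plane → ℝ} (hw : Continuous w) {x : Plane} (hx : x ≠ 0) (α : ℝ) :
    P n w (rot α x) + P n w (rot (-α) x) = 2 * Real.cos (n * α) * P n w x := by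
  have hpol : ∀ r : ℝ, Continuous fun θ => w (polarPt r θ) := by
    intro r
    refine hw.comp ?_
    unfold polarPt
    fun_prop
  have hi : ∀ β : ℝ, IntervalIntegrable (fun θ =>
      w (polarPt ‖x‖ θ) * Real.cos (n * (angle x - θ) + n * β)) volume 0 (2 * Real.pi) := fun β =>
    ((hpol _).mul (by fun_prop)).intervalIntegrable _ _
  rw [P_rot n w hx, P_rot n w hx, ← mul_add, ← intervalIntegral.integral_add (hi _) (hi _), P]
  have e : ∀ θ : ℝ, w (polarPt ‖x‖ θ) * Real.cos (n * (angle x - θ) + n * α) +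
      w (polarPt ‖x‖ θ) * Real.cos (n * (angle x - θ) + n * -α) =
      2 * Real.cos (n * α) * (w (polarPt ‖x‖ θ) * Real.cos (n * (angle x - θ))) := by
    intro θ
    rw [mul_neg, ← sub_eq_add_neg, Real.cos_add, Real.cos_sub]; ring
  simp_rw [e]
  rw [intervalIntegral.integral_const_mul]
  ring

/-- Rotations preserve null sets, so the relation for P_n f passes to f almost everywhere, and
continuity makes it hold everywhere. -/
lemma mem_modeS_of_P_ae_eq {n : ℕ} {f : Sch} (hf : P n (f : Plane → ℝ) =ᵐ[volume] f) :
    f ∈ modeS n := by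
  intro α
  have hq : ∀ β, (fun x => P n f (rot β x)) =ᵐ[volume] fun x => f (rot β x) := fun β =>
    (rot β).measurePreserving.quasiMeasurePreserving.ae_eq_comp hf
  have h0 : ∀ᵐ x : Plane ∂volume, x ≠ 0 := by simp [ae_iff]
  have hae : (fun x => f (rot α x) + f (rot (-α) x)) =ᵐ[volume]
      fun x => 2 * Real.cos (n * α) * f x := by
    filter_upwards [hq α, hq (-α), hf, h0] with x h1 h2 h3 hx
    rw [← h1, ← h2, ← h3]
    exact P_rot_add f.continuous hx α
  have := (Continuous.ae_eq_iff_eq volume (by fun_prop) (by fun_prop)).1 hae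
  ext x
  exact congrFun this x

lemma wgt_mem_Yn_iff {n : ℕ} (hn : n ≠ 0) {f : Sch} : wgt f ∈ Yn n ↔ f ∈ modeS n := by
  constructor
  · rintro ⟨_, h⟩
    have h1 : mulS gam f ∈ modeS n := mem_modeS_of_P_ae_eq h
    intro α
    have h2 := h1 α
    rw [rotS_mulS gam.hasTemperateGrowth gam_rot, rotS_mulS gam.hasTemperateGrowth gam_rot,
      ← map_add, ← map_smul] at h2
    exact wgt_injective (congrArg (fun f : Sch => (f : Plane → ℝ)) h2)
  · intro hf
    refine ⟨wgt_mem_Y f, ?_⟩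
    rw [wgt, P_eq_self_of_mem_modeS hn (mulS_mem_modeS gam.hasTemperateGrowth gam_rot hf)]

lemma mem_Yn_inter_Z_iff {n : ℕ} (hn : n ≠ 0) {w : Plane → ℝ} :
    w ∈ Yn n ∩ Z ↔ ∃ f ∈ modeS n, w = wgt f := by
  constructor
  · rintro ⟨h1, h2⟩
    obtain ⟨f, rfl⟩ := mem_Z_iff.1 h2
    exact ⟨f, (wgt_mem_Yn_iff hn).1 h1, rfl⟩
  · rintro ⟨f, hf, rfl⟩
    exact ⟨(wgt_mem_Yn_iff hn).2 hf, mem_Z_iff.2 ⟨f, rfl⟩⟩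

/-! ### Solutions within a mode and the rate of convergence -/

lemma resolvent_wgt (ε : ℝ) (f : Sch) :
    ε • (wgt f - calL (wgt f)) + Lam (wgt f) = wgt (ε • oscH f + vorA f) := by
  rw [wgt_sub_calL, Lam_wgt, wgt_add, wgt_smul]

/-- Both sides of the mode relation for f solve the same equation, because the operators commute
with rotations; uniqueness makes them equal. -/
lemma exists_mem_modeS_oscH_add_vorA_eq {n : ℕ} {ε : ℝ} (hε : ε ≠ 0) {g : Sch}
    (hg : g ∈ modeS n) : ∃ f ∈ modeS n, ε • oscH f + vorA f = g := by
  obtain ⟨f, hf⟩ := exists_oscH_add_vorA_eq hε g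
  refine ⟨f, fun α => oscH_add_vorA_injective hε ?_, hf⟩
  have e : ∀ β, ε • oscH (rotS β f) + vorA (rotS β f) = rotS β g := by
    intro β
    rw [oscH_rotS, vorA_rotS, ← map_smul, ← map_add, hf]
  calc ε • oscH (rotS α f + rotS (-α) f) + vorA (rotS α f + rotS (-α) f)
      = (ε • oscH (rotS α f) + vorA (rotS α f)) +
        (ε • oscH (rotS (-α) f) + vorA (rotS (-α) f)) := by
          rw [map_add, map_add, smul_add]; abel
    _ = (2 * Real.cos (n * α)) • (ε • oscH f + vorA f) := by rw [e, e, hf, hg α]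
    _ = _ := by rw [map_smul, map_smul, smul_add, smul_comm]

/-- Convergence rate of the regularised solutions. -/
lemma exists_sob_zero_sub_le {n : ℕ} (hn : 2 ≤ n) {f₀ : Sch} (hf₀ : f₀ ∈ modeS n) :
    ∃ C, 0 < C ∧ ∀ ε : ℝ, ε ≠ 0 → ∀ f, ε • oscH f + vorA f = vorA f₀ →
      sob 0 (f - f₀) ≤ C * |ε| / (1 + |ε|) := by
  -- The corrector: f₀ - εf₁ solves the regularised equation up to an error of order ε², whereas f₀
  -- alone leaves an error of order ε.
  obtain ⟨f₁, -, h₁⟩ := exists_vorA_eq hn (oscH_mem_modeS hf₀)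
  -- The first summand comes from the bound on f - f₀ without corrector, multiplied by |ε|; the next
  -- two come from the corrected bound. The final 1 only makes the constant positive.
  refine ⟨2 * sob 0 (oscH f₀) + 2 * sob 0 (oscH f₁) + sob 0 f₁ + 1, by positivity,
    fun ε hε f hf => ?_⟩
  have hε' : 0 < |ε| := abs_pos.2 hε
  have e1 : ε • oscH (f - f₀) + vorA (f - f₀) = (-ε) • oscH f₀ := by
    rw [map_sub, map_sub, smul_sub, sub_add_sub_comm, hf, neg_smul]; abel
  have e2 : ε • oscH (f - f₀ + ε • f₁) + vorA (f - f₀ + ε • f₁) = (ε ^ 2) • oscH f₁ := by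
    rw [map_add, map_add, smul_add, add_add_add_comm, e1, map_smul, map_smul, h₁, smul_smul,
      neg_smul, pow_two]
    abel
  have b1 := sob_zero_le_of_skew hε (f - f₀)
  rw [e1, map_smul_eq_mul, norm_neg, Real.norm_eq_abs, ← mul_assoc, div_mul_cancel₀ _ hε'.ne'] at b1
  have b2 := sob_zero_le_of_skew hε (f - f₀ + ε • f₁)
  rw [e2, map_smul_eq_mul, norm_pow, Real.norm_eq_abs, ← mul_assoc,
    show 2 / |ε| * |ε| ^ 2 = 2 * |ε| by field_simp] at b2
  have b3 : sob 0 (f - f₀) ≤ sob 0 (f - f₀ + ε • f₁) + |ε| * sob 0 f₁ := by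
    have := map_sub_le_add (sob 0) (f - f₀ + ε • f₁) (ε • f₁)
    rwa [add_sub_cancel_right, map_smul_eq_mul, Real.norm_eq_abs] at this
  rw [le_div_iff₀ (by positivity)]
  nlinarith

end

end OseenVortex

open OseenVortex

theorem lemma3p4 (n : ℕ) (hn : 2 ≤ n) (z : Plane → ℝ) (hz : z ∈ Yn n ∩ Z) :
    ∃ w : Plane → ℝ,
      -- `w` is the solution of `Λ w = z`
      (w ∈ Yn n ∩ Z ∧ Lam w = z ∧ ∀ w' ∈ Yn n ∩ Z, Lam w' = z → w' = w) ∧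
      (∀ ε : ℝ, ε ≠ 0 →
        ∃! wε : Plane → ℝ, wε ∈ Yn n ∩ Z ∧ ε • (wε - calL wε) + Lam wε = z) ∧
      ∃ C : ℝ, 0 < C ∧ ∀ ε : ℝ, ε ≠ 0 → ∀ wε ∈ Yn n ∩ Z,
        ε • (wε - calL wε) + Lam wε = z →
          normY (wε - w) ≤ C * |ε| / (1 + |ε|) := by
  have hn0 : n ≠ 0 := by omega
  obtain ⟨g, hg, rfl⟩ := (mem_Yn_inter_Z_iff hn0).1 hz
  obtain ⟨f₀, hf₀, rfl⟩ := exists_vorA_eq hn hg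
  refine ⟨wgt f₀, ⟨(mem_Yn_inter_Z_iff hn0).2 ⟨f₀, hf₀, rfl⟩, Lam_wgt f₀, ?_⟩, ?_, ?_⟩
  · intro w' hw' h
    obtain ⟨f', hf', rfl⟩ := (mem_Yn_inter_Z_iff hn0).1 hw'
    rw [Lam_wgt] at h
    have h1 : vorA (f' - f₀) = 0 := by rw [map_sub, wgt_injective h, sub_self]
    rw [sub_eq_zero.1 (eq_zero_of_vorA_eq_zero hn ((modeS n).sub_mem hf' hf₀) h1)]
  · intro ε hε
    obtain ⟨f, hf, hfe⟩ := exists_mem_modeS_oscH_add_vorA_eq hε hg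
    refine ⟨wgt f, ⟨(mem_Yn_inter_Z_iff hn0).2 ⟨f, hf, rfl⟩, by rw [resolvent_wgt, hfe]⟩, ?_⟩
    rintro w' ⟨hw', h⟩
    obtain ⟨f', hf', rfl⟩ := (mem_Yn_inter_Z_iff hn0).1 hw'
    rw [resolvent_wgt] at h
    rw [oscH_add_vorA_injective hε ((wgt_injective h).trans hfe.symm)]
  · obtain ⟨C, hC0, hC⟩ := exists_sob_zero_sub_le hn hf₀
    refine ⟨C, hC0, fun ε hε w' hw' h => ?_⟩
    obtain ⟨f', hf', rfl⟩ := (mem_Yn_inter_Z_iff hn0).1 hw'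
    rw [resolvent_wgt] at h
    rw [← wgt_sub, normY_wgt]
    exact hC ε hε f' (wgt_injective h)
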